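/- Let $D=\mathbb C$ or $D=\mathbb R\oplus\mathbb R$, let $x\mapsto\bar x$ be its nontrivial involution (complex conjugation, resp. the swap), and let $\eta=\eta_D:\mathbb R^\times\to\{\pm1\}$ be the sign character if $D=\mathbb C$ and trivial if $D=\mathbb R\oplus\mathbb R$. Let $\psi:\mathbb R\to\mathbb C^\times$ be a nontrivial continuous unitary character and let $n\ge 1$. Let $H=H^n(D)$ be the real vector space of Hermitian $n\times n$ matrices over $D$, with the bilinear form $B(x,y)=\operatorname{Tr}(x\,w\,y\,w)$, where $w$ is the antidiagonal permutation matrix. For $f\in\mathcal S(H)$ let $\mathcal F(f)(y)=\int_H f(x)\,\psi(-B(x,y))\,dx$, with $dx$ the Haar measure that is self-dual for $(B,\psi)$. Let $N$ be the group of upper unitriangular matrices over $D$ with its Lebesgue measure $du$, let $\chi_\psi(u)=\psi\big(\sum_{i=1}^{n-1}(u_{i,i+1}+\bar u_{i,i+1})\big)$, let $A\cong(\mathbb R^\times)^n$ be the group of invertible real diagonal matrices, and let $\sigma(x)=\prod_{i=1}^{n-1}\Delta_i(x)$, where $\Delta_i$ is the leading principal $i\times i$ minor. For $a\in A$ put $$\widetilde\Omega^{\psi}(f)(a)=\eta(\sigma(a))\,|\sigma(a)|\int_N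 f(\bar u^{t}au)\,\chi_\psi(u)\,du .$$ These integrals converge absolutely for $f\in\mathcal S(H)$. Let $c(D,\psi)$ be the constant of the Weil formula: for every $a\in\mathbb R^\times$, the Fourier transform (with respect to $\psi$, the form $(x,y)\mapsto x\bar y+\bar xy$ on $D$, and its self-dual measure) of the distribution $\psi(ax\bar x)$ on $D$ is $|a|^{-1}\eta_D(a)\,c(D,\psi)\,\psi(-x\bar x/a)$. All integrals over $\mathbb R$ below are with respect to the Haar measure self-dual for $\psi$ and the form $(x,y)\mapsto xy$. **Jacquet space and Jacquet transform.** Let $M=\{(a_1,\dots,a_n)\in\mathbb R^n: a_1,\dots,a_{n-1}\ne0\}$, and let $\mathcal S^{\mathrm{fib}}$ be the space of smooth functions $h$ on $M$ such that for every Schwartz function $g$ on $(\mathbb R^\times)^{n-1}$ the function $a\mapsto g(a_1,\dots,a_{n-1})h(a)$ is a Schwartz function on $M$; such $h$ are regarded as functions on $A\subset M$ by restriction. (A Schwartz function on $M$ or on $(\mathbb R^\times)^{n-1}$ is the restriction of a Schwartz function on $\mathbb R^n$, resp. $\mathbb R^{n-1}$, vanishing with all derivatives on the complement.) Let $\mathcal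 F_n h(a_1,\dots,a_n)=\int h(a_1,\dots,a_{n-1},p)\,\psi(-a_np)\,dp$, and for $1\le i<n$ let $$(\mathcal J^{(i)}h)(a_1,\dots,a_n)=(\mathcal F_nh)(a_1,\dots,a_{i-1},a_{i+1},\dots,a_n,a_i)\;\psi\!\left(\frac1{a_ia_n}\right).$$ Put $\mathfrak J^{[1]}=\mathcal S^{\mathrm{fib}}$, $\mathcal J^{[1]}=\mathcal F_n$, and, for $2\le i\le n$, $\mathfrak J^{[i]}=\{h\in\mathcal S^{\mathrm{fib}}:\mathcal J^{(n+1-i)}h\in\mathfrak J^{[i-1]}\}$ and $\mathcal J^{[i]}=\mathcal J^{[i-1]}\circ\mathcal J^{(n+1-i)}$. The Jacquet space is $\mathfrak J=\mathfrak J^{[n]}$ and the Jacquet transform is $\mathcal J=\mathcal J^{[n]}$. **Theorem (inversion formula, Jacquet).** The constants $c(D,\psi)$ and $c(D,\bar\psi)$ exist, and for every $f\in\mathcal S(H)$: (1) For all $a_1,\dots,a_n\in\mathbb R^\times$, $$\widetilde\Omega^{\bar\psi}(\mathcal F(f))(\operatorname{diag}(a_1,\dots,a_n))=c(D,\bar\psi)^{n(n-1)/2}\int\!\cdots\!\int\widetilde\Omega^{\psi}(f)(\operatorname{diag}(p_1,\dots,p_n))\,\psi\Big(-\sum_{i=1}^na_{n+1-i}p_i+\sum_{i=1}^{n-1}\frac1{a_{n-i}p_i}\Big)\,dp_n\cdots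 dp_1 ,$$ where the right-hand side converges as an iterated integral: the integral over $p_n$, then over $p_{n-1}$, and so on down to $p_1$, each converges absolutely for all nonzero values of the remaining variables. (2) $\widetilde\Omega^{\psi}(f)\in\mathfrak J$, and on $A$ $$\mathcal J(\widetilde\Omega^{\psi}(f))=c(D,\psi)^{n(n-1)/2}\;\widetilde\Omega^{\bar\psi}(\mathcal F(f)).$$ -/

import Mathlib

open MeasureTheory SchwartzMap
open scoped ContDiff

/-! ### The two semisimple quadratic algebras over `ℝ` -/

/-- The two semisimple two-dimensional real algebras: `ℂ` and `ℝ ⊕ ℝ`. -/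
inductive QuadAlg : Type
  | complex : QuadAlg
  | split : QuadAlg

/-- The underlying set of the algebra `D`. -/
def QuadAlg.Carrier : QuadAlg → Type
  | .complex => ℂ
  | .split => ℝ × ℝ

noncomputable instance QuadAlg.instNormedCommRing : (D : QuadAlg) → NormedCommRing D.Carrier
  | .complex => inferInstanceAs (NormedCommRing ℂ)
  | .split => inferInstanceAs (NormedCommRing (ℝ × ℝ))

noncomputable instance QuadAlg.instNormedAlgebra : (D : QuadAlg) → NormedAlgebra ℝ D.Carrier
  | .complex => inferInstanceAs (NormedAlgebra ℝ ℂ)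
  | .split => inferInstanceAs (NormedAlgebra ℝ (ℝ × ℝ))

noncomputable instance QuadAlg.instMeasureSpace : (D : QuadAlg) → MeasureSpace D.Carrier
  | .complex => inferInstanceAs (MeasureSpace ℂ)
  | .split => inferInstanceAs (MeasureSpace (ℝ × ℝ))

instance QuadAlg.instBorelSpace : (D : QuadAlg) → BorelSpace D.Carrier
  | .complex => inferInstanceAs (BorelSpace ℂ)
  | .split => inferInstanceAs (BorelSpace (ℝ × ℝ))

/-- The nontrivial involution `x ↦ x̄` of `D`: complex conjugation, respectively the swap of the
two coordinates. -/
def QuadAlg.conj : (D : QuadAlg) → D.Carrier → D.Carrier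
  | .complex => fun z : ℂ => (starRingEnd ℂ z : ℂ)
  | .split => fun z : ℝ × ℝ => ((z.2, z.1) : ℝ × ℝ)

instance QuadAlg.instStarRing (D : QuadAlg) : StarRing D.Carrier where
  star := D.conj
  star_involutive x := by
    cases D
    · have h : ∀ x : ℂ, star (star x) = x := star_star
      exact h x
    · rfl
  star_mul x y := by
    cases D
    · have h : ∀ x y : ℂ, star (x * y) = star y * star x := star_mul
      exact h x y
    · exact Prod.ext (mul_comm (G := ℝ) _ _) (mul_comm (G := ℝ) _ _)
  star_add x y := by
    cases D
    · have h : ∀ x y : ℂ, star (x + y) = star x + star y := star_add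
      exact h x y
    · rfl

instance QuadAlg.instStarModule (D : QuadAlg) : StarModule ℝ D.Carrier where
  star_smul r x := by
    cases D
    · exact star_smul (A := ℂ) r x
    · rfl

/-- The character `η_D` of `ℝˣ`: the sign if `D = ℂ`, trivial if `D = ℝ ⊕ ℝ`. -/
noncomputable def QuadAlg.eta : QuadAlg → ℝ → ℝ
  | .complex => fun a => (SignType.sign a : ℝ)
  | .split => fun _ => 1

/-- The trace `x + x̄` of `x ∈ D`, as a real number. -/
noncomputable def QuadAlg.tr (D : QuadAlg) (x : D.Carrier) : ℝ := Algebra.trace ℝ D.Carrier x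

/-- For `x = x̄ ∈ D`, the real number that `x` is. -/
noncomputable def QuadAlg.toReal (D : QuadAlg) (x : D.Carrier) : ℝ := D.tr x / 2

/-! ### Self-dual measures and Fourier transforms -/

/-- `μ` is a Haar measure on `V` which is self-dual for the bilinear form `B` and the additive
character `ψ`: Fourier inversion holds with `μ` used for both transforms. -/
def IsSelfDual {V : Type*} [NormedAddCommGroup V] [NormedSpace ℝ V] [MeasurableSpace V]
    (B : V → V → ℝ) (ψ : AddChar ℝ Circle) (μ : Measure V) : Prop :=
  μ.IsAddHaarMeasure ∧ ∀ (f : 𝓢(V, ℂ)) (z : V),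
    ∫ y, (∫ x, f x * (ψ (-B x y) : ℂ) ∂μ) * (ψ (B z y) : ℂ) ∂μ = f z

/-- The self-dual Haar measure on `V` with respect to `B` and `ψ`. -/
noncomputable def selfDualHaar {V : Type*} [NormedAddCommGroup V] [NormedSpace ℝ V]
    [MeasurableSpace V] (B : V → V → ℝ) (ψ : AddChar ℝ Circle) : Measure V :=
  Classical.epsilon fun μ => IsSelfDual B ψ μ

/-- The Fourier transform with respect to `B` and `ψ` and the self-dual Haar measure. -/
noncomputable def fourierB {V : Type*} [NormedAddCommGroup V] [NormedSpace ℝ V]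
    [MeasurableSpace V] (B : V → V → ℝ) (ψ : AddChar ℝ Circle) (f : V → ℂ) (y : V) : ℂ :=
  ∫ x, f x * (ψ (-B x y) : ℂ) ∂(selfDualHaar B ψ)

/-- The self-dual Haar measure on `ℝ` with respect to `(x, y) ↦ x y`. -/
noncomputable def haarReal (ψ : AddChar ℝ Circle) : Measure ℝ :=
  selfDualHaar (fun x y : ℝ => x * y) ψ

/-- The form `(x, y) ↦ x ȳ + x̄ y` on `D`. -/
noncomputable def QuadAlg.form (D : QuadAlg) (x y : D.Carrier) : ℝ := D.tr (x * star y)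

/-- `c` is the constant of the one-dimensional Weil formula: for every `a ≠ 0`, the Fourier
transform of the distribution `ψ(a x x̄)` on `D` is `|a|⁻¹ η_D(a) c ψ(-x x̄ / a)`. -/
def IsWeilConstant (D : QuadAlg) (ψ : AddChar ℝ Circle) (c : ℂ) : Prop :=
  ∀ a : ℝ, a ≠ 0 → ∀ φ : 𝓢(D.Carrier, ℂ),
    ∫ x, (ψ (a * D.toReal (x * star x)) : ℂ) * fourierB D.form ψ φ x ∂(selfDualHaar D.form ψ) =
      ∫ x, ((|a|⁻¹ * D.eta a : ℝ) : ℂ) * c * (ψ (-D.toReal (x * star x) / a) : ℂ) * φ x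
        ∂(selfDualHaar D.form ψ)

/-! ### Hermitian matrices and Kloosterman integrals -/

attribute [local instance] Matrix.normedAddCommGroup Matrix.normedSpace

/-- The real vector space `H^n(D)` of Hermitian `n × n` matrices over `D`. -/
abbrev Herm (D : QuadAlg) (n : ℕ) : Type :=
  selfAdjoint.submodule ℝ (Matrix (Fin n) (Fin n) D.Carrier)

noncomputable instance Herm.instMeasurableSpace (D : QuadAlg) (n : ℕ) : MeasurableSpace (Herm D n) := borel _

instance Herm.instBorelSpace (D : QuadAlg) (n : ℕ) : BorelSpace (Herm D n) := ⟨rfl⟩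

/-- The antidiagonal permutation matrix `w_n`. -/
noncomputable def wMat (D : QuadAlg) (n : ℕ) : Matrix (Fin n) (Fin n) D.Carrier :=
  Matrix.of fun i j => if j = i.rev then 1 else 0

/-- The bilinear form `B(x, y) = Tr(x w y w)` on `H^n(D)`. -/
noncomputable def hermForm (D : QuadAlg) (n : ℕ) (x y : Herm D n) : ℝ :=
  D.toReal (Matrix.trace (x.1 * wMat D n * y.1 * wMat D n))

/-- The Fourier transform on `H^n(D)`. -/
noncomputable def fourierH {D : QuadAlg} {n : ℕ} (ψ : AddChar ℝ Circle) (f : Herm D n → ℂ) :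
    Herm D n → ℂ :=
  fourierB (hermForm D n) ψ f

/-- The leading principal `i × i` minor. -/
noncomputable def leadMinor {D : QuadAlg} {n : ℕ} (i : ℕ) (x : Herm D n) : ℝ :=
  D.toReal (x.1.submatrix (Subtype.val : {j : Fin n // (j : ℕ) < i} → Fin n) Subtype.val).det

/-- The product of the leading principal minors of sizes `1, …, n - 1`. -/
noncomputable def sigmaH {D : QuadAlg} {n : ℕ} (x : Herm D n) : ℝ :=
  ∏ i ∈ Finset.Icc 1 (n - 1), leadMinor i x

/-- The diagonal matrix `diag(a_1, …, a_n)` in `H^n(D)`. -/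
noncomputable def diagH (D : QuadAlg) {n : ℕ} (a : Fin n → ℝ) : Herm D n :=
  ⟨Matrix.diagonal fun i => algebraMap ℝ D.Carrier (a i), by
    change star _ = _
    rw [Matrix.star_eq_conjTranspose, Matrix.diagonal_conjTranspose]
    congr 1
    funext i
    simp [Algebra.algebraMap_eq_smul_one]⟩

/-- Positions strictly above the diagonal. -/
abbrev UpperIdx (n : ℕ) : Type := {p : Fin n × Fin n // p.1 < p.2}

/-- The upper unitriangular matrix with given entries above the diagonal; this identifies
`N^n(D)` with `D^(n(n-1)/2)` and its Haar measure with Lebesgue measure. -/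
noncomputable def unip {D : QuadAlg} {n : ℕ} (v : UpperIdx n → D.Carrier) : Matrix (Fin n) (Fin n) D.Carrier :=
  Matrix.of fun i j => if h : i < j then v ⟨(i, j), h⟩ else if i = j then 1 else 0

/-- The action `x ↦ ūᵗ x u` on Hermitian matrices. -/
noncomputable def hermAct {D : QuadAlg} {n : ℕ} (u : Matrix (Fin n) (Fin n) D.Carrier) (x : Herm D n) :
    Herm D n :=
  ⟨u.conjTranspose * x.1 * u, by
    have hx : x.1.conjTranspose = x.1 := x.2
    change (u.conjTranspose * x.1 * u).conjTranspose = _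
    rw [Matrix.conjTranspose_mul, Matrix.conjTranspose_mul, Matrix.conjTranspose_conjTranspose,
      hx, Matrix.mul_assoc]⟩

/-- The character `χ_ψ(u) = ψ(∑ (u_{i,i+1} + ū_{i,i+1}))` of `N^n(D)`. -/
noncomputable def chiN {D : QuadAlg} {n : ℕ} (ψ : AddChar ℝ Circle)
    (u : Matrix (Fin n) (Fin n) D.Carrier) : ℂ :=
  (ψ (∑ i : Fin n, ∑ j : Fin n, if (i : ℕ) + 1 = j then D.tr (u i j) else 0) : ℂ)

/-- The integrand `u ↦ Ψ(ūᵗ a u) χ_ψ(u)` of the Kloosterman integral. -/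
noncomputable def kloosIntegrand {D : QuadAlg} {n : ℕ} (ψ : AddChar ℝ Circle)
    (Ψ : Herm D n → ℂ) (a : Fin n → ℝ) (v : UpperIdx n → D.Carrier) : ℂ :=
  Ψ (hermAct (unip v) (diagH D a)) * chiN ψ (unip v)

/-- The Kloosterman integral `Ω^ψ(Ψ)(diag a)`. -/
noncomputable def kloos {D : QuadAlg} {n : ℕ} (ψ : AddChar ℝ Circle) (Ψ : Herm D n → ℂ)
    (a : Fin n → ℝ) : ℂ :=
  ∫ v : UpperIdx n → D.Carrier, kloosIntegrand ψ Ψ a v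

/-- The normalized Kloosterman integral `η(σ(a)) |σ(a)| Ω^ψ(Ψ)(diag a)`. -/
noncomputable def kloosNorm {D : QuadAlg} {n : ℕ} (ψ : AddChar ℝ Circle) (Ψ : Herm D n → ℂ)
    (a : Fin n → ℝ) : ℂ :=
  ((D.eta (sigmaH (diagH D a)) * |sigmaH (diagH D a)| : ℝ) : ℂ) * kloos ψ Ψ a

/-! ### Iterated integrals -/

/-- The iterated integral `∫ ⋯ ∫ G(p_1, …, p_n) dp_n ⋯ dp_1` (the last variable innermost). -/
noncomputable def iterInt (μ : Measure ℝ) : (n : ℕ) → ((Fin n → ℝ) → ℂ) → ℂ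
  | 0, G => G Fin.elim0
  | n + 1, G => iterInt μ n fun p => ∫ x, G (Fin.snoc p x) ∂μ

/-- Convergence of the iterated integral: each of the successive one-variable integrals converges
absolutely, for all nonzero values of the variables not yet integrated. -/
def IterIntegrable (μ : Measure ℝ) : (n : ℕ) → ((Fin n → ℝ) → ℂ) → Prop
  | 0, _ => True
  | n + 1, G => (∀ p : Fin n → ℝ, (∀ i, p i ≠ 0) → Integrable (fun x => G (Fin.snoc p x)) μ) ∧
      IterIntegrable μ n fun p => ∫ x, G (Fin.snoc p x) ∂μ

/-- The phase `-∑_{i=1}^n a_{n+1-i} p_i + ∑_{i=1}^{n-1} 1 / (a_{n-i} p_i)`, for `n = m + 1`. -/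
noncomputable def inversionPhase {m : ℕ} (a p : Fin (m + 1) → ℝ) : ℝ :=
  -(∑ i : Fin (m + 1), a i.rev * p i) + ∑ i : Fin m, 1 / (a i.rev.castSucc * p i.castSucc)

/-! ### The Jacquet space and the Jacquet transform -/

/-- All derivatives of `g`, including `g` itself, vanish off `U`. A Schwartz function on an open
semialgebraic subset `U` of a vector space is (the restriction of) a Schwartz function `g` on the
vector space which is flat in this sense. -/
def FlatOff {E : Type*} [NormedAddCommGroup E] [NormedSpace ℝ E] (U : Set E) (g : E → ℂ) : Prop :=
  ∀ x ∉ U, ∀ k : ℕ, iteratedFDeriv ℝ k g x = 0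

/-- `f` restricts to a Schwartz function on the open semialgebraic set `U`. -/
def IsSchwartzOn {E : Type*} [NormedAddCommGroup E] [NormedSpace ℝ E] (U : Set E) (f : E → ℂ) :
    Prop :=
  ∃ g : 𝓢(E, ℂ), FlatOff U g ∧ ∀ x ∈ U, g x = f x

/-- The set `(ℝˣ)^m`; for `m = n` it is identified with the group `A^n` of diagonal matrices. -/
def torus (m : ℕ) : Set (Fin m → ℝ) := {a | ∀ i, a i ≠ 0}

/-- The diagonal matrices `diag(a_1, …, a_n)` with `a_1, …, a_{n-1}` nonzero, for `n = m + 1`. -/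
def partialTorus (m : ℕ) : Set (Fin (m + 1) → ℝ) := {a | Fin.init a ∈ torus m}

/-- The function `h` on `A^n` (`n = m + 1`) extends to a smooth function on
`M = {a_1, …, a_{n-1} ≠ 0}` which is Schwartz along the fibers of
`M → (ℝˣ)^{n-1}, a ↦ (a_1, …, a_{n-1})`: its product with the pullback of any Schwartz function
on `(ℝˣ)^{n-1}` is a Schwartz function on `M`. -/
def IsFiberSchwartz {m : ℕ} (h : (Fin (m + 1) → ℝ) → ℂ) : Prop :=
  ∃ H : (Fin (m + 1) → ℝ) → ℂ, (∀ a ∈ torus (m + 1), H a = h a) ∧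
    ContDiffOn ℝ ∞ H (partialTorus m) ∧
    ∀ g : 𝓢(Fin m → ℝ, ℂ), FlatOff (torus m) g →
      IsSchwartzOn (partialTorus m) fun a => g (Fin.init a) * H a

/-- The Fourier transform in the last coordinate. -/
noncomputable def fourierLast {m : ℕ} (ψ : AddChar ℝ Circle) (h : (Fin (m + 1) → ℝ) → ℂ) :
    (Fin (m + 1) → ℝ) → ℂ :=
  fun a => fourierB (fun x y : ℝ => x * y) ψ (fun p => h (Fin.snoc (Fin.init a) p))
    (a (Fin.last m))

/-- The elementary operator: Fourier transform in the last coordinate, then move the last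
coordinate to position `i` and multiply by a phase,
`(a_1, …, a_n) ↦ (F h)(a_1, …, a_{i-1}, a_{i+1}, …, a_n, a_i) ψ(1 / (a_i a_n))`. -/
noncomputable def jacquetStep {m : ℕ} (ψ : AddChar ℝ Circle) (i : Fin (m + 1))
    (h : (Fin (m + 1) → ℝ) → ℂ) : (Fin (m + 1) → ℝ) → ℂ :=
  fun a => fourierLast ψ h (Fin.snoc (i.removeNth a) (a i)) * (ψ (1 / (a i * a (Fin.last m))) : ℂ)

/-- For `n = m + 1`, the step with (one-based) position `n - k`, in terms of `k`; it is used for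
`1 ≤ k ≤ n - 1`. -/
noncomputable def jacquetStepAt {m : ℕ} (ψ : AddChar ℝ Circle) (k : ℕ)
    (h : (Fin (m + 1) → ℝ) → ℂ) : (Fin (m + 1) → ℝ) → ℂ :=
  jacquetStep ψ ⟨m - k, Nat.lt_succ_of_le (Nat.sub_le m k)⟩ h

/-- Membership in the intermediate Jacquet space with superscript `[k + 1]`. -/
def MemJacquet {m : ℕ} (ψ : AddChar ℝ Circle) : ℕ → ((Fin (m + 1) → ℝ) → ℂ) → Prop
  | 0, h => IsFiberSchwartz h
  | k + 1, h => IsFiberSchwartz h ∧ MemJacquet ψ k (jacquetStepAt ψ (k + 1) h)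

/-- The intermediate Jacquet transform with superscript `[k + 1]`. -/
noncomputable def jacquetIter {m : ℕ} (ψ : AddChar ℝ Circle) :
    ℕ → ((Fin (m + 1) → ℝ) → ℂ) → ((Fin (m + 1) → ℝ) → ℂ)
  | 0, h => fourierLast ψ h
  | k + 1, h => jacquetIter ψ k (jacquetStepAt ψ (k + 1) h)

/-- The Jacquet space of functions on `A^n`, `n = m + 1`. -/
def JacquetSpace (m : ℕ) (ψ : AddChar ℝ Circle) : Set ((Fin (m + 1) → ℝ) → ℂ) :=
  {h | MemJacquet ψ m h}

/-- The Jacquet transform, for `n = m + 1`. -/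
noncomputable def jacquetTransform {m : ℕ} (ψ : AddChar ℝ Circle) (h : (Fin (m + 1) → ℝ) → ℂ) :
    (Fin (m + 1) → ℝ) → ℂ :=
  jacquetIter ψ m h

/-!
Write the character as `ψ(x) = exp(2πiλx)` (`exists_frequency`). All self-dual measures are then
explicit multiples of Lebesgue measures (`isSelfDual_of_coords`), and the Weil constant is `i` times
the sign of `λ` for `D = ℂ` and `1` for `D = ℝ ⊕ ℝ` (`QuadAlg.isWeilConstant_weilConst`), as a limit
of Gaussian integrals (`integral_fourier_chirp`). In particular the constants of `ψ` and of its
inverse are inverse to each other.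

The inversion formula is proved by induction on `n`, removing the last variable on one side and the
first one on the other. Write a unipotent matrix as a smaller one together with its last column, and
take the Fourier transform of a Kloosterman integral in the last diagonal entry. The integral over
the last column becomes the integral of a quadratic phase, with a linear term coming from `χ_ψ`.
Completing the square produces the phase `ψ(1 / (a_i a_n))` of the Jacquet transform, and the Weil
formula evaluates the rest (`integral_mulVec_char`). The result is again a Kloosterman integral, in
one dimension less, of a Schwartz function obtained from `f` by the column operator `colOp`
(`integral_kloosNorm_snoc`). The Fourier transform on Hermitian matrices takes the column operator to
the row operator `rowOp` (`fourierH_colOp`), which integrates out the first row of the unipotent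
variable (`kloos_cons`). So the Fourier transform of `colOp ψ λ q f` has as Kloosterman integral at
`diag(a)` the one of the Fourier transform of `f` at `diag(q, a)`, up to an explicit factor
(`kloosNorm_fourierH_colOp`), and the induction closes (`iterInt_kloosNorm`).

For the Jacquet space, the same steps are carried out with the removed diagonal entries kept as
parameters. What has to be seen is that Kloosterman integrals stay Schwartz along the fibers, jointly
in the parameters. On each component of the torus `(ℝˣ)^m` the coordinates `signedParam` identify the
Schwartz functions on the torus with those on `ℝ^m` (`exists_pullback_flat`, `exists_pushOrthant`,
`isFiberSchwartz_of_signedParam`), while torus coordinates and their inverses have temperate growth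
in them. The row and column operators preserve Schwartz functions depending on such parameters
(`exists_rowOp`, `exists_colOp`), so that each step replaces a Schwartz family by another one
(`IsSchwartzFamily.step`, `jacquetStepAt_eq`, `memJacquet_kloosNorm`). Absolute convergence of the
Kloosterman integrals is obtained in the same way, one row at a time (`OrbitIntegrable.cons`).

Functions are recognised as Schwartz functions by one criterion: they lie in a space of bounded
differentiable functions stable under derivatives and multiplication by linear forms
(`exists_schwartzMap_of_submodule`).
-/

/-! ### A criterion for Schwartz functions -/

section Criterion
variable {E : Type*} [NormedAddCommGroup E] [NormedSpace ℝ E]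

/-- A space of bounded differentiable functions which is stable under directional derivatives and
under multiplication by linear forms consists of Schwartz functions: applying boundedness to all
iterates gives all Schwartz estimates at once. -/
theorem exists_schwartzMap_of_submodule [FiniteDimensional ℝ E] (S : Submodule ℂ (E → ℂ))
    (hb : ∀ F ∈ S, ∃ C, ∀ x, ‖F x‖ ≤ C) (hd : ∀ F ∈ S, Differentiable ℝ F)
    (hder : ∀ F ∈ S, ∀ e, (fun x => fderiv ℝ F x e) ∈ S)
    (hmul : ∀ F ∈ S, ∀ l : E →L[ℝ] ℝ, (fun x => (l x : ℂ) * F x) ∈ S)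
    {F : E → ℂ} (hF : F ∈ S) : ∃ G : 𝓢(E, ℂ), ∀ x, G x = F x := by
  classical
  -- Linear forms and directional derivatives are only needed along a basis; `T i` extends a value
  -- to the linear map supported on the `i`-th coordinate.
  let b := Module.finBasis ℝ E
  let l : Fin (Module.finrank ℝ E) → E →L[ℝ] ℝ := fun i => LinearMap.toContinuousLinearMap (b.coord i)
  let T : Fin (Module.finrank ℝ E) → ℂ →L[ℝ] (E →L[ℝ] ℂ) := fun i =>
    ContinuousLinearMap.smulRightL ℝ E ℂ (l i)
  have hexp : ∀ x : E, ∑ i, l i x • b i = x := fun x => b.sum_repr x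
  have hfd : ∀ F : E → ℂ, fderiv ℝ F = fun x => ∑ i, T i (fderiv ℝ F x (b i)) := by
    intro F
    ext x v
    conv_lhs => rw [← hexp v]
    simp [T]
  have hcd : ∀ n : ℕ, ∀ F ∈ S, ContDiff ℝ n F := by
    intro n
    induction n with
    | zero => exact fun F hF => contDiff_zero.2 (hd F hF).continuous
    | succ n ih =>
      intro F hF
      push_cast
      rw [contDiff_succ_iff_fderiv]
      refine ⟨hd F hF, by simp, ?_⟩
      rw [hfd F]
      exact ContDiff.sum fun i _ => (T i).contDiff.comp (ih _ (hder F hF (b i)))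
  have h0 : ∀ k : ℕ, ∀ F ∈ S, ∃ C, ∀ x, ‖x‖ ^ k * ‖F x‖ ≤ C := by
    intro k
    induction k with
    | zero => simpa using hb
    | succ k ih =>
      intro F hF
      choose C hC using fun i => ih _ (hmul F hF (l i))
      refine ⟨∑ i, ‖b i‖ * C i, fun x => ?_⟩
      have hx : ‖x‖ ≤ ∑ i, ‖l i x‖ * ‖b i‖ := by
        conv_lhs => rw [← hexp x]
        exact (norm_sum_le _ _).trans (le_of_eq (by simp [norm_smul]))
      calc ‖x‖ ^ (k + 1) * ‖F x‖ = ‖x‖ * (‖x‖ ^ k * ‖F x‖) := by ring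
        _ ≤ (∑ i, ‖l i x‖ * ‖b i‖) * (‖x‖ ^ k * ‖F x‖) := by gcongr
        _ = ∑ i, ‖b i‖ * (‖x‖ ^ k * ‖(l i x : ℂ) * F x‖) := by
          rw [Finset.sum_mul]
          refine Finset.sum_congr rfl fun i _ => ?_
          rw [norm_mul, Complex.norm_real]; ring
        _ ≤ _ := Finset.sum_le_sum fun i _ => by gcongr; exact hC i x
  have hdec : ∀ n k : ℕ, ∀ F ∈ S, ∃ C, ∀ x, ‖x‖ ^ k * ‖iteratedFDeriv ℝ n F x‖ ≤ C := by
    intro n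
    induction n with
    | zero => simpa using h0
    | succ n ih =>
      intro k F hF
      choose C hC using fun i => ih k _ (hder F hF (b i))
      refine ⟨∑ i, ‖T i‖ * C i, fun x => ?_⟩
      rw [← norm_iteratedFDeriv_fderiv, hfd F, iteratedFDeriv_fun_sum_apply]
      · calc _ ≤ ‖x‖ ^ k * ∑ i, ‖iteratedFDeriv ℝ n (fun x => T i (fderiv ℝ F x (b i))) x‖ := by
              gcongr; exact norm_sum_le _ _
          _ ≤ ‖x‖ ^ k * ∑ i, ‖T i‖ * ‖iteratedFDeriv ℝ n (fun x => fderiv ℝ F x (b i)) x‖ := by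
              gcongr with i
              exact (T i).norm_iteratedFDeriv_comp_left (hcd n _ (hder F hF (b i))).contDiffAt le_rfl
          _ = ∑ i, ‖T i‖ * (‖x‖ ^ k * ‖iteratedFDeriv ℝ n (fun x => fderiv ℝ F x (b i)) x‖) := by
              rw [Finset.mul_sum]; exact Finset.sum_congr rfl fun i _ => by ring
          _ ≤ _ := Finset.sum_le_sum fun i _ => by gcongr; exact hC i x
      · intro i _
        exact ((T i).contDiff.comp (hcd n _ (hder F hF (b i)))).contDiffAt
  exact ⟨⟨F, contDiff_infty.2 fun n => hcd n F hF, fun k n => hdec n k F hF⟩, fun x => rfl⟩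

/-- The criterion of `exists_schwartzMap_of_submodule`, checked on a spanning set. It reduces the
construction of a Schwartz function to finding a family of functions closed under first derivatives
and linear forms. -/
theorem exists_schwartzMap_of_set [FiniteDimensional ℝ E] (S : Set (E → ℂ))
    (hb : ∀ F ∈ S, ∃ C, ∀ x, ‖F x‖ ≤ C) (hd : ∀ F ∈ S, Differentiable ℝ F)
    (hder : ∀ F ∈ S, ∀ e, (fun x => fderiv ℝ F x e) ∈ Submodule.span ℂ S)
    (hmul : ∀ F ∈ S, ∀ l : E →L[ℝ] ℝ, (fun x => (l x : ℂ) * F x) ∈ Submodule.span ℂ S)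
    {F : E → ℂ} (hF : F ∈ S) : ∃ G : 𝓢(E, ℂ), ∀ x, G x = F x := by
  have hd' : ∀ F ∈ Submodule.span ℂ S, Differentiable ℝ F := by
    intro F hF
    induction hF using Submodule.span_induction with
    | mem F h => exact hd F h
    | zero => exact differentiable_const _
    | add F G _ _ h1 h2 => exact h1.add h2
    | smul c F _ h => exact h.const_smul c
  refine exists_schwartzMap_of_submodule (Submodule.span ℂ S) ?_ hd' ?_ ?_ (Submodule.subset_span hF)
  · intro F hF
    induction hF using Submodule.span_induction with
    | mem F h => exact hb F h
    | zero => exact ⟨0, by simp⟩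
    | add F G _ _ h1 h2 =>
      obtain ⟨C, hC⟩ := h1
      obtain ⟨C', hC'⟩ := h2
      exact ⟨C + C', fun x => (norm_add_le _ _).trans (add_le_add (hC x) (hC' x))⟩
    | smul c F _ h =>
      obtain ⟨C, hC⟩ := h
      exact ⟨‖c‖ * C, fun x => by simpa using mul_le_mul_of_nonneg_left (hC x) (norm_nonneg c)⟩
  · intro F hF e
    induction hF using Submodule.span_induction with
    | mem F h => exact hder F h e
    | zero =>
      convert (Submodule.span ℂ S).zero_mem using 1
      ext x
      simp
    | add F G hF hG h1 h2 =>
      convert (Submodule.span ℂ S).add_mem h1 h2 using 1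
      ext x
      simp [fderiv_add (hd' F hF x) (hd' G hG x)]
    | smul c F hF h =>
      convert (Submodule.span ℂ S).smul_mem c h using 1
      ext x
      simp [fderiv_const_smul (hd' F hF x) c]
  · intro F hF l
    induction hF using Submodule.span_induction with
    | mem F h => exact hmul F h l
    | zero =>
      convert (Submodule.span ℂ S).zero_mem using 1
      ext x
      simp
    | add F G hF hG h1 h2 =>
      convert (Submodule.span ℂ S).add_mem h1 h2 using 1
      ext x
      simp [mul_add]
    | smul c F hF h =>
      convert (Submodule.span ℂ S).smul_mem c h using 1
      ext x
      simp; ring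

end Criterion

/-! ### Functions of temperate growth -/

section TemperateGrowth
open Function
variable {E F G : Type*} [NormedAddCommGroup E] [NormedSpace ℝ E] [NormedAddCommGroup F]
  [NormedSpace ℝ F] [NormedAddCommGroup G] [NormedSpace ℝ G]

@[fun_prop]
theorem hasTemperateGrowth_prodMk {f : E → F} {g : E → G} (hf : f.HasTemperateGrowth)
    (hg : g.HasTemperateGrowth) : (fun x => (f x, g x)).HasTemperateGrowth := by
  have h : (fun x => (f x, g x)) = fun x =>
      ContinuousLinearMap.inl ℝ F G (f x) + ContinuousLinearMap.inr ℝ F G (g x) := by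
    ext x <;> simp
  rw [h]
  fun_prop

@[fun_prop]
theorem hasTemperateGrowth_pi {ι : Type*} [Fintype ι] {F : ι → Type*}
    [∀ i, NormedAddCommGroup (F i)] [∀ i, NormedSpace ℝ (F i)] {f : E → ∀ i, F i}
    (hf : ∀ i, (fun x => f x i).HasTemperateGrowth) : f.HasTemperateGrowth := by
  classical
  have h : f = fun x => ∑ i, ContinuousLinearMap.single ℝ F i (f x i) := by
    ext x i
    simp [Finset.sum_apply]
  rw [h]
  exact HasTemperateGrowth.sum fun i _ => by have := hf i; fun_prop

@[fun_prop]
theorem hasTemperateGrowth_fst {f : E → F × G} (hf : f.HasTemperateGrowth) :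
    (fun x => (f x).1).HasTemperateGrowth :=
  (ContinuousLinearMap.fst ℝ F G).hasTemperateGrowth.comp hf

@[fun_prop]
theorem hasTemperateGrowth_snd {f : E → F × G} (hf : f.HasTemperateGrowth) :
    (fun x => (f x).2).HasTemperateGrowth :=
  (ContinuousLinearMap.snd ℝ F G).hasTemperateGrowth.comp hf

@[fun_prop]
theorem hasTemperateGrowth_apply {ι : Type*} [Fintype ι] (i : ι) :
    (fun f : ι → F => f i).HasTemperateGrowth :=
  (ContinuousLinearMap.proj (R := ℝ) (φ := fun _ : ι => F) i).hasTemperateGrowth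

theorem hasTemperateGrowth_cexp_mul_I : (fun r : ℝ => Complex.exp (r * Complex.I)).HasTemperateGrowth := by
  refine ⟨(Complex.ofRealCLM.contDiff.mul contDiff_const).cexp, fun n => ⟨0, 1, fun x => ?_⟩⟩
  have h : (fun r : ℝ => Complex.exp (r * Complex.I)) = fun r : ℝ => Complex.exp (Complex.I * r) := by
    ext r; rw [mul_comm]
  have h2 : ∀ n, iteratedDeriv n (fun r : ℝ => Complex.exp (Complex.I * r)) =
      fun r : ℝ => Complex.I ^ n * Complex.exp (Complex.I * r) := by
    intro n
    induction n with
    | zero => simp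
    | succ n ih =>
      rw [iteratedDeriv_succ, ih]
      ext r
      have h3 : HasDerivAt (fun r : ℝ => Complex.I * (r : ℂ)) (Complex.I * 1) r :=
        (Complex.ofRealCLM.hasDerivAt (x := r)).const_mul Complex.I
      have := (h3.cexp.const_mul (Complex.I ^ n)).deriv
      rw [this]; ring
  rw [norm_iteratedFDeriv_eq_norm_iteratedDeriv, h, h2]
  simp [mul_comm Complex.I, Complex.norm_exp_ofReal_mul_I]

/-- A unitary phase `exp(iφ)` has temperate growth when `φ` has. -/
@[fun_prop]
theorem hasTemperateGrowth_cexp {φ : E → ℝ} (h : φ.HasTemperateGrowth) :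
    (fun x => Complex.exp (φ x * Complex.I)).HasTemperateGrowth :=
  hasTemperateGrowth_cexp_mul_I.comp h

end TemperateGrowth

/-! ### Partial Fourier transforms -/

section PartialFourier
variable {E W W' : Type*} [NormedAddCommGroup E] [NormedSpace ℝ E]
  [NormedAddCommGroup W] [NormedSpace ℝ W] [NormedAddCommGroup W'] [NormedSpace ℝ W']

/-- The restriction of a Schwartz function on `E × W` to the slice `{e} × W`. -/
noncomputable def schwartzSlice (K : 𝓢(E × W, ℂ)) (e : E) : 𝓢(W, ℂ) :=
  compCLMOfAntilipschitz ℂ (K := 1) (g := fun w => (e, w)) (by fun_prop)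
    (AntilipschitzWith.of_le_mul_dist fun x y => by simp [Prod.dist_eq]) K

@[simp] theorem schwartzSlice_apply (K : 𝓢(E × W, ℂ)) (e : E) (w : W) :
    schwartzSlice K e w = K (e, w) := rfl

/-- A Schwartz function on a product and its derivatives decay in the second variable, uniformly in
the first. -/
theorem exists_bound_iteratedFDeriv (K : 𝓢(E × W, ℂ)) (k n : ℕ) :
    ∃ C, 0 ≤ C ∧ ∀ e w, ‖iteratedFDeriv ℝ n K (e, w)‖ ≤ C * (1 + ‖w‖) ^ (-(k : ℝ)) := by
  let C := 2 ^ k * ((Finset.Iic (k, n)).sup fun m => SchwartzMap.seminorm ℝ m.1 m.2) K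
  refine ⟨C, by positivity, fun e w => ?_⟩
  have h := one_add_le_sup_seminorm_apply (𝕜 := ℝ) (m := (k, n)) le_rfl le_rfl K (e, w)
  have h1 : (1 + ‖w‖) ^ k * ‖iteratedFDeriv ℝ n K (e, w)‖ ≤ C := by
    refine le_trans ?_ h
    gcongr
    exact norm_snd_le (e, w)
  rw [Real.rpow_neg (by positivity), Real.rpow_natCast, ← div_eq_mul_inv,
    le_div_iff₀ (by positivity)]
  linarith

/-- The kernel `exp(-2πi b(w, ξ))` of the partial Fourier transform attached to a pairing `b`. -/
noncomputable def fourierKer (b : W →L[ℝ] W' →L[ℝ] ℝ) (w : W) (ξ : W') : ℂ :=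
  Complex.exp ((-(2 * Real.pi * b w ξ) : ℝ) * Complex.I)

theorem norm_fourierKer (b : W →L[ℝ] W' →L[ℝ] ℝ) (w : W) (ξ : W') : ‖fourierKer b w ξ‖ = 1 :=
  Complex.norm_exp_ofReal_mul_I _

theorem hasFDerivAt_fourierKer (b : W →L[ℝ] W' →L[ℝ] ℝ) (w : W) (ξ : W') :
    HasFDerivAt (fun p : W × W' => fourierKer b p.1 p.2)
      (fourierKer b w ξ • ((-(2 * Real.pi) * Complex.I) •
        (Complex.ofRealCLM.comp (b.deriv₂ (w, ξ))))) (w, ξ) := by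
  have h1 : HasFDerivAt (fun p : W × W' => b p.1 p.2) (b.deriv₂ (w, ξ)) (w, ξ) :=
    b.isBoundedBilinearMap.hasFDerivAt (w, ξ)
  have h2 := ((Complex.ofRealCLM.hasFDerivAt.comp (w, ξ) h1).const_mul
    (-(2 * Real.pi) * Complex.I)).cexp
  have h3 : (fun p : W × W' => fourierKer b p.1 p.2) = fun p => Complex.exp
      (-(2 * Real.pi) * Complex.I * (Complex.ofRealCLM ∘ fun p : W × W' => b p.1 p.2) p) := by
    ext p
    simp only [fourierKer, Function.comp, Complex.ofRealCLM_apply]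
    congr 1; push_cast; ring
  rw [h3]
  refine h2.congr_fderiv ?_
  rw [← congrFun h3 (w, ξ)]

variable [FiniteDimensional ℝ W] [MeasurableSpace W] [BorelSpace W]

/-- Differentiation under the integral sign in a partial Fourier transform. The integrability of the
derivative of the integrand is recorded too, since it is needed to evaluate the derivative in a
direction. -/
theorem hasFDerivAt_partialFourier (μ : Measure W) [μ.IsAddHaarMeasure]
    (b : W →L[ℝ] W' →L[ℝ] ℝ) (K : 𝓢(E × W, ℂ)) (x : E × W') :
    Integrable (fun w => fourierKer b w x.2 • ((fderiv ℝ K (x.1, w)).comp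
        (ContinuousLinearMap.inl ℝ E W ∘L ContinuousLinearMap.fst ℝ E W')) +
      K (x.1, w) • fourierKer b w x.2 • ((-(2 * Real.pi) * Complex.I) •
        (Complex.ofRealCLM.comp (b w ∘L ContinuousLinearMap.snd ℝ E W')))) μ ∧
    HasFDerivAt (fun x : E × W' => ∫ w, K (x.1, w) * fourierKer b w x.2 ∂μ)
      (∫ w, (fourierKer b w x.2 • ((fderiv ℝ K (x.1, w)).comp
          (ContinuousLinearMap.inl ℝ E W ∘L ContinuousLinearMap.fst ℝ E W')) +
        K (x.1, w) • fourierKer b w x.2 • ((-(2 * Real.pi) * Complex.I) •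
          (Complex.ofRealCLM.comp (b w ∘L ContinuousLinearMap.snd ℝ E W')))) ∂μ) x := by
  set F' : E × W' → W → (E × W' →L[ℝ] ℂ) := fun x w =>
    fourierKer b w x.2 • ((fderiv ℝ K (x.1, w)).comp
          (ContinuousLinearMap.inl ℝ E W ∘L ContinuousLinearMap.fst ℝ E W')) +
        K (x.1, w) • fourierKer b w x.2 • ((-(2 * Real.pi) * Complex.I) •
          (Complex.ofRealCLM.comp (b w ∘L ContinuousLinearMap.snd ℝ E W'))) with hF'
  have hker : ∀ ξ : W', Continuous fun w => fourierKer b w ξ := fun ξ => by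
    unfold fourierKer; fun_prop
  have hcK : ∀ e : E, Continuous fun w => K (e, w) := fun e => K.continuous.comp (by fun_prop)
  have hdK : Continuous (fderiv ℝ K) := (K.smooth 1).continuous_fderiv (by simp)
  have hcF' : ∀ x, Continuous (F' x) := by
    intro x
    refine Continuous.add ((hker _).smul ?_) ((hcK _).smul ((hker _).smul (Continuous.fun_const_smul ?_ _)))
    · exact (hdK.comp (by fun_prop : Continuous fun w : W => (x.1, w))).clm_comp continuous_const
    · exact continuous_const.clm_comp (b.continuous.clm_comp continuous_const)
  let N := μ.integrablePower
  obtain ⟨C1, hC1, h1⟩ := exists_bound_iteratedFDeriv K N 1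
  obtain ⟨C0, hC0, h0⟩ := exists_bound_iteratedFDeriv K (N + 1) 0
  let M := C1 * ‖ContinuousLinearMap.inl ℝ E W ∘L ContinuousLinearMap.fst ℝ E W'‖ +
    C0 * (2 * Real.pi * (‖Complex.ofRealCLM‖ * (‖b‖ * ‖ContinuousLinearMap.snd ℝ E W'‖)))
  have hbound : ∀ x w, ‖F' x w‖ ≤ M * (1 + ‖w‖) ^ (-(N : ℝ)) := by
    intro x w
    have h1' := h1 x.1 w
    rw [norm_iteratedFDeriv_one] at h1'
    have h0' := h0 x.1 w
    rw [norm_iteratedFDeriv_zero] at h0'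
    have h0'' : ‖K (x.1, w)‖ * ‖w‖ ≤ C0 * (1 + ‖w‖) ^ (-(N : ℝ)) := by
      calc ‖K (x.1, w)‖ * ‖w‖ ≤ C0 * (1 + ‖w‖) ^ (-((N + 1 : ℕ) : ℝ)) * (1 + ‖w‖) := by
            gcongr; linarith
        _ = C0 * (1 + ‖w‖) ^ (-(N : ℝ)) := by
            rw [mul_assoc]
            congr 1
            nth_rw 2 [← Real.rpow_one (1 + ‖w‖)]
            rw [← Real.rpow_add (by positivity)]
            congr 1; push_cast; ring
    calc ‖F' x w‖ ≤ ‖fderiv ℝ K (x.1, w)‖ *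
            ‖ContinuousLinearMap.inl ℝ E W ∘L ContinuousLinearMap.fst ℝ E W'‖ +
          ‖K (x.1, w)‖ * (2 * Real.pi * (‖Complex.ofRealCLM‖ *
            (‖b‖ * ‖w‖ * ‖ContinuousLinearMap.snd ℝ E W'‖))) := by
          refine (norm_add_le _ _).trans (add_le_add ?_ ?_)
          · rw [norm_smul, norm_fourierKer, one_mul]
            exact ContinuousLinearMap.opNorm_comp_le _ _
          · rw [norm_smul, norm_smul, norm_fourierKer, one_mul, norm_smul]
            gcongr
            · simp [abs_of_pos Real.pi_pos]
            · refine (ContinuousLinearMap.opNorm_comp_le _ _).trans ?_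
              gcongr
              refine (ContinuousLinearMap.opNorm_comp_le _ _).trans ?_
              gcongr
              exact b.le_opNorm w
      _ ≤ (C1 * (1 + ‖w‖) ^ (-(N : ℝ))) *
            ‖ContinuousLinearMap.inl ℝ E W ∘L ContinuousLinearMap.fst ℝ E W'‖ +
          (C0 * (1 + ‖w‖) ^ (-(N : ℝ))) * (2 * Real.pi * (‖Complex.ofRealCLM‖ *
            (‖b‖ * ‖ContinuousLinearMap.snd ℝ E W'‖))) := by
          refine add_le_add (by gcongr) ?_
          calc _ = (‖K (x.1, w)‖ * ‖w‖) * (2 * Real.pi * (‖Complex.ofRealCLM‖ *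
            (‖b‖ * ‖ContinuousLinearMap.snd ℝ E W'‖))) := by ring
            _ ≤ _ := by gcongr
      _ = M * (1 + ‖w‖) ^ (-(N : ℝ)) := by simp only [M]; ring
  have hint : Integrable (fun w : W => M * (1 + ‖w‖) ^ (-(N : ℝ))) μ :=
    (Measure.integrable_pow_neg_integrablePower μ).const_mul M
  refine ⟨hint.mono' (hcF' x).aestronglyMeasurable (.of_forall (hbound x)), ?_⟩
  refine hasFDerivAt_integral_of_dominated_of_fderiv_le (F' := F') Filter.univ_mem
    (.of_forall fun x => ((hcK _).mul (hker _)).aestronglyMeasurable) ?_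
    (hcF' x).aestronglyMeasurable (.of_forall fun w x _ => hbound x w) hint
    (.of_forall fun w x _ => ?_)
  · refine (schwartzSlice K x.1).integrable.norm.mono' ((hcK _).mul (hker _)).aestronglyMeasurable
      (.of_forall fun w => ?_)
    rw [norm_mul, norm_fourierKer, mul_one, schwartzSlice_apply]
  · have e1 : HasFDerivAt (fun x : E × W' => K (x.1, w)) ((fderiv ℝ K (x.1, w)).comp
        (ContinuousLinearMap.inl ℝ E W ∘L ContinuousLinearMap.fst ℝ E W')) x := by
      have : HasFDerivAt (fun x : E × W' => (x.1, w))
          (ContinuousLinearMap.inl ℝ E W ∘L ContinuousLinearMap.fst ℝ E W') x := by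
        refine ((hasFDerivAt_fst (p := x)).prodMk (hasFDerivAt_const w x)).congr_fderiv ?_
        ext <;> simp
      exact (K.hasFDerivAt (x.1, w)).comp x this
    have e2 : HasFDerivAt (fun x : E × W' => fourierKer b w x.2)
        (fourierKer b w x.2 • ((-(2 * Real.pi) * Complex.I) •
          (Complex.ofRealCLM.comp (b w ∘L ContinuousLinearMap.snd ℝ E W')))) x := by
      have : HasFDerivAt (fun x : E × W' => (w, x.2))
          (ContinuousLinearMap.inr ℝ W W' ∘L ContinuousLinearMap.snd ℝ E W') x := by
        refine ((hasFDerivAt_const w x).prodMk (hasFDerivAt_snd (p := x))).congr_fderiv ?_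
        ext <;> simp
      refine ((hasFDerivAt_fourierKer b w x.2).comp x this).congr_fderiv ?_
      ext <;> simp [ContinuousLinearMap.deriv₂]
    exact (e1.mul e2).congr_fderiv (by simp only [hF']; rw [add_comm])

/-- The partial Fourier transform of a Schwartz function on `E × W` in the second variable is a
Schwartz function. The pairing has to be nondegenerate in the frequency variable; the pairing with
the zero space amounts to integration over `W`. -/
theorem exists_partialFourier [FiniteDimensional ℝ E] [FiniteDimensional ℝ W'] (μ : Measure W)
    [μ.IsAddHaarMeasure] (b : W →L[ℝ] W' →L[ℝ] ℝ) (hb : Function.Surjective b) (K : 𝓢(E × W, ℂ)) :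
    ∃ G : 𝓢(E × W', ℂ), ∀ e ξ, G (e, ξ) = ∫ w, K (e, w) * fourierKer b w ξ ∂μ := by
  let T : 𝓢(E × W, ℂ) → E × W' → ℂ := fun K x => ∫ w, K (x.1, w) * fourierKer b w x.2 ∂μ
  have hint : ∀ (K : 𝓢(E × W, ℂ)) (x : E × W'),
      Integrable (fun w => K (x.1, w) * fourierKer b w x.2) μ := fun K x => by
    refine (schwartzSlice K x.1).integrable.mono (Continuous.aestronglyMeasurable ?_)
      (.of_forall fun w => ?_)
    · unfold fourierKer
      exact (K.continuous.comp (by fun_prop)).mul (by fun_prop)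
    · rw [norm_mul, norm_fourierKer, mul_one, schwartzSlice_apply]
  have hadd : ∀ K K' x, T (K + K') x = T K x + T K' x := fun K K' x => by
    simp only [T]
    rw [← integral_add (hint K x) (hint K' x)]
    exact integral_congr_ae (.of_forall fun w => by simp [add_mul])
  suffices h : ∃ G : 𝓢(E × W', ℂ), ∀ x, G x = T K x from
    h.imp fun G hG e ξ => hG (e, ξ)
  -- The transforms `T K` of all Schwartz functions `K` form a family to which the criterion
  -- applies.
  refine exists_schwartzMap_of_set (Set.range T) ?_ ?_ ?_ ?_ ⟨K, rfl⟩
  · rintro _ ⟨K, rfl⟩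
    let N := μ.integrablePower
    obtain ⟨C0, hC0, h0⟩ := exists_bound_iteratedFDeriv K N 0
    refine ⟨∫ w, C0 * (1 + ‖w‖) ^ (-(N : ℝ)) ∂μ, fun x => ?_⟩
    refine norm_integral_le_of_norm_le ((Measure.integrable_pow_neg_integrablePower μ).const_mul C0)
      (.of_forall fun w => ?_)
    rw [norm_mul, norm_fourierKer, mul_one]
    simpa using h0 x.1 w
  · rintro _ ⟨K, rfl⟩
    exact fun x => (hasFDerivAt_partialFourier μ b K x).2.differentiableAt
  · rintro _ ⟨K, rfl⟩ v
    let φ : E × W → ℂ := fun p => ((-(2 * Real.pi) * b p.2 v.2 : ℝ) : ℂ) * Complex.I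
    have hφ : φ.HasTemperateGrowth := by
      have : (fun p : E × W => b p.2 v.2) = (b.flip v.2 ∘L ContinuousLinearMap.snd ℝ E W) := by
        ext; simp
      have : (fun p : E × W => b p.2 v.2).HasTemperateGrowth := by rw [this]; fun_prop
      simp only [φ]
      fun_prop
    refine Submodule.subset_span ⟨LineDeriv.lineDerivOp ((v.1, 0) : E × W) K + smulLeftCLM ℂ φ K, ?_⟩
    ext x
    obtain ⟨i1, i2⟩ := hasFDerivAt_partialFourier μ b K x
    have : fderiv ℝ (T K) x = _ := i2.fderiv
    rw [this, ContinuousLinearMap.integral_apply i1]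
    refine integral_congr_ae (.of_forall fun w => ?_)
    simp only [add_apply, lineDerivOp_apply_eq_fderiv, smulLeftCLM_apply_apply hφ]
    simp [φ]
    ring
  · rintro _ ⟨K, rfl⟩ l
    -- The part of `l` on `W'` is `b w0`; multiplication by it is turned into a derivative of `K`
    -- along `w0` by partial integration.
    obtain ⟨w0, hw0⟩ := hb (l ∘L ContinuousLinearMap.inr ℝ E W')
    let φ : E × W → ℂ := fun p => ((l (p.1, 0) : ℝ) : ℂ)
    have hφ : φ.HasTemperateGrowth := by
      have : (fun p : E × W => l (p.1, 0)) =
          (l ∘L ContinuousLinearMap.inl ℝ E W' ∘L ContinuousLinearMap.fst ℝ E W) := by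
        ext; simp
      have : (fun p : E × W => l (p.1, 0)).HasTemperateGrowth := by rw [this]; fun_prop
      simp only [φ]
      fun_prop
    refine Submodule.subset_span ⟨smulLeftCLM ℂ φ K + (1 / (2 * Real.pi * Complex.I) : ℂ) •
      LineDeriv.lineDerivOp ((0, w0) : E × W) K, ?_⟩
    ext x
    rw [hadd]
    have hl : l x = l (x.1, 0) + b w0 x.2 := by
      rw [hw0]
      simp only [ContinuousLinearMap.comp_apply, ContinuousLinearMap.inr_apply]
      rw [← map_add]; simp
    have hpart : ∫ w, K (x.1, w) * (fourierKer b w x.2 *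
          ((-(2 * Real.pi) * b w0 x.2 : ℝ) * Complex.I)) ∂μ =
        -∫ w, (LineDeriv.lineDerivOp ((0, w0) : E × W) K) (x.1, w) * fourierKer b w x.2 ∂μ := by
      refine integral_bilinear_hasLineDerivAt_right_eq_neg_left_of_integrable
        (B := ContinuousLinearMap.mul ℝ ℂ) (v := w0) (f := fun w => K (x.1, w))
        (f' := fun w => (LineDeriv.lineDerivOp ((0, w0) : E × W) K) (x.1, w))
        (g := fun w => fourierKer b w x.2)
        (g' := fun w => (fourierKer b w x.2 * ((-(2 * Real.pi) * b w0 x.2 : ℝ) * Complex.I)))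
        (hint _ x) ?_ (hint K x) ?_ ?_
      · simp only [ContinuousLinearMap.mul_apply', ← mul_assoc]
        simpa only [mul_assoc] using (hint K x).mul_const
          (((-(2 * Real.pi) * b w0 x.2 : ℝ) : ℂ) * Complex.I)
      · intro w _
        have h2 : HasFDerivAt (fun w : W => (x.1, w)) (ContinuousLinearMap.inr ℝ E W) w := by
          refine ((hasFDerivAt_const x.1 w).prodMk (hasFDerivAt_id w)).congr_fderiv ?_
          ext <;> simp
        have := ((K.hasFDerivAt (x.1, w)).comp w h2).hasLineDerivAt w0
        simpa [lineDerivOp_apply_eq_fderiv, Function.comp_def] using this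
      · intro w _
        have h2 : HasFDerivAt (fun w : W => (w, x.2)) (ContinuousLinearMap.inl ℝ W W') w := by
          refine ((hasFDerivAt_id w).prodMk (hasFDerivAt_const x.2 w)).congr_fderiv ?_
          ext <;> simp
        have := ((hasFDerivAt_fourierKer b w x.2).comp w h2).hasLineDerivAt w0
        simp only [Function.comp_def] at this
        convert this using 1
        simp [ContinuousLinearMap.deriv₂]
        exact Or.inl (by ring)
    have e1 : T (smulLeftCLM ℂ φ K) x = (l (x.1, 0) : ℂ) * T K x := by
      simp only [T]
      rw [← integral_const_mul]
      refine integral_congr_ae (.of_forall fun w => ?_)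
      simp only [smulLeftCLM_apply_apply hφ]
      simp [φ, mul_assoc]
    have e2 : T ((1 / (2 * Real.pi * Complex.I) : ℂ) •
        LineDeriv.lineDerivOp ((0, w0) : E × W) K) x = (b w0 x.2 : ℂ) * T K x := by
      have e3 : T ((1 / (2 * Real.pi * Complex.I) : ℂ) •
        LineDeriv.lineDerivOp ((0, w0) : E × W) K) x = (1 / (2 * Real.pi * Complex.I) : ℂ) *
          ∫ w, (LineDeriv.lineDerivOp ((0, w0) : E × W) K) (x.1, w) * fourierKer b w x.2 ∂μ := by
        simp only [T]
        rw [← integral_const_mul]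
        refine integral_congr_ae (.of_forall fun w => ?_)
        simp [mul_assoc]
      have e4 : ∫ w, K (x.1, w) * (fourierKer b w x.2 *
          ((-(2 * Real.pi) * b w0 x.2 : ℝ) * Complex.I)) ∂μ =
          ((-(2 * Real.pi) * b w0 x.2 : ℝ) * Complex.I) * T K x := by
        simp only [T]
        rw [← integral_const_mul]
        refine integral_congr_ae (.of_forall fun w => ?_)
        simp only; ring
      rw [e3, ← neg_neg (∫ w, _ ∂μ), ← hpart, e4]
      have : (Real.pi : ℂ) ≠ 0 := by exact_mod_cast Real.pi_ne_zero
      have := Complex.I_ne_zero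
      push_cast
      field_simp
    rw [e1, e2, hl]
    push_cast; ring

/-- Integrating out one variable of a Schwartz function leaves a Schwartz function. -/
theorem exists_integral_snd [FiniteDimensional ℝ E] (μ : Measure W) [μ.IsAddHaarMeasure]
    (K : 𝓢(E × W, ℂ)) : ∃ G : 𝓢(E, ℂ), ∀ e, G e = ∫ w, K (e, w) ∂μ := by
  obtain ⟨G, hG⟩ := exists_partialFourier (W' := Fin 0 → ℝ) μ 0
    (fun l => ⟨0, by ext x; rw [Subsingleton.elim x 0, map_zero, map_zero]⟩) K
  refine ⟨compCLMOfAntilipschitz ℂ (K := 1) (g := fun e => (e, 0)) (by fun_prop)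
    (AntilipschitzWith.of_le_mul_dist fun x y => by simp [Prod.dist_eq]) G, fun e => ?_⟩
  rw [compCLMOfAntilipschitz_apply, Function.comp, hG]
  simp [fourierKer]

/-- The Fourier transform attached to a nondegenerate pairing preserves Schwartz functions. -/
theorem exists_fourier [FiniteDimensional ℝ W'] (μ : Measure W) [μ.IsAddHaarMeasure]
    (b : W →L[ℝ] W' →L[ℝ] ℝ) (hb : Function.Surjective b) (K : 𝓢(W, ℂ)) :
    ∃ G : 𝓢(W', ℂ), ∀ ξ, G ξ = ∫ w, K w * fourierKer b w ξ ∂μ := by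
  obtain ⟨G, hG⟩ := exists_partialFourier (E := Fin 0 → ℝ) μ b hb
    (compCLMOfAntilipschitz ℂ (K := 1) (g := fun p : (Fin 0 → ℝ) × W => p.2) (by fun_prop)
      (AntilipschitzWith.of_le_mul_dist fun x y => by
        simp [Prod.dist_eq, Subsingleton.elim x.1 y.1]) K)
  exact ⟨schwartzSlice G 0, fun ξ => hG 0 ξ⟩

end PartialFourier

/-! ### Coordinates on the torus -/

section TorusCoordinates
open Function

/-- The parametrisation `s ↦ s + √(1 + s²)` of the positive reals. It and its inverse
`√(1 + s²) - s` have temperate growth. -/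
noncomputable def posParam (s : ℝ) : ℝ := s + (1 + ‖s‖ ^ 2) ^ (1 / 2 : ℝ)

/-- The reciprocal of `posParam`. -/
noncomputable def posParamInv (s : ℝ) : ℝ := (1 + ‖s‖ ^ 2) ^ (1 / 2 : ℝ) - s

@[fun_prop]
theorem hasTemperateGrowth_posParam : posParam.HasTemperateGrowth := by
  unfold posParam; fun_prop

@[fun_prop]
theorem hasTemperateGrowth_posParamInv : posParamInv.HasTemperateGrowth := by
  unfold posParamInv; fun_prop

theorem posParam_mul_inv (s : ℝ) : posParam s * posParamInv s = 1 := by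
  have h : ((1 + ‖s‖ ^ 2) ^ (1 / 2 : ℝ)) ^ 2 = 1 + ‖s‖ ^ 2 := by
    rw [← Real.sqrt_eq_rpow, Real.sq_sqrt (by positivity)]
  have h2 : ‖s‖ ^ 2 = s ^ 2 := by simp
  unfold posParam posParamInv
  linear_combination h + h2

theorem posParam_pos (s : ℝ) : 0 < posParam s := by
  unfold posParam
  rw [← Real.sqrt_eq_rpow]
  have : |s| < √(1 + ‖s‖ ^ 2) := by
    rw [← Real.sqrt_sq_eq_abs]
    exact Real.sqrt_lt_sqrt (by positivity) (by simp)
  linarith [neg_abs_le s]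

theorem posParamInv_eq (s : ℝ) : posParamInv s = (posParam s)⁻¹ :=
  eq_inv_of_mul_eq_one_right (posParam_mul_inv s)

theorem eq_posParam_sub (s : ℝ) : s = (posParam s - (posParam s)⁻¹) / 2 := by
  rw [← posParamInv_eq]; unfold posParam posParamInv; ring

theorem posParam_of_pos {a : ℝ} (ha : 0 < a) : posParam ((a - a⁻¹) / 2) = a := by
  unfold posParam
  have h : 1 + ‖(a - a⁻¹) / 2‖ ^ 2 = ((a + a⁻¹) / 2) ^ 2 := by
    rw [Real.norm_eq_abs, sq_abs]
    field_simp
    ring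
  rw [h, ← Real.sqrt_eq_rpow, Real.sqrt_sq (by positivity)]
  ring

variable {m : ℕ}

theorem hasTemperateGrowth_fderiv_apply {E F : Type*} [NormedAddCommGroup E] [NormedSpace ℝ E]
    [NormedAddCommGroup F] [NormedSpace ℝ F] {r : E → F} (hr : r.HasTemperateGrowth) (e : E) :
    (fun t => fderiv ℝ r t e).HasTemperateGrowth := by
  have h : (fderiv ℝ r).HasTemperateGrowth :=
    ⟨hr.1.fderiv_right (by simp), fun n => by
      simpa only [norm_iteratedFDeriv_fderiv] using hr.2 (n + 1)⟩
  exact (ContinuousLinearMap.apply ℝ F e).hasTemperateGrowth.comp h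

/-- The parametrisation of the component of `(ℝˣ)^m` with signs `ε` by `ℝ^m`. -/
noncomputable def signedParam (ε : Fin m → ℤˣ) (t : Fin m → ℝ) : Fin m → ℝ :=
  fun i => ((ε i : ℤ) : ℝ) * posParam (t i)

theorem unit_mul_self (u : ℤˣ) : ((u : ℤ) : ℝ) * ((u : ℤ) : ℝ) = 1 := by
  rcases Int.units_eq_one_or u with rfl | rfl <;> simp

theorem abs_unit (u : ℤˣ) : |((u : ℤ) : ℝ)| = 1 := by
  rcases Int.units_eq_one_or u with rfl | rfl <;> simp

@[fun_prop]
theorem hasTemperateGrowth_signedParam (ε : Fin m → ℤˣ) : (signedParam ε).HasTemperateGrowth := by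
  unfold signedParam
  refine hasTemperateGrowth_pi fun i => ?_
  fun_prop

theorem signedParam_mem (ε : Fin m → ℤˣ) (t : Fin m → ℝ) : signedParam ε t ∈ torus m := fun i =>
  mul_ne_zero (by simp) (posParam_pos _).ne'

theorem inv_signedParam (ε : Fin m → ℤˣ) (t : Fin m → ℝ) (i : Fin m) :
    (signedParam ε t i)⁻¹ = ((ε i : ℤ) : ℝ) * posParamInv (t i) := by
  rw [signedParam, mul_inv, posParamInv_eq]
  congr 1
  exact inv_eq_of_mul_eq_one_left (unit_mul_self _)

/-- The inverse of `signedParam ε` on the component of the torus with signs `ε`. -/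
noncomputable def signedParamInv (ε : Fin m → ℤˣ) (a : Fin m → ℝ) : Fin m → ℝ :=
  fun i => (((ε i : ℤ) : ℝ) * a i - (((ε i : ℤ) : ℝ) * a i)⁻¹) / 2

theorem signedParam_signedParamInv (ε : Fin m → ℤˣ) (a : Fin m → ℝ)
    (ha : ∀ i, 0 < ((ε i : ℤ) : ℝ) * a i) : signedParam ε (signedParamInv ε a) = a := by
  ext i
  rw [signedParam, signedParamInv, posParam_of_pos (ha i), ← mul_assoc, unit_mul_self, one_mul]

theorem exists_signs (a : Fin m → ℝ) (ha : a ∈ torus m) :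
    ∃ ε : Fin m → ℤˣ, ∀ i, 0 < ((ε i : ℤ) : ℝ) * a i := by
  refine ⟨fun i => if 0 < a i then 1 else -1, fun i => ?_⟩
  rcases lt_or_gt_of_ne (ha i) with h | h
  · simp [h, not_lt.2 h.le]
  · simp [h]

/-- Flatness is inherited by directional derivatives. -/
theorem flatOff_fderiv {E : Type*} [NormedAddCommGroup E] [NormedSpace ℝ E] {U : Set E}
    (g : 𝓢(E, ℂ)) (hg : FlatOff U g) (e : E) : FlatOff U (LineDeriv.lineDerivOp e g : 𝓢(E, ℂ)) := by
  intro x hx k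
  have h : ((LineDeriv.lineDerivOp e g : 𝓢(E, ℂ)) : E → ℂ) =
      ContinuousLinearMap.apply ℝ ℂ e ∘ fderiv ℝ g := by
    ext y; simp [lineDerivOp_apply_eq_fderiv]
  have hs : ContDiffAt ℝ k (fderiv ℝ g) x :=
    ((g.smooth (k + 1 : ℕ)).fderiv_right (m := k) (by norm_cast)).contDiffAt
  rw [h, ← norm_le_zero_iff]
  refine ((ContinuousLinearMap.apply ℝ ℂ e).norm_iteratedFDeriv_comp_left hs le_rfl).trans ?_
  rw [norm_iteratedFDeriv_fderiv, hg x hx]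
  simp

theorem FlatOff.eq_zero {E : Type*} [NormedAddCommGroup E] [NormedSpace ℝ E] {U : Set E}
    {g : E → ℂ} (hg : FlatOff U g) {x : E} (hx : x ∉ U) : g x = 0 := by
  have := hg x hx 0
  rw [← norm_eq_zero, norm_iteratedFDeriv_zero] at this
  simpa using this

/-- A Schwartz function flat off the torus vanishes to infinite order along each coordinate
hyperplane, uniformly. -/
theorem exists_bound_of_flatOff (i : Fin m) (K : ℕ) (g : 𝓢(Fin m → ℝ, ℂ))
    (hg : FlatOff (torus m) g) : ∃ C, 0 ≤ C ∧ ∀ a, ‖g a‖ ≤ C * |a i| ^ K := by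
  induction K generalizing g with
  | zero =>
    exact ⟨SchwartzMap.seminorm ℝ 0 0 g, by positivity, fun a => by
      simpa using norm_le_seminorm ℝ g a⟩
  | succ K ih =>
    obtain ⟨C, hC, h⟩ := ih _ (flatOff_fderiv g hg (Pi.single i (1 : ℝ)))
    refine ⟨C, hC, fun a => ?_⟩
    have hd : ∀ s : ℝ, HasDerivAt (fun s => g (update a i s))
        ((LineDeriv.lineDerivOp (Pi.single i (1 : ℝ) : Fin m → ℝ) g : 𝓢(Fin m → ℝ, ℂ)) (update a i s)) s := fun s => by
      have := (g.hasFDerivAt (update a i s)).comp_hasDerivAt s (hasDerivAt_update a i s)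
      rw [lineDerivOp_apply_eq_fderiv]
      exact this
    have hmv := (convex_uIcc (0 : ℝ) (a i)).norm_image_sub_le_of_norm_hasDerivWithin_le
      (C := C * |a i| ^ K) (fun s _ => (hd s).hasDerivWithinAt) (fun s hs => ?_)
      Set.left_mem_uIcc Set.right_mem_uIcc
    · have h0 : g (update a i 0) = 0 := hg.eq_zero fun h => h i (by simp)
      rw [h0, sub_zero, sub_zero, update_eq_self] at hmv
      rw [pow_succ, ← mul_assoc]
      exact hmv
    · refine (h _).trans ?_
      rw [update_self]
      have := Set.abs_sub_left_of_mem_uIcc hs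
      exact mul_le_mul_of_nonneg_left (pow_le_pow_left₀ (abs_nonneg _) (by simpa using this) K) hC

theorem fderiv_eq_sum_single {F : (Fin m → ℝ) →L[ℝ] ℂ} (e : Fin m → ℝ) :
    F e = ∑ i, (e i : ℂ) * F (Pi.single i 1) := by
  conv_lhs => rw [pi_eq_sum_univ' e]
  simp [map_sum]

/-- Pulled back to one component of the torus, a flat Schwartz function is a Schwartz function. -/
theorem exists_pullback_flat (ε : Fin m → ℤˣ) (g : 𝓢(Fin m → ℝ, ℂ)) (hg : FlatOff (torus m) g) :
    ∃ G : 𝓢(Fin m → ℝ, ℂ), ∀ t, G t = g (signedParam ε t) := by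
  -- The functions `r t * h (signedParam ε t)`, with `r` of temperate growth and `h` flat, are
  -- closed under derivatives and linear forms, since the derivatives of `signedParam` have
  -- temperate growth.
  suffices h : ∃ G : 𝓢(Fin m → ℝ, ℂ), ∀ t, G t = 1 * g (signedParam ε t) by simpa using h
  refine exists_schwartzMap_of_set {F | ∃ (r : (Fin m → ℝ) → ℂ) (h : 𝓢(Fin m → ℝ, ℂ)),
    r.HasTemperateGrowth ∧ FlatOff (torus m) h ∧ F = fun t => r t * h (signedParam ε t)}
    ?_ ?_ ?_ ?_ ⟨fun _ => 1, g, by fun_prop, hg, rfl⟩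
  · rintro _ ⟨r, h, hr, hh, rfl⟩
    obtain ⟨K, C, hC⟩ := hr.2 0
    have hC0 : 0 ≤ C := by
      have := (norm_nonneg _).trans (hC 0)
      simpa using this
    obtain ⟨C1, hC1⟩ : ∃ C1, ∀ a, (1 + ‖a‖) ^ K * ‖h a‖ ≤ C1 :=
      ⟨_, fun a => by
        simpa using one_add_le_sup_seminorm_apply (𝕜 := ℝ) (m := (K, 0)) le_rfl le_rfl h a⟩
    choose C2 hC2 hC2' using fun i => exists_bound_of_flatOff i K h hh
    have hC10 : 0 ≤ C1 := le_trans (by positivity) (hC1 0)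
    refine ⟨C * (C1 + ∑ i, (2 ^ K * C2 i + C1)), fun t => ?_⟩
    have hr' := hC t
    rw [norm_iteratedFDeriv_zero] at hr'
    rw [norm_mul]
    refine (mul_le_mul_of_nonneg_right hr' (norm_nonneg _)).trans ?_
    rw [mul_assoc]
    gcongr
    set a := signedParam ε t with ha
    have habs : ∀ i, |a i| = posParam (t i) := fun i => by
      rw [ha, signedParam, abs_mul, abs_unit, one_mul, abs_of_pos (posParam_pos _)]
    have key : ∀ i, (1 + |t i|) ^ K * ‖h a‖ ≤ 2 ^ K * C2 i + C1 := by
      intro i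
      have hp := posParam_pos (t i)
      have ht : |t i| ≤ (posParam (t i) + (posParam (t i))⁻¹) / 2 := by
        conv_lhs => rw [eq_posParam_sub (t i)]
        rw [abs_le]
        have : 0 < (posParam (t i))⁻¹ := by positivity
        constructor <;> linarith
      -- For large positive `t i` the size of `t i` is that of the entry `a i`, and `h` decays; for
      -- large negative `t i` it is that of `(a i)⁻¹`, and `h` vanishes to infinite order on
      -- `a i = 0`.
      rcases le_total 1 (posParam (t i)) with h1 | h1
      · have : (posParam (t i))⁻¹ ≤ 1 := inv_le_one_of_one_le₀ h1
        have h2 : 1 + |t i| ≤ 1 + ‖a‖ := by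
          have := norm_le_pi_norm a i
          rw [Real.norm_eq_abs, habs] at this
          linarith
        calc (1 + |t i|) ^ K * ‖h a‖ ≤ (1 + ‖a‖) ^ K * ‖h a‖ := by gcongr
          _ ≤ C1 := hC1 a
          _ ≤ _ := by have := hC2 i; simp; positivity
      · have h3 : 1 ≤ (posParam (t i))⁻¹ := (one_le_inv₀ hp).2 h1
        have h2 : 1 + |t i| ≤ 2 * (posParam (t i))⁻¹ := by linarith
        calc (1 + |t i|) ^ K * ‖h a‖
            ≤ (2 * (posParam (t i))⁻¹) ^ K * (C2 i * posParam (t i) ^ K) := by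
              have := hC2' i a
              rw [habs] at this
              gcongr
          _ = 2 ^ K * C2 i := by
              rw [mul_pow, inv_pow]; field_simp
          _ ≤ _ := by linarith
    rcases isEmpty_or_nonempty (Fin m) with hm | hm
    · have : ‖t‖ ≤ ‖a‖ := by rw [Subsingleton.elim t a]
      have : (1 + ‖t‖) ^ K * ‖h a‖ ≤ (1 + ‖a‖) ^ K * ‖h a‖ := by gcongr
      simpa using this.trans (hC1 a)
    -- The sup norm is attained at one coordinate, to which the estimate `key` applies.
    · obtain ⟨i, hi⟩ : ∃ i, ‖t‖ = |t i| := by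
        obtain ⟨i, -, hi⟩ := Finset.exists_mem_eq_sup' Finset.univ_nonempty (fun i => ‖t i‖)
        refine ⟨i, le_antisymm ?_ (norm_le_pi_norm t i)⟩
        rw [pi_norm_le_iff_of_nonneg (abs_nonneg _)]
        intro j
        have := Finset.le_sup' (fun i => ‖t i‖) (Finset.mem_univ j)
        rw [hi] at this
        exact this
      rw [hi]
      refine (key i).trans ?_
      have := Finset.single_le_sum (f := fun i => 2 ^ K * C2 i + C1)
        (fun i _ => by have := hC2 i; positivity) (Finset.mem_univ i)
      linarith
  · rintro _ ⟨r, h, hr, hh, rfl⟩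
    exact (hr.1.differentiable (by simp)).mul
      (h.differentiable.comp ((hasTemperateGrowth_signedParam ε).1.differentiable (by simp)))
  · rintro _ ⟨r, h, hr, hh, rfl⟩ e
    have hφ := hasTemperateGrowth_signedParam ε
    have e1 : (fun t => fderiv ℝ (fun t => r t * h (signedParam ε t)) t e) =
        (fun t => fderiv ℝ r t e * h (signedParam ε t)) +
        ∑ i, fun t => (r t * (fderiv ℝ (signedParam ε) t e i : ℂ)) *
          (LineDeriv.lineDerivOp (Pi.single i (1 : ℝ) : Fin m → ℝ) h : 𝓢(Fin m → ℝ, ℂ)) (signedParam ε t) := by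
      ext t
      have d1 := (hr.1.differentiable (by simp) t).hasFDerivAt
      have d2 := (h.hasFDerivAt (signedParam ε t)).comp t
        (hφ.1.differentiable (by simp) t).hasFDerivAt
      have : fderiv ℝ (fun t => r t * h (signedParam ε t)) t = _ := (d1.mul d2).fderiv
      rw [this]
      simp only [Pi.add_apply, Finset.sum_apply, add_apply,
        smul_apply, ContinuousLinearMap.comp_apply, smul_eq_mul]
      rw [fderiv_eq_sum_single (F := fderiv ℝ h (signedParam ε t)), add_comm, Finset.mul_sum]
      congr 1
      · exact mul_comm _ _
      · refine Finset.sum_congr rfl fun i _ => ?_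
        rw [lineDerivOp_apply_eq_fderiv]; ring
    rw [e1]
    refine Submodule.add_mem _ (Submodule.subset_span ⟨_, h, ?_, hh, rfl⟩)
      (Submodule.sum_mem _ fun i _ => Submodule.subset_span ⟨_, _, ?_, flatOff_fderiv h hh _, rfl⟩)
    · exact hasTemperateGrowth_fderiv_apply hr e
    · have h1 := hasTemperateGrowth_fderiv_apply hφ e
      have h2 : (fun t => fderiv ℝ (signedParam ε) t e i).HasTemperateGrowth := by fun_prop
      fun_prop
  · rintro _ ⟨r, h, hr, hh, rfl⟩ l
    refine Submodule.subset_span ⟨fun t => (l t : ℂ) * r t, h, by fun_prop, hh, ?_⟩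
    ext t; ring

/-- The component of `partialTorus m` with signs `ε`. -/
def orthant (ε : Fin m → ℤˣ) : Set (Fin (m + 1) → ℝ) :=
  {a | ∀ i : Fin m, 0 < ((ε i : ℤ) : ℝ) * a i.castSucc}

theorem isOpen_orthant (ε : Fin m → ℤˣ) : IsOpen (orthant ε) := by
  simp only [orthant, Set.ofPred_forall]
  exact isOpen_iInter_of_finite fun i => isOpen_lt continuous_const (by fun_prop)

open Classical in
/-- The function on `ℝ^(m+1)` which on the component with signs `ε` is the Schwartz function `K` in
the coordinates given by `signedParam`, extended by zero. -/
noncomputable def pushOrthant (ε : Fin m → ℤˣ) (K : 𝓢((Fin m → ℝ) × ℝ, ℂ))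
    (a : Fin (m + 1) → ℝ) : ℂ :=
  if a ∈ orthant ε then K (signedParamInv ε (Fin.init a), a (Fin.last m)) else 0

/-- The derivative of `pushOrthant ε K` in the direction `e` is `pushOrthant ε K'` for this `K'`. -/
noncomputable def pushDeriv (ε : Fin m → ℤˣ) (e : Fin (m + 1) → ℝ) (K : 𝓢((Fin m → ℝ) × ℝ, ℂ)) :
    𝓢((Fin m → ℝ) × ℝ, ℂ) :=
  ∑ i : Fin m, smulLeftCLM ℂ (fun p : (Fin m → ℝ) × ℝ =>
      ((e i.castSucc * (((ε i : ℤ) : ℝ) * ((1 + posParamInv (p.1 i) ^ 2) / 2)) : ℝ) : ℂ))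
      (LineDeriv.lineDerivOp ((Pi.single i 1, 0) : (Fin m → ℝ) × ℝ) K : 𝓢((Fin m → ℝ) × ℝ, ℂ)) +
    LineDeriv.lineDerivOp ((0, e (Fin.last m)) : (Fin m → ℝ) × ℝ) K

theorem hasTemperateGrowth_pushCoeff (ε : Fin m → ℤˣ) (c : ℝ) (i : Fin m) :
    (fun p : (Fin m → ℝ) × ℝ =>
      ((c * (((ε i : ℤ) : ℝ) * ((1 + posParamInv (p.1 i) ^ 2) / 2)) : ℝ) : ℂ)).HasTemperateGrowth := by
  simp only [div_eq_mul_inv]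
  fun_prop

/-- The derivatives of `pushOrthant ε K` are functions of the same kind. On the boundary of the
orthant the derivative vanishes, because `K` decays rapidly where the parameter of a base variable
tends to `-∞`, that is, where that variable tends to `0`. -/
theorem hasFDerivAt_pushOrthant (ε : Fin m → ℤˣ) (K : 𝓢((Fin m → ℝ) × ℝ, ℂ))
    (a : Fin (m + 1) → ℝ) : DifferentiableAt ℝ (pushOrthant ε K) a ∧
      ∀ e, fderiv ℝ (pushOrthant ε K) a e = pushOrthant ε (pushDeriv ε e K) a := by
  by_cases ha : a ∈ orthant ε
  · let φ : (Fin (m + 1) → ℝ) → (Fin m → ℝ) × ℝ :=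
      fun a => (signedParamInv ε (Fin.init a), a (Fin.last m))
    let φ' : (Fin (m + 1) → ℝ) →L[ℝ] (Fin m → ℝ) × ℝ :=
      (ContinuousLinearMap.pi fun i => (((ε i : ℤ) : ℝ) *
        ((1 + (((ε i : ℤ) : ℝ) * a i.castSucc)⁻¹ ^ 2) / 2)) •
          ContinuousLinearMap.proj (R := ℝ) (φ := fun _ : Fin (m + 1) => ℝ) i.castSucc).prod
        (ContinuousLinearMap.proj (R := ℝ) (φ := fun _ : Fin (m + 1) => ℝ) (Fin.last m))
    have hφ : HasFDerivAt φ φ' a := by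
      refine HasFDerivAt.prodMk (hasFDerivAt_pi.2 fun i => ?_) (hasFDerivAt_apply _ _)
      have h1 : HasFDerivAt (fun a : Fin (m + 1) → ℝ => ((ε i : ℤ) : ℝ) * a i.castSucc)
          (((ε i : ℤ) : ℝ) • ContinuousLinearMap.proj (R := ℝ) (φ := fun _ : Fin (m + 1) => ℝ)
            i.castSucc) a := (hasFDerivAt_apply i.castSucc a).const_mul _
      have h2 : HasDerivAt (fun x : ℝ => (x - x⁻¹) / 2)
          ((1 + (((ε i : ℤ) : ℝ) * a i.castSucc)⁻¹ ^ 2) / 2) (((ε i : ℤ) : ℝ) * a i.castSucc) := by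
        have := ((hasDerivAt_id (((ε i : ℤ) : ℝ) * a i.castSucc)).sub
          (hasDerivAt_inv (ha i).ne')).div_const 2
        refine this.congr_deriv ?_
        rw [inv_pow]; ring
      refine (h2.comp_hasFDerivAt a h1).congr_fderiv ?_
      ext; simp; ring
    have hev : pushOrthant ε K =ᶠ[nhds a] K ∘ φ := by
      filter_upwards [(isOpen_orthant ε).mem_nhds ha] with b hb
      simp [pushOrthant, hb, φ]
    have hd : HasFDerivAt (pushOrthant ε K) ((fderiv ℝ K (φ a)).comp φ') a :=
      ((K.hasFDerivAt (φ a)).comp a hφ).congr_of_eventuallyEq hev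
    refine ⟨hd.differentiableAt, fun e => ?_⟩
    rw [hd.fderiv, pushOrthant, if_pos ha]
    have hpos : ∀ i : Fin m, posParamInv ((φ a).1 i) = (((ε i : ℤ) : ℝ) * a i.castSucc)⁻¹ := by
      intro i
      rw [posParamInv_eq]
      congr 1
      exact posParam_of_pos (ha i)
    have hsplit : φ' e = ∑ i : Fin m, (φ' e).1 i • ((Pi.single i 1, 0) : (Fin m → ℝ) × ℝ) +
        (0, e (Fin.last m)) := by
      ext j
      · simp [Prod.fst_sum, Finset.sum_apply, Pi.single_apply]
      · simp [Prod.snd_sum, φ']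
    rw [ContinuousLinearMap.comp_apply, hsplit, map_add, map_sum, pushDeriv, add_apply, sum_apply]
    congr 1
    refine Finset.sum_congr rfl fun i _ => ?_
    rw [smulLeftCLM_apply_apply (hasTemperateGrowth_pushCoeff ε _ i), lineDerivOp_apply_eq_fderiv,
      map_smul, hpos i, Complex.real_smul, smul_eq_mul]
    congr 2
    simp [φ']
    ring
  -- Off the orthant, some base variable of `a` has the wrong sign or is zero. Multiplying `K` by
  -- the square of its inverse shows that `pushOrthant ε K b` is of order `‖b - a‖ ^ 2`.
  · have h0 : HasFDerivAt (pushOrthant ε K) (0 : (Fin (m + 1) → ℝ) →L[ℝ] ℂ) a := by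
      obtain ⟨i, hi⟩ : ∃ i : Fin m, ((ε i : ℤ) : ℝ) * a i.castSucc ≤ 0 := by
        simpa [orthant] using ha
      let r : (Fin m → ℝ) × ℝ → ℂ := fun p => ((posParamInv (p.1 i) ^ 2 : ℝ) : ℂ)
      have hr : r.HasTemperateGrowth := by simp only [r]; fun_prop
      let C := SchwartzMap.seminorm ℝ 0 0 (smulLeftCLM ℂ r K)
      refine Asymptotics.IsBigO.hasFDerivAt (n := 2) (Asymptotics.IsBigO.of_bound C
        (.of_forall fun b => ?_)) one_lt_two
      have hC : 0 ≤ C := by positivity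
      by_cases hb : b ∈ orthant ε
      · have h1 := norm_le_seminorm ℝ (smulLeftCLM ℂ r K)
          (signedParamInv ε (Fin.init b), b (Fin.last m))
        have hp : posParamInv (signedParamInv ε (Fin.init b) i) =
            (((ε i : ℤ) : ℝ) * b i.castSucc)⁻¹ := by
          rw [posParamInv_eq]
          congr 1
          exact posParam_of_pos (hb i)
        rw [smulLeftCLM_apply_apply hr, norm_smul, Complex.norm_real, Real.norm_eq_abs, abs_sq, hp,
          inv_pow] at h1
        rw [pushOrthant, if_pos hb]
        have hbp := hb i
        have h2 : ((ε i : ℤ) : ℝ) * b i.castSucc ≤ ‖b - a‖ := by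
          calc _ ≤ ((ε i : ℤ) : ℝ) * b i.castSucc - ((ε i : ℤ) : ℝ) * a i.castSucc := by linarith
            _ ≤ |((ε i : ℤ) : ℝ) * (b i.castSucc - a i.castSucc)| := by
              rw [← mul_sub]; exact le_abs_self _
            _ = ‖(b - a) i.castSucc‖ := by rw [abs_mul, abs_unit, one_mul]; rfl
            _ ≤ _ := norm_le_pi_norm _ _
        rw [norm_pow, norm_norm]
        refine le_trans ?_ (mul_le_mul_of_nonneg_left (pow_le_pow_left₀ hbp.le h2 2) hC)
        rwa [inv_mul_eq_div, div_le_iff₀ (by positivity)] at h1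
      · rw [pushOrthant, if_neg hb, norm_zero]
        positivity
    refine ⟨h0.differentiableAt, fun e => ?_⟩
    rw [h0.fderiv, pushOrthant, if_neg ha]
    rfl

/-- Pushed forward to one component and extended by zero, a Schwartz function in the coordinates of
`signedParam` is a Schwartz function which is flat off `partialTorus m`. -/
theorem exists_pushOrthant (ε : Fin m → ℤˣ) (K : 𝓢((Fin m → ℝ) × ℝ, ℂ)) :
    ∃ G : 𝓢(Fin (m + 1) → ℝ, ℂ), FlatOff (partialTorus m) G ∧ ∀ a, G a = pushOrthant ε K a := by
  obtain ⟨G, hG⟩ : ∃ G : 𝓢(Fin (m + 1) → ℝ, ℂ), ∀ a, G a = pushOrthant ε K a := by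
    refine exists_schwartzMap_of_set (Set.range (pushOrthant ε)) ?_ ?_ ?_ ?_ ⟨K, rfl⟩
    · rintro _ ⟨K, rfl⟩
      refine ⟨SchwartzMap.seminorm ℝ 0 0 K, fun a => ?_⟩
      rw [pushOrthant]
      split_ifs
      · exact norm_le_seminorm ℝ K _
      · simp
    · rintro _ ⟨K, rfl⟩
      exact fun a => (hasFDerivAt_pushOrthant ε K a).1
    · rintro _ ⟨K, rfl⟩ e
      exact Submodule.subset_span ⟨pushDeriv ε e K,
        funext fun a => ((hasFDerivAt_pushOrthant ε K a).2 e).symm⟩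
    · rintro _ ⟨K, rfl⟩ l
      let r : (Fin m → ℝ) × ℝ → ℂ := fun p =>
        ((l (fun i => Fin.snoc (α := fun _ => ℝ) (signedParam ε p.1) p.2 i) : ℝ) : ℂ)
      have hr : r.HasTemperateGrowth := by
        have : (fun p : (Fin m → ℝ) × ℝ => (fun i =>
            Fin.snoc (α := fun _ => ℝ) (signedParam ε p.1) p.2 i : Fin (m + 1) → ℝ)).HasTemperateGrowth := by
          refine hasTemperateGrowth_pi fun i => ?_
          refine Fin.lastCases ?_ (fun i => ?_) i
          · simp only [Fin.snoc_last]; fun_prop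
          · simp only [Fin.snoc_castSucc]; fun_prop
        simp only [r]
        fun_prop
      refine Submodule.subset_span ⟨smulLeftCLM ℂ r K, funext fun a => ?_⟩
      simp only [pushOrthant]
      split_ifs with ha
      · rw [smulLeftCLM_apply_apply hr]
        simp only [r, smul_eq_mul]
        rw [signedParam_signedParamInv ε (Fin.init a) ha]
        simp only [Fin.snoc_init_self]
      · simp
  refine ⟨G, ?_, hG⟩
  have key : ∀ k : ℕ, ∀ (K : 𝓢((Fin m → ℝ) × ℝ, ℂ)) (G : 𝓢(Fin (m + 1) → ℝ, ℂ)),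
      (∀ a, G a = pushOrthant ε K a) → ∀ x ∉ partialTorus m, iteratedFDeriv ℝ k G x = 0 := by
    intro k
    induction k with
    | zero =>
      intro K G hG x hx
      rw [← norm_eq_zero, norm_iteratedFDeriv_zero, hG, pushOrthant, if_neg, norm_zero]
      exact fun h => hx fun i h0 => (h i).ne' (by
        have : x i.castSucc = 0 := h0
        rw [this, mul_zero])
    | succ k ih =>
      intro K G hG x hx
      ext v
      rw [iteratedFDeriv_succ_apply_right]
      have hG' : ∀ a, (LineDeriv.lineDerivOp (v (Fin.last k)) G : 𝓢(Fin (m + 1) → ℝ, ℂ)) a =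
          pushOrthant ε (pushDeriv ε (v (Fin.last k)) K) a := fun a => by
        rw [lineDerivOp_apply_eq_fderiv, ← (hasFDerivAt_pushOrthant ε K a).2]
        congr 2
        exact funext hG
      have h1 := ih _ _ hG' x hx
      have h2 : ((LineDeriv.lineDerivOp (v (Fin.last k)) G : 𝓢(Fin (m + 1) → ℝ, ℂ)) :
          (Fin (m + 1) → ℝ) → ℂ) =
          ContinuousLinearMap.apply ℝ ℂ (v (Fin.last k)) ∘ fderiv ℝ G := by
        ext y; simp [lineDerivOp_apply_eq_fderiv]
      have hs : ContDiffAt ℝ k (fderiv ℝ G) x :=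
        ((G.smooth (k + 1 : ℕ)).fderiv_right (m := k) (by norm_cast)).contDiffAt
      rw [h2, ContinuousLinearMap.iteratedFDeriv_comp_left _ hs le_rfl] at h1
      have h3 := congrArg (fun T => T (Fin.init v)) h1
      simpa using h3
  exact fun x hx k => key k K G hG x hx

theorem isOpen_torus (m : ℕ) : IsOpen (torus m) := by
  simp only [torus, Set.ofPred_forall]
  exact isOpen_iInter_of_finite fun i => isOpen_ne_fun (by fun_prop) (by fun_prop)

theorem isOpen_partialTorus (m : ℕ) : IsOpen (partialTorus m) :=
  (isOpen_torus m).preimage (by unfold Fin.init; fun_prop)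

/-- There are flat Schwartz functions equal to `1` near a given point of the torus; smoothness on
`partialTorus m` is tested by multiplying with them. -/
theorem exists_flat_bump (a : Fin m → ℝ) (ha : a ∈ torus m) :
    ∃ g : 𝓢(Fin m → ℝ, ℂ), FlatOff (torus m) g ∧ ∀ᶠ b in nhds a, g b = 1 := by
  obtain ⟨r, hr, hrs⟩ := Metric.nhds_basis_closedBall.mem_iff.1 ((isOpen_torus m).mem_nhds ha)
  let φ : ContDiffBump a := ⟨r / 2, r, by positivity, by linarith⟩
  let f : (Fin m → ℝ) → ℂ := fun x => (φ x : ℂ)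
  have hsupp : tsupport f ⊆ Metric.closedBall a r := by
    rw [← φ.tsupport_eq]
    exact closure_mono fun x hx hx' => hx (by simp [f, hx'])
  have hc : HasCompactSupport f := (isCompact_closedBall a r).of_isClosed_subset
    (isClosed_tsupport f) hsupp
  refine ⟨hc.toSchwartzMap (Complex.ofRealCLM.contDiff.comp φ.contDiff), fun x hx k => ?_, ?_⟩
  · have : x ∉ tsupport f := fun h => hx (hrs (hsupp h))
    exact image_eq_zero_of_notMem_tsupport fun h => this (tsupport_iteratedFDeriv_subset k h)
  · filter_upwards [φ.eventuallyEq_one] with b hb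
    change (φ b : ℂ) = 1
    simp [hb]

/-- A function on `partialTorus m` is fiberwise Schwartz as soon as, on each component and in the
coordinates given by `signedParam`, its products with flat Schwartz functions of the base variables
are Schwartz. -/
theorem isFiberSchwartz_of_signedParam (h H : (Fin (m + 1) → ℝ) → ℂ)
    (hH : ∀ a ∈ torus (m + 1), H a = h a)
    (hK : ∀ g : 𝓢(Fin m → ℝ, ℂ), FlatOff (torus m) g → ∀ ε : Fin m → ℤˣ,
      ∃ K : 𝓢((Fin m → ℝ) × ℝ, ℂ), ∀ t x,
        K (t, x) = g (signedParam ε t) * H (Fin.snoc (signedParam ε t) x)) :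
    IsFiberSchwartz h := by
  have main : ∀ g : 𝓢(Fin m → ℝ, ℂ), FlatOff (torus m) g →
      IsSchwartzOn (partialTorus m) fun a => g (Fin.init a) * H a := by
    intro g hg
    choose K hK using hK g hg
    choose G hG hG' using fun ε => exists_pushOrthant ε (K ε)
    -- The components of `partialTorus m` are disjoint, so at each point only one summand
    -- contributes.
    refine ⟨∑ ε, G ε, fun x hx k => ?_, fun a ha => ?_⟩
    · have : ((∑ ε, G ε : 𝓢(Fin (m + 1) → ℝ, ℂ)) : (Fin (m + 1) → ℝ) → ℂ) = fun x => ∑ ε, G ε x := by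
        ext; rw [sum_apply]
      rw [this, iteratedFDeriv_fun_sum_apply fun ε _ => ((G ε).smooth k).contDiffAt]
      exact Finset.sum_eq_zero fun ε _ => hG ε x hx k
    · rw [sum_apply]
      obtain ⟨ε, hε⟩ := exists_signs _ ha
      rw [Finset.sum_eq_single ε]
      · rw [hG', pushOrthant, if_pos (show a ∈ orthant ε from hε), hK, signedParam_signedParamInv _ _ hε, Fin.snoc_init_self]
      · intro ε' _ hne
        rw [hG', pushOrthant, if_neg]
        intro h'
        apply hne
        ext i
        have h1 := hε i
        have h2 : 0 < ((ε' i : ℤ) : ℝ) * Fin.init a i := h' i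
        rcases Int.units_eq_one_or (ε i) with e | e <;>
          rcases Int.units_eq_one_or (ε' i) with e' | e' <;> rw [e] at h1 ⊢ <;> rw [e'] at h2 ⊢ <;>
          push_cast at h1 h2 <;> linarith
      · simp
  refine ⟨H, hH, fun a ha => ?_, main⟩
  obtain ⟨g, hg, hg1⟩ := exists_flat_bump (Fin.init a) ha
  obtain ⟨G, -, hG⟩ := main g hg
  have hev : H =ᶠ[nhds a] G := by
    have hc : Filter.Tendsto (fun b : Fin (m + 1) → ℝ => Fin.init b) (nhds a) (nhds (Fin.init a)) :=
      (by unfold Fin.init; fun_prop : Continuous fun b : Fin (m + 1) → ℝ => Fin.init b).tendsto a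
    filter_upwards [hc.eventually hg1, (isOpen_partialTorus m).mem_nhds ha] with b h1 h2
    rw [hG b h2]
    simp only [h1, one_mul]
  exact ((G.smooth ⊤).contDiffAt.congr_of_eventuallyEq hev).contDiffWithinAt

end TorusCoordinates

/-! ### Characters of the real line -/

section Characters

/-- A nontrivial continuous unitary character of `ℝ` is `x ↦ exp(2πiλx)` with `λ ≠ 0`. -/
theorem exists_frequency (ψ : AddChar ℝ Circle) (hcont : Continuous ψ) (hψ : ψ ≠ 1) :
    ∃ lam : ℝ, lam ≠ 0 ∧ ∀ x, (ψ x : ℂ) = Complex.exp ((2 * Real.pi * (lam * x) : ℝ) * Complex.I) := by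
  have hc : Continuous fun x => (ψ x : ℂ) := continuous_subtype_val.comp hcont
  -- The primitive `F` of `ψ` satisfies `F (x + h) - F x = ψ x * F h`. So `ψ` is differentiable,
  -- and being multiplicative it solves `ψ' = c ψ`.
  let F : ℝ → ℂ := fun x => ∫ t in (0 : ℝ)..x, (ψ t : ℂ)
  have hF : ∀ x, HasDerivAt F (ψ x : ℂ) x := fun x =>
    intervalIntegral.integral_hasDerivAt_right (hc.intervalIntegrable _ _)
      hc.aestronglyMeasurable.stronglyMeasurableAtFilter hc.continuousAt
  obtain ⟨h, hh⟩ : ∃ h, F h ≠ 0 := by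
    by_contra! hcon
    have h1 : F = fun _ => 0 := funext hcon
    have h2 := hF 0
    rw [h1] at h2
    have := h2.unique (hasDerivAt_const 0 (0 : ℂ))
    simp at this
  have hmul : ∀ x, (ψ x : ℂ) = (F (x + h) - F x) / F h := by
    intro x
    rw [eq_div_iff hh]
    have : F (x + h) - F x = ∫ t in x..x + h, (ψ t : ℂ) :=
      intervalIntegral.integral_interval_sub_left (hc.intervalIntegrable _ _)
        (hc.intervalIntegrable _ _)
    rw [this, ← intervalIntegral.integral_const_mul]
    have h3 := intervalIntegral.integral_comp_add_left (a := 0) (b := h) (fun t => (ψ t : ℂ)) x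
    rw [add_zero] at h3
    rw [← h3]
    simp [AddChar.map_add_eq_mul]
  let c : ℂ := ((ψ h : ℂ) - 1) / F h
  have hder : ∀ x, HasDerivAt (fun x => (ψ x : ℂ)) (c * ψ x) x := by
    intro x
    have h1 : HasDerivAt (fun x => (F (x + h) - F x) / F h) (((ψ (x + h) : ℂ) - ψ x) / F h) x :=
      (((hF (x + h)).comp_add_const x h).sub (hF x)).div_const _
    rw [← funext hmul] at h1
    refine h1.congr_deriv ?_
    simp only [c, AddChar.map_add_eq_mul, Circle.coe_mul]
    ring
  have hconst : ∀ x, (ψ x : ℂ) * Complex.exp (-(c * x)) = 1 := by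
    have hd : ∀ x : ℝ, HasDerivAt (fun x : ℝ => (ψ x : ℂ) * Complex.exp (-(c * x))) 0 x := by
      intro x
      have h1 : HasDerivAt (fun x : ℝ => -(c * (x : ℂ))) (-(c * 1)) x :=
        ((Complex.ofRealCLM.hasDerivAt (x := x)).const_mul c).neg
      refine ((hder x).mul h1.cexp).congr_deriv ?_
      ring
    intro x
    have := is_const_of_deriv_eq_zero (fun x => (hd x).differentiableAt) (fun x => (hd x).deriv) x 0
    simpa using this
  have hexp : ∀ x, (ψ x : ℂ) = Complex.exp (c * x) := by
    intro x
    have := hconst x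
    rw [Complex.exp_neg] at this
    field_simp at this
    exact this
  have hre : c.re = 0 := by
    have h1 := Circle.norm_coe (ψ 1)
    rw [hexp 1, Complex.norm_exp] at h1
    simpa using h1
  refine ⟨c.im / (2 * Real.pi), ?_, fun x => ?_⟩
  · intro h0
    have him : c.im = 0 := by
      have := Real.pi_ne_zero
      field_simp at h0
      simpa using h0
    apply hψ
    ext x
    have hc0 : c = 0 := Complex.ext hre him
    have h1 := hexp x
    rw [hc0] at h1
    simpa using h1
  · rw [hexp]
    congr 1
    have : c = c.im * Complex.I := by
      apply Complex.ext <;> simp [hre]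
    rw [this]
    have := Real.pi_ne_zero
    push_cast
    field_simp
    simp [mul_comm]

end Characters

/-! ### Self-dual measures -/

section SelfDual
variable {V : Type*} [NormedAddCommGroup V] [NormedSpace ℝ V]

/-- A test function, by which a self-dual measure is determined among its multiples. -/
theorem exists_schwartzMap_ne_zero [FiniteDimensional ℝ V] : ∃ f : 𝓢(V, ℂ), f 0 ≠ 0 := by
  let φ : ContDiffBump (0 : V) := ⟨1, 2, one_pos, one_lt_two⟩
  have hc : HasCompactSupport fun x => (φ x : ℂ) := φ.hasCompactSupport.comp_left (g := Complex.ofReal) rfl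
  refine ⟨hc.toSchwartzMap (Complex.ofRealCLM.contDiff.comp φ.contDiff), ?_⟩
  change (φ 0 : ℂ) ≠ 0
  have h1 : φ 0 = 1 := φ.one_of_mem_closedBall (Metric.mem_closedBall_self φ.rIn_pos.le)
  simp [h1]

variable [MeasurableSpace V] [BorelSpace V]

/-- The self-dual Haar measure is unique: rescaling it by `c` scales the double transform by `c²`. -/
theorem IsSelfDual.unique [FiniteDimensional ℝ V] {B : V → V → ℝ} {ψ : AddChar ℝ Circle} {μ ν : Measure V}
    (hμ : IsSelfDual B ψ μ) (hν : IsSelfDual B ψ ν) : μ = ν := by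
  have := hμ.1
  have := hν.1
  obtain ⟨f, hf⟩ := exists_schwartzMap_ne_zero (V := V)
  have hc := Measure.isAddLeftInvariant_eq_smul μ ν
  set c := Measure.addHaarScalarFactor μ ν with hcdef
  have h1 := hμ.2 f 0
  rw [hc] at h1
  simp only [integral_smul_nnreal_measure] at h1
  have h2 := hν.2 f 0
  simp only [NNReal.smul_def, Complex.real_smul, mul_assoc, integral_const_mul] at h1
  rw [h2] at h1
  have h4 : ((c * c : NNReal) : ℂ) * f 0 = f 0 := by
    push_cast
    rw [mul_assoc]
    exact h1
  have h5 : c * c = 1 := by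
    have := mul_right_cancel₀ hf (h4.trans (one_mul _).symm)
    exact_mod_cast this
  have h6 : c = 1 := by
    have := mul_self_eq_one_iff (a := (c : ℝ))
    rcases this.1 (by exact_mod_cast h5) with h | h
    · exact_mod_cast h
    · linarith [c.2, show (c : ℝ) = -1 from h, NNReal.coe_nonneg c]
  rw [hc, h6, one_smul]

/-- By uniqueness, any self-dual measure which can be written down is the chosen one. -/
theorem selfDualHaar_eq [FiniteDimensional ℝ V] {B : V → V → ℝ} {ψ : AddChar ℝ Circle} {μ : Measure V}
    (hμ : IsSelfDual B ψ μ) : selfDualHaar B ψ = μ :=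
  (Classical.epsilon_spec (p := fun μ => IsSelfDual B ψ μ) ⟨μ, hμ⟩).unique hμ

variable {ι : Type*} [Fintype ι]

/-- Fourier inversion on `ℝ^ι`. -/
theorem fourier_inversion_pi (h : 𝓢(ι → ℝ, ℂ)) (z : ι → ℝ) :
    ∫ ξ : ι → ℝ, (∫ x : ι → ℝ, h x * Complex.exp ((-(2 * Real.pi * ∑ i, x i * ξ i) : ℝ) * Complex.I)) *
      Complex.exp ((2 * Real.pi * ∑ i, z i * ξ i : ℝ) * Complex.I) = h z := by
  let h' : 𝓢(EuclideanSpace ℝ ι, ℂ) :=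
    compCLMOfContinuousLinearEquiv ℂ (EuclideanSpace.equiv ι ℝ) h
  have h1 : FourierTransformInv.fourierInv (FourierTransform.fourier h') = h' :=
    FourierTransform.fourierInv_fourier_eq h'
  have h2 := congrArg (fun f : 𝓢(EuclideanSpace ℝ ι, ℂ) => f (WithLp.toLp 2 z)) h1
  simp only [fourierInv_coe, fourier_coe, Real.fourierInv_eq] at h2
  have h3 : h' (WithLp.toLp 2 z) = h z := rfl
  have e1 : ∀ ξ : EuclideanSpace ℝ ι, FourierTransform.fourier (h' : EuclideanSpace ℝ ι → ℂ) ξ =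
      ∫ x : ι → ℝ, h x * Complex.exp ((-(2 * Real.pi * ∑ i, x i * ξ i) : ℝ) * Complex.I) := by
    intro ξ
    rw [Real.fourier_eq, ← (PiLp.volume_preserving_ofLp ι).integral_comp
      (MeasurableEquiv.toLp 2 (ι → ℝ)).symm.measurableEmbedding]
    refine integral_congr_ae (.of_forall fun x => ?_)
    simp only [Circle.smul_def, Real.fourierChar_apply, smul_eq_mul]
    rw [mul_comm]
    have : h' x = h x.ofLp := rfl
    rw [this]
    congr 3
    simp [PiLp.inner_apply, mul_comm]
  rw [h3] at h2
  rw [← h2, ← (PiLp.volume_preserving_ofLp ι).integral_comp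
      (MeasurableEquiv.toLp 2 (ι → ℝ)).symm.measurableEmbedding]
  refine integral_congr_ae (.of_forall fun x => ?_)
  simp only [e1, Circle.smul_def, Real.fourierChar_apply, smul_eq_mul]
  rw [mul_comm]
  congr 3

/-- The change of variables which permutes and rescales the coordinates. -/
theorem integral_comp_mul_perm (τ : Equiv.Perm ι) (s : ι → ℝ) (hs : ∀ i, s i ≠ 0) (Φ : (ι → ℝ) → ℂ) :
    ∫ y : ι → ℝ, Φ (fun i => s i * y (τ i)) = ((∏ i, |s i|⁻¹ : ℝ) : ℂ) * ∫ y, Φ y := by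
  classical
  have h1 : ∫ y : ι → ℝ, Φ (fun i => s i * y (τ i)) = ∫ y : ι → ℝ, Φ (fun i => s i * y i) := by
    have := (volume_measurePreserving_piCongrLeft (fun _ : ι => ℝ) τ.symm).integral_comp'
      (fun y => Φ (fun i => s i * y i))
    rw [← this]
    refine integral_congr_ae (.of_forall fun y => ?_)
    simp only
    congr 1
    ext i
    congr 1
    have := Equiv.piCongrLeft_apply_apply (fun _ : ι => ℝ) τ.symm y (τ i)
    simp only [Equiv.symm_apply_apply] at this
    exact this.symm
  have hdet : (Matrix.diagonal s).det ≠ 0 := by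
    rw [Matrix.det_diagonal]; exact Finset.prod_ne_zero_iff.2 fun i _ => hs i
  have h2 := Real.map_matrix_volume_pi_eq_smul_volume_pi hdet
  have h3 : ∀ y : ι → ℝ, Matrix.toLin' (Matrix.diagonal s) y = fun i => s i * y i := fun y => by
    ext i; simp [Matrix.mulVec_diagonal]
  let e : (ι → ℝ) ≃L[ℝ] (ι → ℝ) :=
    ((Matrix.toLin' (Matrix.diagonal s)).equivOfDetNeZero (by simpa using hdet)).toContinuousLinearEquiv
  have h4 : ∫ y : ι → ℝ, Φ (fun i => s i * y i) =
      ∫ y, Φ y ∂(Measure.map (Matrix.toLin' (Matrix.diagonal s)) volume) := by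
    have : (Matrix.toLin' (Matrix.diagonal s) : (ι → ℝ) → ι → ℝ) = e.toHomeomorph.toMeasurableEquiv := rfl
    rw [this, integral_map_equiv]
    refine integral_congr_ae (.of_forall fun y => ?_)
    simp only [← this, h3]
  rw [h1, h4, h2, integral_smul_measure, Matrix.det_diagonal, Complex.real_smul,
    ENNReal.toReal_ofReal (abs_nonneg _), abs_inv, Finset.abs_prod, Finset.prod_inv_distrib]

/-- The self-dual measure for a bilinear form which in suitable coordinates pairs each coordinate
with one other. -/
theorem isSelfDual_of_coords (L : V ≃L[ℝ] (ι → ℝ)) (μ : Measure V) (hL : MeasurePreserving L μ volume)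
    (τ : Equiv.Perm ι) (s : ι → ℝ) (hs : ∀ i, s i ≠ 0) (B : V → V → ℝ)
    (hB : ∀ x y, B x y = ∑ i, s i * (L x i * L y (τ i))) (ψ : AddChar ℝ Circle) (lam : ℝ)
    (hlam : lam ≠ 0)
    (hψ : ∀ x, (ψ x : ℂ) = Complex.exp ((2 * Real.pi * (lam * x) : ℝ) * Complex.I)) :
    IsSelfDual B ψ (ENNReal.ofReal (∏ i, √|lam * s i|) • μ) := by
  have hμ : μ = Measure.map L.symm volume := by
    rw [← hL.map_eq, Measure.map_map L.symm.continuous.measurable hL.measurable]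
    simp
  have hH : μ.IsAddHaarMeasure := by
    rw [hμ]; exact L.symm.isAddHaarMeasure_map volume
  have hpos : 0 < ∏ i, √|lam * s i| := Finset.prod_pos fun i _ =>
    Real.sqrt_pos.2 (abs_pos.2 (mul_ne_zero hlam (hs i)))
  refine ⟨Measure.IsAddHaarMeasure.smul μ (by simpa using hpos) ENNReal.ofReal_ne_top, fun f z => ?_⟩
  have hint : ∀ g : V → ℂ, ∫ x, g x ∂μ = ∫ x : ι → ℝ, g (L.symm x) := fun g => by
    rw [← hL.integral_comp L.toHomeomorph.measurableEmbedding]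
    simp
  let h : 𝓢(ι → ℝ, ℂ) := compCLMOfContinuousLinearEquiv ℂ L.symm f
  simp only [integral_smul_measure, hint, hB, ContinuousLinearEquiv.apply_symm_apply, hψ,
    ENNReal.toReal_ofReal hpos.le, Complex.real_smul]
  have e1 : ∀ (x y : ι → ℝ), lam * (∑ i, s i * (x i * y (τ i))) = ∑ i, x i * ((lam * s i) * y (τ i)) :=
    fun x y => by rw [Finset.mul_sum]; exact Finset.sum_congr rfl fun i _ => by ring
  simp only [mul_neg, e1]
  have e2 := integral_comp_mul_perm τ (fun i => lam * s i) (fun i => mul_ne_zero hlam (hs i))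
    (fun ξ => (∫ x : ι → ℝ, h x * Complex.exp ((-(2 * Real.pi * ∑ i, x i * ξ i) : ℝ) * Complex.I)) *
      Complex.exp ((2 * Real.pi * ∑ i, L z i * ξ i : ℝ) * Complex.I))
  rw [fourier_inversion_pi] at e2
  simp only [mul_assoc, integral_const_mul]
  have e3 : h (L z) = f z := by simp [h]
  rw [e3] at e2
  simp only [mul_assoc] at e2
  change _ * (_ * (∫ y : ι → ℝ, (∫ x : ι → ℝ, h x * _) * _)) = _
  rw [e2]
  have e4 : (∏ i, √|lam * s i|) * ((∏ i, √|lam * s i|) * ∏ i, |lam * s i|⁻¹) = 1 := by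
    rw [← Finset.prod_mul_distrib, ← Finset.prod_mul_distrib]
    refine Finset.prod_eq_one fun i _ => ?_
    have : |lam * s i| ≠ 0 := abs_ne_zero.2 (mul_ne_zero hlam (hs i))
    rw [← mul_assoc, Real.mul_self_sqrt (abs_nonneg _), mul_inv_cancel₀ this]
  rw [← mul_assoc, ← mul_assoc, ← Complex.ofReal_mul, ← Complex.ofReal_mul, mul_assoc, e4]
  simp

end SelfDual

/-! ### Fourier transforms of quadratic phases -/

section Gaussian
variable {ι : Type*} [Fintype ι]
open Filter Topology

/-- Parseval's formula for a Gaussian with complex variances. -/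
theorem integral_fourier_gaussian (h : 𝓢(ι → ℝ, ℂ)) (k : ι → ℝ) (z : ι → ℂ) (hz : ∀ i, 0 < (z i).re) :
    ∫ x : ι → ℝ, Complex.exp (-∑ i, (Real.pi * z i) * (x i : ℂ) ^ 2) *
      ∫ y : ι → ℝ, h y * Complex.exp ((-(2 * Real.pi * ∑ i, k i * (x i * y i)) : ℝ) * Complex.I) =
    (∏ i, (1 / z i) ^ (1 / 2 : ℂ)) *
      ∫ y : ι → ℝ, Complex.exp (-∑ i, (Real.pi * k i ^ 2 / z i) * (y i : ℂ) ^ 2) * h y := by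
  have hb : ∀ i, 0 < ((Real.pi : ℂ) * z i).re := fun i => by
    simpa using mul_pos Real.pi_pos (hz i)
  have hg : Integrable fun x : ι → ℝ => Complex.exp (-∑ i, (Real.pi * z i) * (x i : ℂ) ^ 2) := by
    simpa using GaussianFourier.integrable_cexp_neg_sum_mul_add hb (fun _ => 0)
  have hint : Integrable (fun p : (ι → ℝ) × (ι → ℝ) =>
      Complex.exp (-∑ i, (Real.pi * z i) * (p.1 i : ℂ) ^ 2) * (h p.2 *
        Complex.exp ((-(2 * Real.pi * ∑ i, k i * (p.1 i * p.2 i)) : ℝ) * Complex.I)))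
      (volume.prod volume) := by
    refine (hg.mul_prod h.integrable).mono (Continuous.aestronglyMeasurable ?_)
      (.of_forall fun p => ?_)
    · have := h.continuous
      fun_prop
    · rw [norm_mul, norm_mul, Complex.norm_exp_ofReal_mul_I, mul_one, norm_mul]
  simp only [← integral_const_mul]
  rw [integral_integral_swap hint]
  refine integral_congr_ae (.of_forall fun y => ?_)
  have h1 := GaussianFourier.integral_cexp_neg_sum_mul_add hb
    (fun i => -(2 * Real.pi * k i * y i) * Complex.I)
  have h2 : ∀ x : ι → ℝ, Complex.exp (-∑ i, (Real.pi * z i) * (x i : ℂ) ^ 2) * (h y *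
        Complex.exp ((-(2 * Real.pi * ∑ i, k i * (x i * y i)) : ℝ) * Complex.I)) =
      h y * Complex.exp (-∑ i, (Real.pi * z i) * (x i : ℂ) ^ 2 +
        ∑ i, (-(2 * Real.pi * k i * y i) * Complex.I) * x i) := by
    intro x
    rw [Complex.exp_add]
    have : ((-(2 * Real.pi * ∑ i, k i * (x i * y i)) : ℝ) : ℂ) * Complex.I =
        ∑ i, (-(2 * Real.pi * k i * y i) * Complex.I) * x i := by
      push_cast
      rw [Finset.mul_sum, ← Finset.sum_neg_distrib, Finset.sum_mul]
      exact Finset.sum_congr rfl fun i _ => by ring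
    rw [this]; ring
  simp only [h2]
  rw [integral_const_mul, h1, Finset.prod_mul_distrib, ← Complex.exp_sum]
  have h3 : ∀ i, (Real.pi : ℂ) / (Real.pi * z i) = 1 / z i := fun i => by
    have : (Real.pi : ℂ) ≠ 0 := by exact_mod_cast Real.pi_ne_zero
    have hz0 : z i ≠ 0 := fun h0 => by have := hz i; rw [h0] at this; simp at this
    field_simp
  have h4 : ∑ i, (-(2 * Real.pi * k i * y i) * Complex.I) ^ 2 / (4 * (Real.pi * z i)) =
      -∑ i, (Real.pi * k i ^ 2 / z i) * (y i : ℂ) ^ 2 := by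
    rw [← Finset.sum_neg_distrib]
    refine Finset.sum_congr rfl fun i _ => ?_
    have : (Real.pi : ℂ) ≠ 0 := by exact_mod_cast Real.pi_ne_zero
    have hz0 : z i ≠ 0 := fun h0 => by have := hz i; rw [h0] at this; simp at this
    field_simp
    rw [Complex.I_sq]
    ring
  simp only [h3, h4]
  ring

/-- The Weil formula for a nondegenerate diagonal quadratic form on `ℝ^ι`, the limit of the Gaussian
formula as the real parts of the variances tend to zero. -/
theorem integral_fourier_chirp (h : 𝓢(ι → ℝ, ℂ)) (k s : ι → ℝ) (hk : ∀ i, k i ≠ 0)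
    (hs : ∀ i, s i ≠ 0) :
    ∫ x : ι → ℝ, Complex.exp (-∑ i, (Real.pi * (s i * Complex.I)) * (x i : ℂ) ^ 2) *
      ∫ y : ι → ℝ, h y * Complex.exp ((-(2 * Real.pi * ∑ i, k i * (x i * y i)) : ℝ) * Complex.I) =
    (∏ i, (1 / (s i * Complex.I)) ^ (1 / 2 : ℂ)) *
      ∫ y : ι → ℝ, Complex.exp (-∑ i, (Real.pi * k i ^ 2 / (s i * Complex.I)) * (y i : ℂ) ^ 2) * h y := by
  classical
  let b : (ι → ℝ) →L[ℝ] (ι → ℝ) →L[ℝ] ℝ := LinearMap.toContinuousLinearMap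
    (LinearMap.toContinuousLinearMap.toLinearMap ∘ₗ LinearMap.mk₂ ℝ (fun y x : ι → ℝ => ∑ i, k i * (x i * y i))
      (fun a b c => by rw [← Finset.sum_add_distrib]; exact Finset.sum_congr rfl fun i _ => by simp; ring)
      (fun a b c => by rw [smul_eq_mul, Finset.mul_sum]; exact Finset.sum_congr rfl fun i _ => by simp; ring)
      (fun a b c => by rw [← Finset.sum_add_distrib]; exact Finset.sum_congr rfl fun i _ => by simp; ring)
      (fun a b c => by rw [smul_eq_mul, Finset.mul_sum]; exact Finset.sum_congr rfl fun i _ => by simp; ring))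
  have hb : ∀ y x, b y x = ∑ i, k i * (x i * y i) := fun _ _ => rfl
  obtain ⟨G, hG⟩ := exists_fourier volume b (fun l => ⟨fun i => l (Pi.single i 1) / k i, by
    ext x
    rw [hb]
    conv_rhs => rw [pi_eq_sum_univ' x]
    rw [map_sum]
    refine Finset.sum_congr rfl fun i _ => ?_
    rw [map_smul, smul_eq_mul]
    have := hk i
    field_simp⟩) h
  have hG' : ∀ x : ι → ℝ, ∫ y : ι → ℝ, h y *
      Complex.exp ((-(2 * Real.pi * ∑ i, k i * (x i * y i)) : ℝ) * Complex.I) = G x := fun x => (hG x).symm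
  simp only [hG']
  let z : ℝ → ι → ℂ := fun ε i => ε + s i * Complex.I
  have hz : ∀ i, Tendsto (fun ε => z ε i) (𝓝[>] 0) (𝓝 (s i * Complex.I)) := fun i => by
    have : Continuous fun ε : ℝ => z ε i := by fun_prop
    have h1 := this.tendsto 0
    simp only [z, Complex.ofReal_zero, zero_add] at h1
    exact h1.mono_left nhdsWithin_le_nhds
  have hsI : ∀ i, (s i : ℂ) * Complex.I ≠ 0 := fun i => by simp [hs i]
  have hre : ∀ ε i, (z ε i).re = ε := fun ε i => by simp [z]
  have hlim1 : Tendsto (fun ε => ∫ x : ι → ℝ,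
      Complex.exp (-∑ i, (Real.pi * z ε i) * (x i : ℂ) ^ 2) * G x) (𝓝[>] 0)
      (𝓝 (∫ x : ι → ℝ, Complex.exp (-∑ i, (Real.pi * (s i * Complex.I)) * (x i : ℂ) ^ 2) * G x)) := by
    refine tendsto_integral_filter_of_dominated_convergence (fun x => ‖G x‖) (.of_forall fun ε => ?_)
      ?_ G.integrable.norm (.of_forall fun x => ?_)
    · have := G.continuous
      exact Continuous.aestronglyMeasurable (by fun_prop)
    · filter_upwards [self_mem_nhdsWithin] with ε hε
      refine .of_forall fun x => ?_
      rw [norm_mul, Complex.norm_exp]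
      refine mul_le_of_le_one_left (norm_nonneg _) (Real.exp_le_one_iff.2 ?_)
      rw [Complex.neg_re, Complex.re_sum, neg_nonpos]
      refine Finset.sum_nonneg fun i _ => ?_
      rw [← Complex.ofReal_pow, Complex.re_mul_ofReal, Complex.re_ofReal_mul, hre]
      have : 0 < ε := hε
      positivity
    · refine Tendsto.mul_const _ ((Complex.continuous_exp.tendsto _).comp (Tendsto.neg
        (tendsto_finsetSum _ fun i _ => ((hz i).const_mul _).mul_const _)))
  have hlim2 : Tendsto (fun ε => (∏ i, (1 / z ε i) ^ (1 / 2 : ℂ)) * ∫ y : ι → ℝ,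
      Complex.exp (-∑ i, (Real.pi * k i ^ 2 / z ε i) * (y i : ℂ) ^ 2) * h y) (𝓝[>] 0)
      (𝓝 ((∏ i, (1 / (s i * Complex.I)) ^ (1 / 2 : ℂ)) * ∫ y : ι → ℝ,
        Complex.exp (-∑ i, (Real.pi * k i ^ 2 / (s i * Complex.I)) * (y i : ℂ) ^ 2) * h y)) := by
    refine Tendsto.mul (tendsto_finsetProd _ fun i _ => ?_) ?_
    · have h1 : Tendsto (fun ε => 1 / z ε i) (𝓝[>] 0) (𝓝 (1 / (s i * Complex.I))) :=
        tendsto_const_nhds.div (hz i) (hsI i)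
      have h2 : 1 / (s i * Complex.I) ∈ Complex.slitPlane := by
        right
        simp [hs i]
      exact ((continuousAt_cpow_const h2).tendsto).comp h1
    · refine tendsto_integral_filter_of_dominated_convergence (fun x => ‖h x‖) (.of_forall fun ε => ?_)
        ?_ h.integrable.norm (.of_forall fun x => ?_)
      · have := h.continuous
        exact Continuous.aestronglyMeasurable (by fun_prop)
      · filter_upwards [self_mem_nhdsWithin] with ε hε
        refine .of_forall fun x => ?_
        rw [norm_mul, Complex.norm_exp]
        refine mul_le_of_le_one_left (norm_nonneg _) (Real.exp_le_one_iff.2 ?_)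
        rw [Complex.neg_re, Complex.re_sum, neg_nonpos]
        refine Finset.sum_nonneg fun i _ => ?_
        have e1 : (Real.pi * k i ^ 2 / z ε i) * (x i : ℂ) ^ 2 =
            ((Real.pi * k i ^ 2 * x i ^ 2 : ℝ) : ℂ) * (z ε i)⁻¹ := by push_cast; ring
        rw [e1, Complex.re_ofReal_mul, Complex.inv_re, hre]
        have : 0 < ε := hε
        have := Complex.normSq_nonneg (z ε i)
        positivity
      · refine Tendsto.mul_const _ ((Complex.continuous_exp.tendsto _).comp (Tendsto.neg
          (tendsto_finsetSum _ fun i _ => (tendsto_const_nhds.div (hz i) (hsI i)).mul_const _)))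
  -- Both sides are limits, for `ε → 0` from the right, of the two sides of the formula for
  -- Gaussians of variances `ε + s i * I`.
  refine tendsto_nhds_unique hlim1 (hlim2.congr' ?_)
  filter_upwards [self_mem_nhdsWithin] with ε hε
  have := integral_fourier_gaussian h k (z ε) (fun i => by rw [hre]; exact hε)
  simp only [hG'] at this
  exact this.symm

end Gaussian

/-! ### The quadratic algebras in coordinates -/

namespace QuadAlg

instance instFiniteDimensional : (D : QuadAlg) → FiniteDimensional ℝ D.Carrier
  | .complex => inferInstanceAs (FiniteDimensional ℝ ℂ)
  | .split => inferInstanceAs (FiniteDimensional ℝ (ℝ × ℝ))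

instance instIsAddHaarMeasure : (D : QuadAlg) → (volume : Measure D.Carrier).IsAddHaarMeasure
  | .complex => inferInstanceAs ((volume : Measure ℂ).IsAddHaarMeasure)
  | .split => inferInstanceAs ((volume : Measure (ℝ × ℝ)).IsAddHaarMeasure)

instance instSecondCountable : (D : QuadAlg) → SecondCountableTopology D.Carrier
  | .complex => inferInstanceAs (SecondCountableTopology ℂ)
  | .split => inferInstanceAs (SecondCountableTopology (ℝ × ℝ))

instance instSigmaFinite : (D : QuadAlg) → SigmaFinite (volume : Measure D.Carrier)
  | .complex => inferInstanceAs (SigmaFinite (volume : Measure ℂ))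
  | .split => inferInstanceAs (SigmaFinite (volume : Measure (ℝ × ℝ)))

theorem finrank_carrier (D : QuadAlg) : Module.finrank ℝ D.Carrier = 2 := by
  cases D
  · exact Complex.finrank_real_complex
  · change Module.finrank ℝ (ℝ × ℝ) = 2
    simp

theorem tr_complex (z : ℂ) : QuadAlg.tr .complex z = 2 * z.re := Algebra.trace_complex_apply z

theorem tr_split (x : ℝ × ℝ) : QuadAlg.tr .split x = x.1 + x.2 := by
  have := Algebra.trace_prod_apply (R := ℝ) (S := ℝ) (T := ℝ) x
  simp only [Algebra.trace_self_apply] at this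
  exact this

variable (D : QuadAlg)

theorem algebraMap_tr (x : D.Carrier) : algebraMap ℝ D.Carrier (D.tr x) = x + star x := by
  cases D
  · have h : ∀ z : ℂ, ((2 * z.re : ℝ) : ℂ) = z + (starRingEnd ℂ) z := fun z => by
      rw [Complex.add_conj]
    exact (congrArg _ (tr_complex x)).trans (h x)
  · have h : ∀ z : ℝ × ℝ, algebraMap ℝ (ℝ × ℝ) (z.1 + z.2) = z + (z.2, z.1) := fun z => by
      ext <;> simp [add_comm]
    exact (congrArg _ (tr_split x)).trans (h x)

instance instNontrivial : Nontrivial D.Carrier :=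
  Module.nontrivial_of_finrank_pos (R := ℝ) (by rw [finrank_carrier]; norm_num)

theorem tr_add (x y : D.Carrier) : D.tr (x + y) = D.tr x + D.tr y := map_add _ _ _

theorem tr_smul (r : ℝ) (x : D.Carrier) : D.tr (r • x) = r * D.tr x := map_smul _ _ _

theorem tr_sum {ι : Type*} (s : Finset ι) (f : ι → D.Carrier) :
    D.tr (∑ i ∈ s, f i) = ∑ i ∈ s, D.tr (f i) := map_sum _ _ _

theorem algebraMap_injective : Function.Injective (algebraMap ℝ D.Carrier) :=
  FaithfulSMul.algebraMap_injective _ _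

theorem tr_star (x : D.Carrier) : D.tr (star x) = D.tr x := by
  apply D.algebraMap_injective
  rw [algebraMap_tr, algebraMap_tr, star_star, add_comm]

theorem tr_algebraMap (r : ℝ) : D.tr (algebraMap ℝ D.Carrier r) = 2 * r := by
  rw [tr, Algebra.trace_algebraMap, finrank_carrier, nsmul_eq_mul]
  norm_num

@[simp]
theorem toReal_algebraMap (r : ℝ) : D.toReal (algebraMap ℝ D.Carrier r) = r := by
  rw [toReal, tr_algebraMap]; ring

theorem toReal_add (x y : D.Carrier) : D.toReal (x + y) = D.toReal x + D.toReal y := by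
  simp [toReal, tr_add, add_div]

theorem toReal_smul (r : ℝ) (x : D.Carrier) : D.toReal (r • x) = r * D.toReal x := by
  simp [toReal, tr_smul, mul_div_assoc]

theorem toReal_sum {ι : Type*} (s : Finset ι) (f : ι → D.Carrier) :
    D.toReal (∑ i ∈ s, f i) = ∑ i ∈ s, D.toReal (f i) := by
  simp [toReal, tr_sum, Finset.sum_div]

theorem star_algebraMap (r : ℝ) : star (algebraMap ℝ D.Carrier r) = algebraMap ℝ D.Carrier r := by
  simp [Algebra.algebraMap_eq_smul_one]

theorem algebraMap_toReal {x : D.Carrier} (hx : star x = x) :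
    algebraMap ℝ D.Carrier (D.toReal x) = x := by
  have h : algebraMap ℝ D.Carrier 2 * algebraMap ℝ D.Carrier (D.toReal x) = algebraMap ℝ D.Carrier 2 * x := by
    rw [← map_mul, toReal, mul_div_cancel₀ _ (two_ne_zero), algebraMap_tr, hx]
    rw [show (2 : ℝ) = 1 + 1 by norm_num, map_add, map_one, add_mul, one_mul]
  have h2 := congrArg (fun z => (2⁻¹ : ℝ) • z) h
  simpa [Algebra.algebraMap_eq_smul_one, smul_smul, mul_comm (D.toReal x), ← mul_assoc] using h2

/-- The norm form `x ↦ x x̄`. -/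
noncomputable def normForm (x : D.Carrier) : ℝ := D.toReal (x * star x)

theorem algebraMap_normForm (x : D.Carrier) : algebraMap ℝ D.Carrier (D.normForm x) = x * star x :=
  D.algebraMap_toReal (by simp [mul_comm])

theorem form_comm (x y : D.Carrier) : D.form x y = D.form y x := by
  rw [form, form, ← tr_star]; simp [mul_comm]

theorem form_self (x : D.Carrier) : D.form x x = 2 * D.normForm x := by
  simp [form, normForm, toReal]; ring

theorem form_add_left (x y z : D.Carrier) : D.form (x + y) z = D.form x z + D.form y z := by
  simp [form, add_mul, tr_add]

theorem form_smul_left (r : ℝ) (x y : D.Carrier) : D.form (r • x) y = r * D.form x y := by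
  simp [form, tr_smul]

theorem normForm_add (x y : D.Carrier) :
    D.normForm (x + y) = D.normForm x + D.form x y + D.normForm y := by
  have h := D.form_self (x + y)
  rw [form_add_left, form_comm, form_comm D y, form_add_left, form_add_left, form_self, form_self,
    form_comm D y x] at h
  linarith

theorem normForm_smul (r : ℝ) (x : D.Carrier) : D.normForm (r • x) = r ^ 2 * D.normForm x := by
  simp [normForm, toReal_smul]; ring

theorem eta_mul (a b : ℝ) : D.eta (a * b) = D.eta a * D.eta b := by
  cases D <;> simp [eta, sign_mul]

theorem eta_one : D.eta 1 = 1 := by cases D <;> simp [eta]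

theorem eta_mul_self {a : ℝ} (ha : a ≠ 0) : D.eta a * D.eta a = 1 := by
  cases D
  · rcases lt_or_gt_of_ne ha with h | h <;> simp [eta, h]
  · simp [eta]

theorem eta_inv (a : ℝ) : D.eta a⁻¹ = D.eta a := by
  rcases eq_or_ne a 0 with rfl | ha
  · simp
  · have h1 := D.eta_mul a a⁻¹
    rw [mul_inv_cancel₀ ha, eta_one] at h1
    have h2 := D.eta_mul_self ha
    have h3 : D.eta a ≠ 0 := fun h => by simp [h] at h2
    exact mul_left_cancel₀ h3 (h1.symm.trans h2.symm)

theorem eta_pow (a : ℝ) (n : ℕ) : D.eta (a ^ n) = D.eta a ^ n := by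
  induction n with
  | zero => simp [eta_one]
  | succ n ih => rw [pow_succ, pow_succ, eta_mul, ih]

theorem eta_prod {ι : Type*} (s : Finset ι) (a : ι → ℝ) : D.eta (∏ i ∈ s, a i) = ∏ i ∈ s, D.eta (a i) := by
  classical
  induction s using Finset.induction_on with
  | empty => simp [eta_one]
  | insert i s hi ih => rw [Finset.prod_insert hi, Finset.prod_insert hi, eta_mul, ih]

/-- The coefficients of the norm form in coordinates on `D` which preserve the Lebesgue measure:
`x x̄ = s² + t²` on `ℂ`, and `x x̄ = s² / 4 - t²` on `ℝ ⊕ ℝ` with `s = x₁ + x₂`,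
`t = (x₂ - x₁) / 2`. -/
noncomputable def coeff : QuadAlg → Fin 2 → ℝ
  | .complex => ![1, 1]
  | .split => ![1 / 4, -1]

theorem coeff_ne_zero (i : Fin 2) : D.coeff i ≠ 0 := by
  cases D <;> fin_cases i <;> simp [coeff]

/-- Coordinates as described at `coeff`: they preserve the Lebesgue measure, diagonalise the trace
form, and the involution of `D` changes the sign of the second one. -/
theorem exists_coords : ∃ L : D.Carrier ≃L[ℝ] (Fin 2 → ℝ), MeasurePreserving L ∧
    (∀ x y, D.form x y = ∑ i, 2 * D.coeff i * (L x i * L y i)) ∧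
    ∀ x, L (star x) = ![L x 0, -L x 1] := by
  cases D
  · let L : ℂ ≃L[ℝ] (Fin 2 → ℝ) := Complex.basisOneI.equivFun.toContinuousLinearEquiv
    have hL0 : ∀ z, L z 0 = z.re := fun z => by simp [L]
    have hL1 : ∀ z, L z 1 = z.im := fun z => by simp [L]
    refine ⟨L, ?_, fun x y => ?_, fun x => ?_⟩
    · exact Complex.volume_preserving_equiv_pi
    · have h : ∀ x y : ℂ, QuadAlg.tr .complex (x * (starRingEnd ℂ) y : ℂ) =
          ∑ i, 2 * QuadAlg.complex.coeff i * (L x i * L y i) := fun x y => by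
        rw [tr_complex]
        simp [hL0, hL1, coeff]
        ring
      exact h x y
    · have h : ∀ x : ℂ, L ((starRingEnd ℂ) x) = ![L x 0, -L x 1] := fun x => by
        ext i; fin_cases i
        · simp [hL0]
        · simp [hL1]
      exact h x
  · let L : (ℝ × ℝ) ≃L[ℝ] (Fin 2 → ℝ) := LinearEquiv.toContinuousLinearEquiv
      { toFun := fun x => ![x.1 + x.2, (x.2 - x.1) / 2]
        invFun := fun y => (y 0 / 2 - y 1, y 0 / 2 + y 1)
        map_add' := fun x y => by ext i; fin_cases i <;> simp <;> ring
        map_smul' := fun r x => by ext i; fin_cases i <;> simp <;> ring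
        left_inv := fun x => by ext <;> simp <;> ring
        right_inv := fun y => by ext i; fin_cases i <;> simp }
    have hL : ∀ x, L x = ![x.1 + x.2, (x.2 - x.1) / 2] := fun x => rfl
    refine ⟨L, ?_, fun x y => ?_, fun x => ?_⟩
    · have hm : MeasurePreserving (fun x : ℝ × ℝ => (x.1 + x.2, (x.2 - x.1) / 2)) := by
        have h1 : MeasurePreserving (fun x : ℝ × ℝ => (x.1 + x.2, x.2)) := by
          have h := (Measure.measurePreserving_swap (μ := (volume : Measure ℝ)) (ν := (volume : Measure ℝ))).comp
            ((measurePreserving_prod_add (volume : Measure ℝ) (volume : Measure ℝ)).comp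
              (Measure.measurePreserving_swap (μ := (volume : Measure ℝ)) (ν := (volume : Measure ℝ))))
          have e : (fun x : ℝ × ℝ => (x.1 + x.2, x.2)) =
              Prod.swap ∘ (fun z : ℝ × ℝ => (z.1, z.1 + z.2)) ∘ Prod.swap := by
            ext x <;> simp [add_comm]
          rw [e]
          exact h
        have h2 : MeasurePreserving (fun x : ℝ × ℝ => (x.1, x.2 - x.1 / 2)) :=
          (MeasurePreserving.id (volume : Measure ℝ)).skew_product
            (g := fun s t => t - s / 2) (by fun_prop) (.of_forall fun s => map_sub_right_eq_self volume _)
        convert h2.comp h1 using 2 with x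
        ext <;> simp
        ring
      exact ((volume_preserving_finTwoArrow ℝ).symm).comp hm
    · have h : ∀ x y : ℝ × ℝ, QuadAlg.tr .split (x * (y.2, y.1)) =
          ∑ i, 2 * QuadAlg.split.coeff i * (L x i * L y i) := fun x y => by
        rw [tr_split]
        simp [hL, coeff]
        ring
      exact h x y
    · have h : ∀ x : ℝ × ℝ, L (x.2, x.1) = ![L x 0, -L x 1] := fun x => by
        ext i; fin_cases i
        · simp [hL, add_comm]
        · simp [hL]; ring
      exact h x

/-- Coordinates on `D` which preserve the Lebesgue measure and diagonalise the trace form. -/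
noncomputable def coords : D.Carrier ≃L[ℝ] (Fin 2 → ℝ) := D.exists_coords.choose

theorem measurePreserving_coords : MeasurePreserving D.coords := D.exists_coords.choose_spec.1

theorem form_eq_coords (x y : D.Carrier) :
    D.form x y = ∑ i, 2 * D.coeff i * (D.coords x i * D.coords y i) :=
  D.exists_coords.choose_spec.2.1 x y

theorem coords_star (x : D.Carrier) : D.coords (star x) = ![D.coords x 0, -D.coords x 1] :=
  D.exists_coords.choose_spec.2.2 x

theorem normForm_eq_coords (x : D.Carrier) : D.normForm x = ∑ i, D.coeff i * D.coords x i ^ 2 := by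
  have h := D.form_self x
  rw [form_eq_coords] at h
  simp only [Fin.sum_univ_two] at h ⊢
  linarith

theorem measurePreserving_star : MeasurePreserving (star : D.Carrier → D.Carrier) := by
  have h1 : MeasurePreserving (fun y : Fin 2 → ℝ => fun i => ((![1, -1] : Fin 2 → ℝ) i) * y i) := by
    refine volume_preserving_pi (f := fun i x => ((![1, -1] : Fin 2 → ℝ) i) * x) fun i => ?_
    fin_cases i
    · convert MeasurePreserving.id (volume : Measure ℝ) using 1
      ext x; simp
    · convert Measure.measurePreserving_neg (volume : Measure ℝ) using 1
      ext x; simp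
  have h2 := (D.measurePreserving_coords.symm D.coords.toHomeomorph.toMeasurableEquiv).comp
    (h1.comp D.measurePreserving_coords)
  convert h2 using 1
  ext x
  apply D.coords.injective
  rw [coords_star]
  have : ∀ y, D.coords (D.coords.toHomeomorph.toMeasurableEquiv.symm y) = y := fun y =>
    D.coords.apply_symm_apply y
  simp only [Function.comp, this]
  ext i
  fin_cases i <;> simp

end QuadAlg

theorem measurePreserving_uncurry {ι κ : Type*} [Fintype ι] [Fintype κ] :
    MeasurePreserving (fun (y : ι → κ → ℝ) (p : ι × κ) => y p.1 p.2) := by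
  refine ⟨by fun_prop, ?_⟩
  refine (Measure.pi_eq fun s hs => ?_).symm
  rw [Measure.map_apply (by fun_prop) (MeasurableSet.univ_pi hs)]
  have : (fun (y : ι → κ → ℝ) (p : ι × κ) => y p.1 p.2) ⁻¹' Set.univ.pi s =
      Set.univ.pi fun i => Set.univ.pi fun k => s (i, k) := by
    ext y; simp [Set.mem_pi]
  rw [this, volume_pi_pi]
  simp only [volume_pi_pi]
  rw [Fintype.prod_prod_type]

/-- Coordinates on `D^ι` which preserve the Lebesgue measure. -/
noncomputable def QuadAlg.piCoords (D : QuadAlg) (ι : Type*) [Fintype ι] :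
    (ι → D.Carrier) ≃L[ℝ] (ι × Fin 2 → ℝ) :=
  (ContinuousLinearEquiv.piCongrRight fun _ => D.coords).trans
    (LinearEquiv.curry ℝ ℝ ι (Fin 2)).symm.toContinuousLinearEquiv

theorem QuadAlg.piCoords_apply (D : QuadAlg) {ι : Type*} [Fintype ι] (x : ι → D.Carrier) (p : ι × Fin 2) :
    D.piCoords ι x p = D.coords (x p.1) p.2 := rfl

theorem QuadAlg.measurePreserving_piCoords (D : QuadAlg) (ι : Type*) [Fintype ι] :
    MeasurePreserving (D.piCoords ι) :=
  measurePreserving_uncurry.comp (volume_preserving_pi fun _ => D.measurePreserving_coords)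

/-! ### The Weil formula -/

/-- The complex value of a unitary character. -/
noncomputable def charVal (ψ : AddChar ℝ Circle) (x : ℝ) : ℂ := (ψ x : ℂ)

theorem charVal_add (ψ : AddChar ℝ Circle) (x y : ℝ) : charVal ψ (x + y) = charVal ψ x * charVal ψ y := by
  simp [charVal, AddChar.map_add_eq_mul]

theorem charVal_zero (ψ : AddChar ℝ Circle) : charVal ψ 0 = 1 := by simp [charVal]

theorem norm_charVal (ψ : AddChar ℝ Circle) (x : ℝ) : ‖charVal ψ x‖ = 1 := Circle.norm_coe _

theorem charVal_inv (ψ : AddChar ℝ Circle) (x : ℝ) : charVal ψ⁻¹ x = charVal ψ (-x) := by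
  simp [charVal]

/-- `ψ` is the character `x ↦ exp(2πiλx)`. -/
def HasFrequency (ψ : AddChar ℝ Circle) (lam : ℝ) : Prop :=
  ∀ x, charVal ψ x = Complex.exp ((2 * Real.pi * (lam * x) : ℝ) * Complex.I)

theorem HasFrequency.inv {ψ : AddChar ℝ Circle} {lam : ℝ} (h : HasFrequency ψ lam) :
    HasFrequency ψ⁻¹ (-lam) := fun x => by
  rw [charVal_inv, h]; congr 3; ring

theorem HasFrequency.continuous {ψ : AddChar ℝ Circle} {lam : ℝ} (h : HasFrequency ψ lam) :
    Continuous (charVal ψ) := by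
  have : charVal ψ = fun x : ℝ => Complex.exp ((2 * Real.pi * (lam * x) : ℝ) * Complex.I) := funext h
  rw [this]; fun_prop

/-- The Weil formula in measure-preserving coordinates which diagonalise the quadratic form. -/
theorem weil_formula_of_coords {V : Type*} [NormedAddCommGroup V] [NormedSpace ℝ V] [MeasurableSpace V]
    [BorelSpace V] {ι : Type*} [Fintype ι] (L : V ≃L[ℝ] (ι → ℝ)) (μ : Measure V)
    (hL : MeasurePreserving L μ volume) (k b : ι → ℝ) (hk : ∀ i, k i ≠ 0) (hb : ∀ i, b i ≠ 0)
    {ψ : AddChar ℝ Circle} {lam : ℝ} (hlam : lam ≠ 0) (hψ : HasFrequency ψ lam) (h : 𝓢(V, ℂ)) :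
    ∫ x, charVal ψ (∑ i, b i * L x i ^ 2) *
        ∫ y, h y * charVal ψ (-∑ i, 2 * k i * (L y i * L x i)) ∂μ ∂μ =
      (∏ i, (1 / ((-(2 * lam * b i) : ℝ) * Complex.I)) ^ (1 / 2 : ℂ)) *
        ∫ y, charVal ψ (-∑ i, k i ^ 2 / b i * L y i ^ 2) * h y ∂μ := by
  have hint : ∀ g : V → ℂ, ∫ x, g x ∂μ = ∫ x : ι → ℝ, g (L.symm x) := fun g => by
    rw [← hL.integral_comp L.toHomeomorph.measurableEmbedding]
    simp
  have key := integral_fourier_chirp (compCLMOfContinuousLinearEquiv ℂ L.symm h)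
    (fun i => 2 * lam * k i) (fun i => -(2 * lam * b i)) (fun i => by simp [hlam, hk])
    (fun i => by simp [hlam, hb])
  simp only [hint, ContinuousLinearEquiv.apply_symm_apply]
  have hl : ∀ x y : ι → ℝ, charVal ψ (-∑ i, 2 * k i * (y i * x i)) =
      Complex.exp ((-(2 * Real.pi * ∑ i, 2 * lam * k i * (x i * y i)) : ℝ) * Complex.I) := fun x y => by
    rw [hψ]
    congr 3
    rw [mul_neg, mul_neg, neg_inj, Finset.mul_sum]
    congr 1
    exact Finset.sum_congr rfl fun i _ => by ring
  have h1 : ∀ x : ι → ℝ, charVal ψ (∑ i, b i * x i ^ 2) = Complex.exp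
      (-∑ i, (Real.pi * ((-(2 * lam * b i) : ℝ) * Complex.I)) * (x i : ℂ) ^ 2) := fun x => by
    rw [hψ]
    congr 1
    push_cast
    rw [← Finset.sum_neg_distrib, Finset.mul_sum, Finset.mul_sum, Finset.sum_mul]
    exact Finset.sum_congr rfl fun i _ => by ring
  have h2 : ∀ y : ι → ℝ, charVal ψ (-∑ i, k i ^ 2 / b i * y i ^ 2) = Complex.exp (-∑ i,
      (Real.pi * ((2 * lam * k i : ℝ) : ℂ) ^ 2 / ((-(2 * lam * b i) : ℝ) * Complex.I)) * (y i : ℂ) ^ 2) :=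
    fun y => by
    rw [hψ]
    congr 1
    push_cast
    rw [← Finset.sum_neg_distrib, ← Finset.sum_neg_distrib, Finset.mul_sum, Finset.mul_sum, Finset.sum_mul]
    refine Finset.sum_congr rfl fun i _ => ?_
    have hb' : (b i : ℂ) ≠ 0 := by exact_mod_cast hb i
    have hlam' : (lam : ℂ) ≠ 0 := by exact_mod_cast hlam
    field_simp
    rw [Complex.I_sq]
    ring
  simp only [hl, h1, h2]
  exact key

namespace QuadAlg

/-- The Weil constant of the character of frequency `lam`: it is `i` times the sign of `lam` on `ℂ`,
and `1` on `ℝ ⊕ ℝ`. -/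
noncomputable def weilConst : QuadAlg → ℝ → ℂ
  | .complex => fun lam => Complex.I * (SignType.sign lam : ℝ)
  | .split => fun _ => 1

/-- The density of the self-dual measure on `D` with respect to the Lebesgue measure. -/
noncomputable def density (D : QuadAlg) (lam : ℝ) : ℝ := ∏ i, √|lam * (2 * D.coeff i)|

variable (D : QuadAlg)

theorem density_pos {lam : ℝ} (hlam : lam ≠ 0) : 0 < D.density lam :=
  Finset.prod_pos fun i _ => Real.sqrt_pos.2 (abs_pos.2 (by simp [hlam, D.coeff_ne_zero]))

theorem weilConst_mul_neg {lam : ℝ} (hlam : lam ≠ 0) : D.weilConst lam * D.weilConst (-lam) = 1 := by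
  cases D
  · rcases lt_or_gt_of_ne hlam with h | h <;> simp [weilConst, h]
  · simp [weilConst]

/-- The square of the Weil constant. This is what makes the Weil factor at `-1 / b` inverse to the
one at `b`, up to the density. -/
theorem eta_neg_one_mul (D : QuadAlg) {lam : ℝ} (hlam : lam ≠ 0) :
    (D.eta (-1) : ℂ) = D.weilConst lam * D.weilConst lam := by
  cases D
  · rcases lt_or_gt_of_ne hlam with h | h <;> simp [weilConst, eta, h]
  · simp [weilConst, eta]

theorem cpow_half_I_mul_cpow_half_neg_I {r t : ℝ} (hr : 0 < r) (ht : 0 < t) :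
    ((r : ℂ) * Complex.I) ^ (1 / 2 : ℂ) * ((t : ℂ) * -Complex.I) ^ (1 / 2 : ℂ) = (√(r * t) : ℝ) := by
  have hr' : (r : ℂ) ≠ 0 := by exact_mod_cast hr.ne'
  have ht' : (t : ℂ) ≠ 0 := by exact_mod_cast ht.ne'
  rw [Complex.cpow_def_of_ne_zero (by simp [hr']), Complex.cpow_def_of_ne_zero (by simp [ht']),
    Complex.log_ofReal_mul hr Complex.I_ne_zero, Complex.log_ofReal_mul ht (by simp),
    Complex.log_I, Complex.log_neg_I, ← Complex.exp_add, Real.sqrt_eq_rpow,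
    Real.rpow_def_of_pos (mul_pos hr ht), Real.log_mul hr.ne' ht.ne', Complex.ofReal_exp]
  congr 1
  push_cast
  ring

/-- The product over the two coordinates of the principal square roots which occur in the Weil
formula. Over `ℂ` the two roots are equal, and their product carries the sign of `lam * a`; over
`ℝ ⊕ ℝ` their phases are opposite and cancel. -/
theorem density_mul_prod_cpow {lam a : ℝ} (hlam : lam ≠ 0) (ha : a ≠ 0) :
    (D.density lam : ℂ) * ∏ i, (1 / ((-(2 * lam * (a * D.coeff i)) : ℝ) * Complex.I)) ^ (1 / 2 : ℂ) =
      ((|a|⁻¹ * D.eta a : ℝ) : ℂ) * D.weilConst lam := by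
  have hla : lam * a ≠ 0 := mul_ne_zero hlam ha
  have hlam' : (lam : ℂ) ≠ 0 := by exact_mod_cast hlam
  have ha' : (a : ℂ) ≠ 0 := by exact_mod_cast ha
  cases D
  · have hc : ∀ z : ℂ, z ^ (1 / 2 : ℂ) * z ^ (1 / 2 : ℂ) = z := fun z => by
      have := Complex.cpow_nat_inv_pow z (two_ne_zero)
      rw [pow_two] at this
      simpa using this
    simp only [density, coeff, Fin.prod_univ_two, Matrix.cons_val_zero, Matrix.cons_val_one, hc, mul_one]
    rw [Real.mul_self_sqrt (abs_nonneg _)]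
    rcases lt_or_gt_of_ne hlam with h1 | h1 <;> rcases lt_or_gt_of_ne ha with h2 | h2 <;>
      simp [weilConst, eta, h1, h2, abs_of_neg, abs_of_pos] <;> field_simp
  · have hd : (QuadAlg.split.density lam : ℂ) = (|lam| : ℝ) := by
      simp only [density, coeff, Fin.prod_univ_two, Matrix.cons_val_zero, Matrix.cons_val_one]
      rw [← Real.sqrt_mul (abs_nonneg _), ← abs_mul, show lam * (2 * (1 / 4)) * (lam * (2 * -1)) = -lam ^ 2 by ring,
        abs_neg, abs_pow, Real.sqrt_sq (abs_nonneg _)]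
    rw [hd]
    simp only [coeff, Fin.prod_univ_two, Matrix.cons_val_zero, Matrix.cons_val_one, eta, weilConst,
      mul_one]
    have hI : ∀ t : ℂ, 1 / (t * Complex.I) = 1 / t * -Complex.I := fun t => by
      rw [one_div_mul_eq_div, one_div, mul_inv, Complex.inv_I, div_eq_inv_mul]
    have habs : ((|lam| : ℝ) : ℂ) * ((|lam * a|⁻¹ : ℝ) : ℂ) = ((|a|⁻¹ : ℝ) : ℂ) := by
      rw [← Complex.ofReal_mul, abs_mul, mul_inv, mul_inv_cancel_left₀ (abs_ne_zero.2 hlam)]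
    rw [← habs, hI, hI]
    congr 1
    rcases lt_or_gt_of_ne hla with h | h
    · have e1 : (1 : ℂ) / (-(2 * lam * (a * (1 / 4))) : ℝ) * -Complex.I =
          ((2 / -(lam * a) : ℝ) : ℂ) * -Complex.I := by
        push_cast; field_simp; norm_num
      have e2 : (1 : ℂ) / (-(2 * lam * (a * -1)) : ℝ) * -Complex.I =
          ((1 / (2 * -(lam * a)) : ℝ) : ℂ) * Complex.I := by
        push_cast; field_simp
      rw [e1, e2, mul_comm, cpow_half_I_mul_cpow_half_neg_I (by apply one_div_pos.2; linarith)
        (by apply div_pos <;> linarith), abs_of_neg h]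
      congr 1
      rw [show 1 / (2 * -(lam * a)) * (2 / -(lam * a)) = (-(lam * a))⁻¹ ^ 2 by field_simp,
        Real.sqrt_sq (by rw [inv_nonneg]; linarith)]
    · have e1 : (1 : ℂ) / (-(2 * lam * (a * (1 / 4))) : ℝ) * -Complex.I =
          ((2 / (lam * a) : ℝ) : ℂ) * Complex.I := by
        push_cast; field_simp; norm_num
      have e2 : (1 : ℂ) / (-(2 * lam * (a * -1)) : ℝ) * -Complex.I =
          ((1 / (2 * (lam * a)) : ℝ) : ℂ) * -Complex.I := by
        push_cast; field_simp
      rw [e1, e2, cpow_half_I_mul_cpow_half_neg_I (by positivity) (by positivity), abs_of_pos h]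
      congr 1
      rw [show 2 / (lam * a) * (1 / (2 * (lam * a))) = (lam * a)⁻¹ ^ 2 by field_simp,
        Real.sqrt_sq (by positivity)]

/-- The self-dual measure on `D` is `D.density lam` times the Lebesgue measure. -/
theorem isSelfDual_form {ψ : AddChar ℝ Circle} {lam : ℝ} (hlam : lam ≠ 0) (hψ : HasFrequency ψ lam) :
    IsSelfDual D.form ψ (ENNReal.ofReal (D.density lam) • volume) :=
  isSelfDual_of_coords D.coords volume D.measurePreserving_coords (Equiv.refl _) (fun i => 2 * D.coeff i)
    (fun i => by simp [D.coeff_ne_zero]) D.form D.form_eq_coords ψ lam hlam hψ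

/-- The Weil formula on `D^ι`, with respect to the Lebesgue measure. -/
theorem weil_formula_pi {ι : Type*} [Fintype ι] {ψ : AddChar ℝ Circle} {lam : ℝ} (hlam : lam ≠ 0)
    (hψ : HasFrequency ψ lam) (a : ι → ℝ) (ha : ∀ i, a i ≠ 0) (h : 𝓢(ι → D.Carrier, ℂ)) :
    ∫ x : ι → D.Carrier, charVal ψ (∑ i, a i * D.normForm (x i)) *
        ∫ y : ι → D.Carrier, h y * charVal ψ (-∑ i, D.form (y i) (x i)) =
      (∏ i, (D.density lam : ℂ)⁻¹ * (((|a i|⁻¹ * D.eta (a i) : ℝ) : ℂ) * D.weilConst lam)) *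
        ∫ y : ι → D.Carrier, charVal ψ (-∑ i, D.normForm (y i) / a i) * h y := by
  have key := weil_formula_of_coords (D.piCoords ι) volume (D.measurePreserving_piCoords ι)
    (fun p => D.coeff p.2) (fun p => a p.1 * D.coeff p.2) (fun p => D.coeff_ne_zero _)
    (fun p => mul_ne_zero (ha _) (D.coeff_ne_zero _)) hlam hψ h
  simp only [Fintype.sum_prod_type, Fintype.prod_prod_type, piCoords_apply] at key
  have hd : (D.density lam : ℂ) ≠ 0 := by exact_mod_cast (D.density_pos hlam).ne'
  have e1 : ∀ x : ι → D.Carrier, ∑ i, ∑ j, a i * D.coeff j * D.coords (x i) j ^ 2 =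
      ∑ i, a i * D.normForm (x i) := fun x => Finset.sum_congr rfl fun i _ => by
    rw [normForm_eq_coords, Finset.mul_sum]; exact Finset.sum_congr rfl fun j _ => by ring
  have e2 : ∀ x : ι → D.Carrier, ∑ i, ∑ j, D.coeff j ^ 2 / (a i * D.coeff j) * D.coords (x i) j ^ 2 =
      ∑ i, D.normForm (x i) / a i := fun x => Finset.sum_congr rfl fun i _ => by
    rw [normForm_eq_coords, Finset.sum_div]
    refine Finset.sum_congr rfl fun j _ => ?_
    have := ha i
    have := D.coeff_ne_zero j
    field_simp
  simp only [← form_eq_coords, e1, e2] at key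
  rw [key]
  congr 1
  refine Finset.prod_congr rfl fun i _ => ?_
  rw [← D.density_mul_prod_cpow hlam (ha i), inv_mul_cancel_left₀ hd]

theorem isWeilConstant_weilConst {ψ : AddChar ℝ Circle} {lam : ℝ} (hlam : lam ≠ 0)
    (hψ : HasFrequency ψ lam) : IsWeilConstant D ψ (D.weilConst lam) := by
  intro a ha φ
  have key := weil_formula_of_coords D.coords volume D.measurePreserving_coords
    D.coeff (fun p => a * D.coeff p) (fun p => D.coeff_ne_zero _)
    (fun p => mul_ne_zero ha (D.coeff_ne_zero _)) hlam hψ φ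
  have e1 : ∀ x : D.Carrier, ∑ j, a * D.coeff j * D.coords x j ^ 2 = a * D.normForm x := fun x => by
    rw [normForm_eq_coords, Finset.mul_sum]; exact Finset.sum_congr rfl fun j _ => by ring
  have e2 : ∀ x : D.Carrier, ∑ j, D.coeff j ^ 2 / (a * D.coeff j) * D.coords x j ^ 2 =
      D.normForm x / a := fun x => by
    rw [normForm_eq_coords, Finset.sum_div]
    refine Finset.sum_congr rfl fun j _ => ?_
    have := D.coeff_ne_zero j
    field_simp
  simp only [← form_eq_coords, e1, e2] at key
  have hd : 0 ≤ D.density lam := (D.density_pos hlam).le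
  have hw := D.density_mul_prod_cpow hlam ha
  simp only [fourierB, selfDualHaar_eq (D.isSelfDual_form hlam hψ), integral_smul_measure,
    ENNReal.toReal_ofReal hd]
  change (D.density lam) • ∫ x, charVal ψ (a * D.normForm x) * ((D.density lam) • ∫ y, φ y * charVal ψ (-D.form y x)) =
    (D.density lam) • ∫ x, ((|a|⁻¹ * D.eta a : ℝ) : ℂ) * D.weilConst lam * charVal ψ (-D.normForm x / a) * φ x
  congr 1
  rw [← hw]
  simp only [Complex.real_smul, mul_left_comm _ (D.density lam : ℂ), mul_assoc, integral_const_mul]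
  rw [key]
  simp only [neg_div, mul_assoc]

end QuadAlg

/-! ### Coordinates on Hermitian matrices -/

section HermitianBlocks
variable {D : QuadAlg} {n r : ℕ}

/-- The topology of `Herm D n`, as the topology of its norm. It agrees definitionally with the
topology as a subspace of the matrices; this instance makes it the one that is found first. -/
noncomputable instance Herm.instTopologicalSpace (D : QuadAlg) (n : ℕ) : TopologicalSpace (Herm D n) :=
  PseudoMetricSpace.toUniformSpace.toTopologicalSpace

instance Herm.borelSpace_norm (D : QuadAlg) (n : ℕ) : BorelSpace (Herm D n) :=
  Herm.instBorelSpace D n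

/-- The Hermitian matrix with given diagonal and given entries above the diagonal. -/
noncomputable def mkHerm (d : Fin n → ℝ) (v : UpperIdx n → D.Carrier) : Herm D n :=
  ⟨Matrix.of fun i j => if h : i < j then v ⟨(i, j), h⟩ else if h : j < i then star (v ⟨(j, i), h⟩) else
    algebraMap ℝ D.Carrier (d i), by
    change star _ = _
    ext i j
    rw [Matrix.star_eq_conjTranspose, Matrix.conjTranspose_apply]
    rcases lt_trichotomy i j with h | h | h
    · simp [h, h.not_gt]
    · subst h; simp [D.star_algebraMap]
    · simp [h, h.not_gt]⟩

theorem mkHerm_apply (d : Fin n → ℝ) (v : UpperIdx n → D.Carrier) (i j : Fin n) :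
    (mkHerm d v).1 i j = if h : i < j then v ⟨(i, j), h⟩ else
      if h : j < i then star (v ⟨(j, i), h⟩) else algebraMap ℝ D.Carrier (d i) := rfl

theorem Herm.star_apply (X : Herm D n) (i j : Fin n) : star (X.1 i j) = X.1 j i := by
  have h : star X.1 = X.1 := X.2
  conv_rhs => rw [← h]
  rfl

theorem Herm.ext {X Y : Herm D n} (h : ∀ i j, X.1 i j = Y.1 i j) : X = Y :=
  Subtype.ext (Matrix.ext h)

theorem Herm.add_apply (X Y : Herm D n) (i j : Fin n) : (X + Y).1 i j = X.1 i j + Y.1 i j := rfl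

theorem Herm.smul_apply (t : ℝ) (X : Herm D n) (i j : Fin n) : (t • X).1 i j = t • X.1 i j := rfl

/-- The coordinates of a Hermitian matrix: its diagonal, and its entries above the diagonal. -/
noncomputable def hermCoords (D : QuadAlg) (n : ℕ) :
    Herm D n ≃L[ℝ] (Fin n → ℝ) × (UpperIdx n → D.Carrier) :=
  LinearEquiv.toContinuousLinearEquiv
    { toFun := fun X => (fun i => D.toReal (X.1 i i), fun p => X.1 p.1.1 p.1.2)
      invFun := fun p => mkHerm p.1 p.2
      map_add' := fun X Y => by
        ext i
        · exact D.toReal_add _ _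
        · rfl
      map_smul' := fun t X => by
        ext i
        · exact D.toReal_smul _ _
        · rfl
      left_inv := fun X => by
        refine Herm.ext fun i j => ?_
        rw [mkHerm_apply]
        split_ifs with h1 h2
        · rfl
        · exact X.star_apply _ _
        · obtain rfl := le_antisymm (not_lt.1 h2) (not_lt.1 h1)
          exact D.algebraMap_toReal (X.star_apply _ _)
      right_inv := fun p => by
        ext i
        · simp [mkHerm_apply]
        · have := i.2
          simp [mkHerm_apply, this] }

theorem hermCoords_fst (X : Herm D n) (i : Fin n) : (hermCoords D n X).1 i = D.toReal (X.1 i i) := rfl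

/-- The Lebesgue measure on Hermitian matrices. -/
noncomputable def hermVol (D : QuadAlg) (n : ℕ) : Measure (Herm D n) :=
  (volume : Measure ((Fin n → ℝ) × (UpperIdx n → D.Carrier))).map (hermCoords D n).symm

theorem measurePreserving_hermCoords_symm : MeasurePreserving (hermCoords D n).symm volume (hermVol D n) :=
  ⟨(hermCoords D n).symm.continuous.measurable, rfl⟩

theorem measurePreserving_hermCoords : MeasurePreserving (hermCoords D n) (hermVol D n) :=
  measurePreserving_hermCoords_symm.symm (hermCoords D n).symm.toHomeomorph.toMeasurableEquiv

instance isAddHaarMeasure_volume_prod {α β : Type*} [NormedAddCommGroup α] [NormedAddCommGroup β] [MeasureSpace α]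
    [MeasureSpace β] [BorelSpace α] [BorelSpace β] [SecondCountableTopology α] [SecondCountableTopology β]
    [(volume : Measure α).IsAddHaarMeasure] [(volume : Measure β).IsAddHaarMeasure]
    [SFinite (volume : Measure α)] [SFinite (volume : Measure β)] :
    (volume : Measure (α × β)).IsAddHaarMeasure :=
  inferInstanceAs ((volume : Measure α).prod (volume : Measure β)).IsAddHaarMeasure

instance isAddHaarMeasure_volume_pi (D : QuadAlg) (ι : Type*) [Fintype ι] :
    (volume : Measure (ι → D.Carrier)).IsAddHaarMeasure :=
  inferInstanceAs (Measure.pi fun _ => (volume : Measure D.Carrier)).IsAddHaarMeasure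

instance isAddHaarMeasure_hermVol : (hermVol D n).IsAddHaarMeasure :=
  (hermCoords D n).symm.isAddHaarMeasure_map volume

instance sigmaFinite_hermVol : SigmaFinite (hermVol D n) :=
  (hermCoords D n).symm.toHomeomorph.toMeasurableEquiv.sigmaFinite_map

/-- Positions above the diagonal, split by the first row. -/
noncomputable def upperRow (r : ℕ) : Fin r ⊕ UpperIdx r ≃ UpperIdx (r + 1) :=
  Equiv.ofBijective (Sum.elim (fun j => ⟨(0, j.succ), Fin.succ_pos j⟩)
    fun p => ⟨(p.1.1.succ, p.1.2.succ), Fin.succ_lt_succ_iff.2 p.2⟩) (by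
    constructor
    · rintro (i | ⟨⟨i, i'⟩, hi⟩) (j | ⟨⟨j, j'⟩, hj⟩) h <;> simp_all [Subtype.ext_iff, Prod.ext_iff]
      exact absurd h.1 (Fin.succ_ne_zero _).symm
    · rintro ⟨⟨i, j⟩, h⟩
      have hj : j ≠ 0 := fun h0 => by simp [h0] at h
      obtain ⟨j, rfl⟩ := Fin.exists_succ_eq.2 hj
      induction i using Fin.cases with
      | zero => exact ⟨.inl j, rfl⟩
      | succ i => exact ⟨.inr ⟨(i, j), by simpa using h⟩, rfl⟩)

/-- Positions above the diagonal, split by the last column. -/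
noncomputable def upperCol (r : ℕ) : UpperIdx r ⊕ Fin r ≃ UpperIdx (r + 1) :=
  Equiv.ofBijective (Sum.elim (fun p => ⟨(p.1.1.castSucc, p.1.2.castSucc), p.2⟩)
    fun i => ⟨(i.castSucc, Fin.last r), Fin.castSucc_lt_last i⟩) (by
    constructor
    · rintro (⟨⟨i, i'⟩, hi⟩ | i) (⟨⟨j, j'⟩, hj⟩ | j) h <;> simp_all [Subtype.ext_iff, Prod.ext_iff]
      exact absurd h.2.symm (Fin.castSucc_ne_last _)
    · rintro ⟨⟨i, j⟩, h⟩
      have hi : i ≠ Fin.last r := fun h0 => by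
        rw [h0] at h; exact absurd h (not_lt.2 (Fin.le_last _))
      obtain ⟨i, rfl⟩ := Fin.exists_castSucc_eq.2 hi
      induction j using Fin.lastCases with
      | last => exact ⟨.inr i, rfl⟩
      | cast j => exact ⟨.inl ⟨(i, j), by simpa using h⟩, rfl⟩)

/-- The entries above the diagonal, assembled from the first row and the rest. -/
noncomputable def rowU (D : QuadAlg) (r : ℕ) :
    ((Fin r → D.Carrier) × (UpperIdx r → D.Carrier)) ≃L[ℝ] (UpperIdx (r + 1) → D.Carrier) :=
  ((LinearEquiv.sumArrowLequivProdArrow (Fin r) (UpperIdx r) ℝ D.Carrier).symm ≪≫ₗ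
    LinearEquiv.funCongrLeft ℝ D.Carrier (upperRow r).symm).toContinuousLinearEquiv

/-- The entries above the diagonal, assembled from the last column and the rest. -/
noncomputable def colU (D : QuadAlg) (r : ℕ) :
    ((UpperIdx r → D.Carrier) × (Fin r → D.Carrier)) ≃L[ℝ] (UpperIdx (r + 1) → D.Carrier) :=
  ((LinearEquiv.sumArrowLequivProdArrow (UpperIdx r) (Fin r) ℝ D.Carrier).symm ≪≫ₗ
    LinearEquiv.funCongrLeft ℝ D.Carrier (upperCol r).symm).toContinuousLinearEquiv

theorem rowU_apply (x : (Fin r → D.Carrier) × (UpperIdx r → D.Carrier)) (s : Fin r ⊕ UpperIdx r) :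
    rowU D r x (upperRow r s) = Sum.elim x.1 x.2 s :=
  congrArg (Sum.elim x.1 x.2) ((upperRow r).symm_apply_apply s)

theorem colU_apply (x : (UpperIdx r → D.Carrier) × (Fin r → D.Carrier)) (s : UpperIdx r ⊕ Fin r) :
    colU D r x (upperCol r s) = Sum.elim x.1 x.2 s :=
  congrArg (Sum.elim x.1 x.2) ((upperCol r).symm_apply_apply s)

@[simp] theorem rowU_zero_succ (x : (Fin r → D.Carrier) × (UpperIdx r → D.Carrier)) (j : Fin r)
    (h : (0 : Fin (r + 1)) < j.succ) : rowU D r x ⟨(0, j.succ), h⟩ = x.1 j :=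
  rowU_apply x (.inl j)

@[simp] theorem rowU_succ_succ (x : (Fin r → D.Carrier) × (UpperIdx r → D.Carrier)) (i j : Fin r)
    (h : i.succ < j.succ) : rowU D r x ⟨(i.succ, j.succ), h⟩ = x.2 ⟨(i, j), Fin.succ_lt_succ_iff.1 h⟩ :=
  rowU_apply x (.inr ⟨(i, j), Fin.succ_lt_succ_iff.1 h⟩)

@[simp] theorem colU_cast_cast (x : (UpperIdx r → D.Carrier) × (Fin r → D.Carrier)) (i j : Fin r)
    (h : i.castSucc < j.castSucc) : colU D r x ⟨(i.castSucc, j.castSucc), h⟩ = x.1 ⟨(i, j), h⟩ :=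
  colU_apply x (.inl ⟨(i, j), h⟩)

@[simp] theorem colU_cast_last (x : (UpperIdx r → D.Carrier) × (Fin r → D.Carrier)) (i : Fin r)
    (h : i.castSucc < Fin.last r) : colU D r x ⟨(i.castSucc, Fin.last r), h⟩ = x.2 i :=
  colU_apply x (.inr i)

theorem measurePreserving_rowU : MeasurePreserving (rowU D r) := by
  have h := (volume_measurePreserving_piCongrLeft (fun _ => D.Carrier) (upperRow r)).comp
    (volume_measurePreserving_sumPiEquivProdPi_symm fun _ : Fin r ⊕ UpperIdx r => D.Carrier)
  refine h.congr (rowU D r).continuous.measurable (.of_forall fun x => ?_)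
  funext p
  obtain ⟨s, rfl⟩ := (upperRow r).surjective p
  rw [rowU_apply]
  exact Equiv.piCongrLeft_apply_apply (fun _ => D.Carrier) (upperRow r) _ s

theorem measurePreserving_colU : MeasurePreserving (colU D r) := by
  have h := (volume_measurePreserving_piCongrLeft (fun _ => D.Carrier) (upperCol r)).comp
    (volume_measurePreserving_sumPiEquivProdPi_symm fun _ : UpperIdx r ⊕ Fin r => D.Carrier)
  refine h.congr (colU D r).continuous.measurable (.of_forall fun x => ?_)
  funext p
  obtain ⟨s, rfl⟩ := (upperCol r).surjective p
  rw [colU_apply]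
  exact Equiv.piCongrLeft_apply_apply (fun _ => D.Carrier) (upperCol r) _ s

/-- `(p, x) ↦ (p₁, …, pₙ, x)` as a continuous linear equivalence. -/
noncomputable def snocL (n : ℕ) : ((Fin n → ℝ) × ℝ) ≃L[ℝ] (Fin (n + 1) → ℝ) :=
  LinearEquiv.toContinuousLinearEquiv
    { toFun := fun x => (Fin.snoc x.1 x.2 : Fin (n + 1) → ℝ)
      invFun := fun y => (Fin.init y, y (Fin.last n))
      map_add' := fun x y => by
        ext i; induction i using Fin.lastCases <;> simp
      map_smul' := fun t x => by
        ext i; induction i using Fin.lastCases <;> simp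
      left_inv := fun x => by simp
      right_inv := fun y => by simp }

@[simp] theorem snocL_apply (x : (Fin n → ℝ) × ℝ) : snocL n x = Fin.snoc x.1 x.2 := rfl

theorem measurePreserving_snocL : MeasurePreserving (snocL n) := by
  have h := (volume_preserving_piFinSuccAbove (fun _ : Fin (n + 1) => ℝ) (Fin.last n)).symm.comp
    (Measure.measurePreserving_swap (μ := (volume : Measure (Fin n → ℝ))) (ν := (volume : Measure ℝ)))
  have e : ⇑(snocL n) = (MeasurableEquiv.piFinSuccAbove (fun _ => ℝ) (Fin.last n)).symm ∘ Prod.swap := by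
    ext x i
    simp [MeasurableEquiv.piFinSuccAbove]
  rw [e]
  exact h

/-- The interchange of the two middle factors preserves the product measures. -/
theorem measurePreserving_prodProdProdComm {α β γ δ : Type*} [MeasureSpace α] [MeasureSpace β]
    [MeasureSpace γ] [MeasureSpace δ] [SFinite (volume : Measure α)] [SFinite (volume : Measure β)]
    [SFinite (volume : Measure γ)] [SFinite (volume : Measure δ)] :
    MeasurePreserving (fun x : (α × β) × (γ × δ) => ((x.1.1, x.2.1), (x.1.2, x.2.2))) := by
  have h1 : MeasurePreserving (fun x : (α × β) × (γ × δ) => (x.1.1, (x.1.2, x.2))) :=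
    measurePreserving_prodAssoc volume volume volume
  have h2 : MeasurePreserving (fun x : β × (γ × δ) => ((x.1, x.2.1), x.2.2)) :=
    (measurePreserving_prodAssoc volume volume volume).symm MeasurableEquiv.prodAssoc
  have h3 : MeasurePreserving (fun x : (β × γ) × δ => ((x.1.2, x.1.1), x.2)) :=
    (Measure.measurePreserving_swap (μ := (volume : Measure β)) (ν := (volume : Measure γ))).prod
      (MeasurePreserving.id (volume : Measure δ))
  have h4 : MeasurePreserving (fun x : (γ × β) × δ => (x.1.1, (x.1.2, x.2))) :=
    measurePreserving_prodAssoc volume volume volume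
  have h5 : MeasurePreserving (fun x : α × (γ × (β × δ)) => ((x.1, x.2.1), x.2.2)) :=
    (measurePreserving_prodAssoc volume volume volume).symm MeasurableEquiv.prodAssoc
  exact h5.comp (((MeasurePreserving.id (volume : Measure α)).prod (h4.comp (h3.comp h2))).comp h1)

/-- The Hermitian matrix with upper left block `Y`, last column `b` and last diagonal entry `d`. -/
noncomputable def colBlk (D : QuadAlg) (r : ℕ) :
    (Herm D r × (ℝ × (Fin r → D.Carrier))) ≃L[ℝ] Herm D (r + 1) :=
  (((hermCoords D r).prodCongr (ContinuousLinearEquiv.refl ℝ _)).trans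
    (LinearEquiv.prodProdProdComm ℝ (Fin r → ℝ) (UpperIdx r → D.Carrier) ℝ
      (Fin r → D.Carrier)).toContinuousLinearEquiv).trans
    (((snocL r).prodCongr (colU D r)).trans (hermCoords D (r + 1)).symm)

theorem colBlk_eq (x : Herm D r × (ℝ × (Fin r → D.Carrier))) :
    colBlk D r x = mkHerm (Fin.snoc (hermCoords D r x.1).1 x.2.1) (colU D r ((hermCoords D r x.1).2, x.2.2)) := rfl

@[simp] theorem colBlk_cast_cast (x : Herm D r × (ℝ × (Fin r → D.Carrier))) (i j : Fin r) :
    (colBlk D r x).1 i.castSucc j.castSucc = x.1.1 i j := by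
  rw [colBlk_eq, mkHerm_apply]
  rcases lt_trichotomy i j with h | h | h
  · rw [dif_pos (Fin.castSucc_lt_castSucc_iff.2 h), colU_cast_cast]; rfl
  · subst h
    simp [hermCoords_fst, D.algebraMap_toReal (x.1.star_apply _ _)]
  · rw [dif_neg (by simpa using h.le), dif_pos (Fin.castSucc_lt_castSucc_iff.2 h), colU_cast_cast]
    exact x.1.star_apply _ _

@[simp] theorem colBlk_cast_last (x : Herm D r × (ℝ × (Fin r → D.Carrier))) (i : Fin r) :
    (colBlk D r x).1 i.castSucc (Fin.last r) = x.2.2 i := by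
  rw [colBlk_eq, mkHerm_apply, dif_pos (Fin.castSucc_lt_last i), colU_cast_last]

@[simp] theorem colBlk_last_cast (x : Herm D r × (ℝ × (Fin r → D.Carrier))) (i : Fin r) :
    (colBlk D r x).1 (Fin.last r) i.castSucc = star (x.2.2 i) := by
  rw [← Herm.star_apply, colBlk_cast_last]

@[simp] theorem colBlk_last_last (x : Herm D r × (ℝ × (Fin r → D.Carrier))) :
    (colBlk D r x).1 (Fin.last r) (Fin.last r) = algebraMap ℝ D.Carrier x.2.1 := by
  rw [colBlk_eq, mkHerm_apply]
  simp

/-- The Hermitian matrix with first diagonal entry `d`, first row `b` and lower right block `Y`. -/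
noncomputable def rowBlk (D : QuadAlg) (r : ℕ) :
    ((ℝ × (Fin r → D.Carrier)) × Herm D r) ≃L[ℝ] Herm D (r + 1) :=
  (((ContinuousLinearEquiv.refl ℝ _).prodCongr (hermCoords D r)).trans
    (LinearEquiv.prodProdProdComm ℝ ℝ (Fin r → D.Carrier) (Fin r → ℝ)
      (UpperIdx r → D.Carrier)).toContinuousLinearEquiv).trans
    (((Fin.consEquivL ℝ fun _ => ℝ).prodCongr (rowU D r)).trans (hermCoords D (r + 1)).symm)

theorem rowBlk_eq (x : (ℝ × (Fin r → D.Carrier)) × Herm D r) :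
    rowBlk D r x = mkHerm (Fin.cons x.1.1 (hermCoords D r x.2).1) (rowU D r (x.1.2, (hermCoords D r x.2).2)) := rfl

@[simp] theorem rowBlk_succ_succ (x : (ℝ × (Fin r → D.Carrier)) × Herm D r) (i j : Fin r) :
    (rowBlk D r x).1 i.succ j.succ = x.2.1 i j := by
  rw [rowBlk_eq, mkHerm_apply]
  rcases lt_trichotomy i j with h | h | h
  · rw [dif_pos (Fin.succ_lt_succ_iff.2 h), rowU_succ_succ]; rfl
  · subst h
    simp [hermCoords_fst, D.algebraMap_toReal (x.2.star_apply _ _)]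
  · rw [dif_neg (by simpa using h.le), dif_pos (Fin.succ_lt_succ_iff.2 h), rowU_succ_succ]
    exact x.2.star_apply _ _

@[simp] theorem rowBlk_zero_succ (x : (ℝ × (Fin r → D.Carrier)) × Herm D r) (i : Fin r) :
    (rowBlk D r x).1 0 i.succ = x.1.2 i := by
  rw [rowBlk_eq, mkHerm_apply, dif_pos (Fin.succ_pos i), rowU_zero_succ]

@[simp] theorem rowBlk_succ_zero (x : (ℝ × (Fin r → D.Carrier)) × Herm D r) (i : Fin r) :
    (rowBlk D r x).1 i.succ 0 = star (x.1.2 i) := by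
  rw [← Herm.star_apply, rowBlk_zero_succ]

@[simp] theorem rowBlk_zero_zero (x : (ℝ × (Fin r → D.Carrier)) × Herm D r) :
    (rowBlk D r x).1 0 0 = algebraMap ℝ D.Carrier x.1.1 := by
  rw [rowBlk_eq, mkHerm_apply]
  simp

/-- The Lebesgue measure on Hermitian matrices is the product of those on the upper left block and
on the last column. -/
theorem measurePreserving_colBlk :
    MeasurePreserving (colBlk D r) ((hermVol D r).prod volume) (hermVol D (r + 1)) :=
  (measurePreserving_hermCoords_symm.comp (measurePreserving_snocL.prod measurePreserving_colU)).comp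
    (measurePreserving_prodProdProdComm.comp
      (measurePreserving_hermCoords.prod (MeasurePreserving.id volume)))

end HermitianBlocks

/-! ### The bilinear form and the action of unipotent matrices in block form -/

section BlockForm
variable {D : QuadAlg} {n r : ℕ}

theorem hermForm_eq (X Y : Herm D n) :
    hermForm D n X Y = D.toReal (∑ i, ∑ j, X.1 i j * Y.1 j.rev i.rev) := by
  have h1 : ∀ (A : Matrix (Fin n) (Fin n) D.Carrier) i j, (A * wMat D n) i j = A i j.rev := fun A i j => by
    rw [Matrix.mul_apply, Finset.sum_eq_single j.rev]
    · simp [wMat]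
    · intro k _ hk
      have : j ≠ k.rev := fun h => hk (by rw [h, Fin.rev_rev])
      simp [wMat, this]
    · simp
  rw [hermForm]
  congr 1
  refine Finset.sum_congr rfl fun i _ => ?_
  rw [Matrix.diag_apply, h1, Matrix.mul_apply, ← Equiv.sum_comp Fin.revPerm]
  exact Finset.sum_congr rfl fun j _ => by rw [h1]; simp

/-- The density of the self-dual measure on Hermitian matrices with respect to the Lebesgue
measure. -/
noncomputable def hermDensity (D : QuadAlg) (n : ℕ) (lam : ℝ) : ℝ :=
  √|lam| ^ n * D.density lam ^ Fintype.card (UpperIdx n)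

theorem hermDensity_succ (lam : ℝ) :
    hermDensity D (r + 1) lam = hermDensity D r lam * (√|lam| * D.density lam ^ r) := by
  have : Fintype.card (UpperIdx (r + 1)) = r + Fintype.card (UpperIdx r) := by
    rw [← Fintype.card_congr (upperRow r), Fintype.card_sum, Fintype.card_fin]
  rw [hermDensity, hermDensity, this]
  ring

theorem hermDensity_pos {lam : ℝ} (hlam : lam ≠ 0) : 0 < hermDensity D n lam :=
  mul_pos (pow_pos (Real.sqrt_pos.2 (abs_pos.2 hlam)) _) (pow_pos (D.density_pos hlam) _)

/-- Reflection of the positions above the diagonal in the antidiagonal. -/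
def upperRev (n : ℕ) : Equiv.Perm (UpperIdx n) where
  toFun p := ⟨(p.1.2.rev, p.1.1.rev), Fin.rev_lt_rev.2 p.2⟩
  invFun p := ⟨(p.1.2.rev, p.1.1.rev), Fin.rev_lt_rev.2 p.2⟩
  left_inv p := by simp
  right_inv p := by simp

/-- A double sum, split into the diagonal and pairs of positions symmetric to it. -/
theorem sum_eq_diag_add_upper {M : Type*} [AddCommMonoid M] (F : Fin n → Fin n → M) :
    ∑ i, ∑ j, F i j = ∑ i, F i i + ∑ p : UpperIdx n, (F p.1.1 p.1.2 + F p.1.2 p.1.1) := by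
  classical
  rw [← Fintype.sum_prod_type' F]
  have h1 : ∀ G : Fin n × Fin n → M, ∑ p : UpperIdx n, G p.1 = ∑ p : Fin n × Fin n, if p.1 < p.2 then G p else 0 :=
    fun G => by
      rw [← Finset.sum_filter, Finset.sum_subtype (p := fun p : Fin n × Fin n => p.1 < p.2)]
      simp
  have h2 : ∑ i, F i i = ∑ p : Fin n × Fin n, if p.1 = p.2 then F p.1 p.2 else 0 := by
    rw [Fintype.sum_prod_type]
    exact Finset.sum_congr rfl fun i _ => by simp
  have h3 : ∑ p : UpperIdx n, F p.1.2 p.1.1 = ∑ p : Fin n × Fin n, if p.2 < p.1 then F p.1 p.2 else 0 := by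
    rw [h1 fun p => F p.2 p.1, ← Equiv.sum_comp (Equiv.prodComm _ _)]
    rfl
  rw [Finset.sum_add_distrib, h3, h1 fun p => F p.1 p.2, h2, ← Finset.sum_add_distrib, ← Finset.sum_add_distrib]
  refine Finset.sum_congr rfl fun p _ => ?_
  rcases lt_trichotomy p.1 p.2 with h | h | h
  · simp [h, h.ne, h.not_gt]
  · simp [h]
  · simp [h, h.ne', h.not_gt]

/-- The form pairs each diagonal entry, and each entry above the diagonal, with the entry at the
position reflected in the antidiagonal. -/
theorem hermForm_eq_upper (X Y : Herm D n) :
    hermForm D n X Y = ∑ i, D.toReal (X.1 i i) * D.toReal (Y.1 i.rev i.rev) +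
      ∑ p : UpperIdx n, D.form (X.1 p.1.1 p.1.2) (star (Y.1 p.1.2.rev p.1.1.rev)) := by
  rw [hermForm_eq, sum_eq_diag_add_upper, D.toReal_add, D.toReal_sum, D.toReal_sum]
  congr 1
  · refine Finset.sum_congr rfl fun i _ => ?_
    rw [← D.algebraMap_toReal (X.star_apply i i), ← D.algebraMap_toReal (Y.star_apply i.rev i.rev), ← map_mul,
      D.toReal_algebraMap, D.toReal_algebraMap, D.toReal_algebraMap]
  · refine Finset.sum_congr rfl fun p _ => ?_
    rw [← X.star_apply p.1.1 p.1.2, ← Y.star_apply p.1.2.rev p.1.1.rev, ← star_mul', D.toReal_add,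
      QuadAlg.toReal, QuadAlg.toReal, D.tr_star, QuadAlg.form, star_star]
    ring

/-- The self-dual measure on Hermitian matrices is `hermDensity D n lam` times the Lebesgue measure.
-/
theorem isSelfDual_hermForm {ψ : AddChar ℝ Circle} {lam : ℝ} (hlam : lam ≠ 0) (hψ : HasFrequency ψ lam) :
    IsSelfDual (hermForm D n) ψ (ENNReal.ofReal (hermDensity D n lam) • hermVol D n) := by
  let L : Herm D n ≃L[ℝ] (Fin n ⊕ UpperIdx n × Fin 2 → ℝ) :=
    ((hermCoords D n).trans ((ContinuousLinearEquiv.refl ℝ _).prodCongr (D.piCoords (UpperIdx n)))).trans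
      (LinearEquiv.sumArrowLequivProdArrow _ _ ℝ ℝ).symm.toContinuousLinearEquiv
  have hL1 : ∀ X i, L X (.inl i) = D.toReal (X.1 i i) := fun X i => rfl
  have hL2 : ∀ X (p : UpperIdx n × Fin 2), L X (.inr p) = D.coords (X.1 p.1.1.1 p.1.1.2) p.2 := fun X p => rfl
  have hLm : MeasurePreserving L (hermVol D n) :=
    (volume_measurePreserving_sumPiEquivProdPi_symm fun _ : Fin n ⊕ UpperIdx n × Fin 2 => ℝ).comp
      (((MeasurePreserving.id volume).prod (D.measurePreserving_piCoords _)).comp measurePreserving_hermCoords)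
  have key := isSelfDual_of_coords L (hermVol D n) hLm
    (Equiv.sumCongr Fin.revPerm ((upperRev n).prodCongr (Equiv.refl _)))
    (Sum.elim (fun _ => 1) fun p => 2 * D.coeff p.2 * (![1, -1] : Fin 2 → ℝ) p.2) ?_ (hermForm D n) ?_ ψ lam hlam hψ
  · convert key using 3
    rw [Fintype.prod_sum_type, Fintype.prod_prod_type, hermDensity]
    simp [QuadAlg.density]
  · rintro (i | ⟨p, i⟩)
    · simp
    · fin_cases i <;> simp [D.coeff_ne_zero]
  · intro X Y
    rw [hermForm_eq_upper, Fintype.sum_sum_type, Fintype.sum_prod_type]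
    congr 1
    · exact Finset.sum_congr rfl fun i _ => by simp [hL1]
    · refine Finset.sum_congr rfl fun p _ => ?_
      rw [D.form_eq_coords]
      refine Finset.sum_congr rfl fun i _ => ?_
      simp only [Sum.elim_inr, Equiv.sumCongr_apply, Sum.map_inr, hL2, D.coords_star]
      fin_cases i <;> simp [upperRev]

/-- The Hermitian matrix `v̄ᵗ v` of a row vector `v`. -/
noncomputable def outerH (v : Fin n → D.Carrier) : Herm D n :=
  ⟨Matrix.of fun i j => star (v i) * v j, by
    change star _ = _
    ext i j
    rw [Matrix.star_eq_conjTranspose, Matrix.conjTranspose_apply]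
    simp [mul_comm]⟩

@[simp] theorem outerH_apply (v : Fin n → D.Carrier) (i j : Fin n) :
    (outerH v).1 i j = star (v i) * v j := rfl

/-- The value `γ̄ᵗ X γ` of the Hermitian form `X`. -/
noncomputable def quadH (X : Herm D n) (γ : Fin n → D.Carrier) : ℝ :=
  D.toReal (∑ i, ∑ j, star (γ i) * X.1 i j * γ j)

/-- The value of a Hermitian form at `γ` is its pairing with a matrix of rank one. So the factor
`ψ(-q⁻¹ quadH X γ)` in the column operator amounts to a translation of the Fourier transform by a
multiple of `outerH`, as in the row operator. -/
theorem hermForm_outerH (X : Herm D n) (γ : Fin n → D.Carrier) :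
    hermForm D n X (outerH fun i => star (γ i.rev)) = quadH X γ := by
  rw [hermForm_eq, quadH]
  congr 1
  refine Finset.sum_congr rfl fun i _ => Finset.sum_congr rfl fun j _ => ?_
  simp
  ring

theorem hermForm_add_right (X Y Z : Herm D n) :
    hermForm D n X (Y + Z) = hermForm D n X Y + hermForm D n X Z := by
  simp only [hermForm_eq, Herm.add_apply, mul_add, Finset.sum_add_distrib, D.toReal_add]

theorem hermForm_smul_right (t : ℝ) (X Y : Herm D n) :
    hermForm D n X (t • Y) = t * hermForm D n X Y := by
  simp only [hermForm_eq, Herm.smul_apply, mul_smul_comm, ← Finset.smul_sum, D.toReal_smul]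

/-- Reflection in the antidiagonal exchanges last column and first row: the form pairs the last
column of the one matrix with the first row of the other. -/
theorem hermForm_colBlk_rowBlk (X : Herm D r) (d : ℝ) (b : Fin r → D.Carrier) (q : ℝ) (γ : Fin r → D.Carrier)
    (Z : Herm D r) :
    hermForm D (r + 1) (colBlk D r (X, (d, b))) (rowBlk D r ((q, fun i => star (γ i.rev)), Z)) =
      q * d + ∑ i, D.form (b i) (γ i) + hermForm D r X Z := by
  rw [hermForm_eq, Fin.sum_univ_castSucc]
  simp only [Fin.sum_univ_castSucc, colBlk_cast_cast, colBlk_cast_last, colBlk_last_cast, colBlk_last_last,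
    Fin.rev_castSucc, Fin.rev_last, rowBlk_succ_succ, rowBlk_succ_zero, rowBlk_zero_succ, rowBlk_zero_zero,
    Fin.rev_rev, star_star, Finset.sum_add_distrib, D.toReal_add]
  rw [hermForm_eq, ← map_mul, D.toReal_algebraMap, D.toReal_sum, D.toReal_sum, D.toReal_sum]
  have : ∀ i, D.toReal (b i * star (γ i)) + D.toReal (star (b i) * γ i) = D.form (b i) (γ i) := fun i => by
    have : star (b i) * γ i = star (b i * star (γ i)) := by simp [mul_comm]
    rw [this, QuadAlg.toReal, QuadAlg.toReal, D.tr_star, QuadAlg.form]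
    ring
  simp only [← this, Finset.sum_add_distrib]
  ring

@[simp] theorem unip_rowU_zero_zero (x : (Fin r → D.Carrier) × (UpperIdx r → D.Carrier)) :
    unip (rowU D r x) 0 0 = 1 := by simp [unip]

@[simp] theorem unip_rowU_zero_succ (x : (Fin r → D.Carrier) × (UpperIdx r → D.Carrier)) (j : Fin r) :
    unip (rowU D r x) 0 j.succ = x.1 j := by simp [unip]

@[simp] theorem unip_rowU_succ_zero (x : (Fin r → D.Carrier) × (UpperIdx r → D.Carrier)) (i : Fin r) :
    unip (rowU D r x) i.succ 0 = 0 := by simp [unip]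

@[simp] theorem unip_rowU_succ_succ (x : (Fin r → D.Carrier) × (UpperIdx r → D.Carrier)) (i j : Fin r) :
    unip (rowU D r x) i.succ j.succ = unip x.2 i j := by simp [unip]

@[simp] theorem unip_colU_cast_cast (x : (UpperIdx r → D.Carrier) × (Fin r → D.Carrier)) (i j : Fin r) :
    unip (colU D r x) i.castSucc j.castSucc = unip x.1 i j := by simp [unip]

@[simp] theorem unip_colU_cast_last (x : (UpperIdx r → D.Carrier) × (Fin r → D.Carrier)) (i : Fin r) :
    unip (colU D r x) i.castSucc (Fin.last r) = x.2 i := by simp [unip, Fin.castSucc_lt_last]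

@[simp] theorem unip_colU_last_cast (x : (UpperIdx r → D.Carrier) × (Fin r → D.Carrier)) (i : Fin r) :
    unip (colU D r x) (Fin.last r) i.castSucc = 0 := by
  simp [unip, (Fin.castSucc_lt_last i).not_gt, (Fin.castSucc_lt_last i).ne']

@[simp] theorem unip_colU_last_last (x : (UpperIdx r → D.Carrier) × (Fin r → D.Carrier)) :
    unip (colU D r x) (Fin.last r) (Fin.last r) = 1 := by simp [unip]

theorem hermAct_diagH_apply (u : Matrix (Fin n) (Fin n) D.Carrier) (a : Fin n → ℝ) (i j : Fin n) :
    (hermAct u (diagH D a)).1 i j = ∑ k, a k • (star (u k i) * u k j) := by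
  change ((u.conjTranspose * Matrix.diagonal fun i => algebraMap ℝ D.Carrier (a i)) * u) i j = _
  rw [Matrix.mul_apply]
  refine Finset.sum_congr rfl fun k _ => ?_
  rw [Matrix.mul_diagonal, Matrix.conjTranspose_apply, Algebra.smul_def]
  ring

/-- The orbit of `diag(q, a)`, with the first row of the unipotent matrix separated from the rest.
-/
theorem hermAct_unip_rowU (x : (Fin r → D.Carrier) × (UpperIdx r → D.Carrier)) (q : ℝ) (a : Fin r → ℝ) :
    hermAct (unip (rowU D r x)) (diagH D (Fin.cons q a : Fin (r + 1) → ℝ)) =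
      rowBlk D r ((q, q • x.1), hermAct (unip x.2) (diagH D a) + q • outerH x.1) := by
  refine Herm.ext fun i j => ?_
  rw [hermAct_diagH_apply, Fin.sum_univ_succ]
  induction i using Fin.cases with
  | zero =>
    induction j using Fin.cases with
    | zero => simp [Algebra.algebraMap_eq_smul_one]
    | succ j => simp
  | succ i =>
    induction j using Fin.cases with
    | zero => simp
    | succ j =>
      rw [rowBlk_succ_succ, Herm.add_apply, Herm.smul_apply, hermAct_diagH_apply, add_comm]
      simp

/-- The orbit of `diag(p, t)`, with the last column of the unipotent matrix separated from the rest.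
-/
theorem hermAct_unip_colU (x : (UpperIdx r → D.Carrier) × (Fin r → D.Carrier)) (p : Fin r → ℝ) (t : ℝ) :
    hermAct (unip (colU D r x)) (diagH D (Fin.snoc p t : Fin (r + 1) → ℝ)) =
      colBlk D r (hermAct (unip x.1) (diagH D p), (t + ∑ i, p i * D.normForm (x.2 i),
        (unip x.1).conjTranspose.mulVec fun i => p i • x.2 i)) := by
  refine Herm.ext fun i j => ?_
  rw [hermAct_diagH_apply, Fin.sum_univ_castSucc]
  induction i using Fin.lastCases with
  | last =>
    induction j using Fin.lastCases with
    | last =>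
      have h : ∀ i, p i • (star (x.2 i) * x.2 i) = algebraMap ℝ D.Carrier (p i * D.normForm (x.2 i)) := fun i => by
        rw [map_mul, D.algebraMap_normForm, Algebra.smul_def, mul_comm (star _)]
      rw [colBlk_last_last, map_add, map_sum, add_comm]
      simp only [Fin.snoc_last, Fin.snoc_castSucc, unip_colU_last_last, unip_colU_cast_last, h, star_one,
        mul_one, Algebra.algebraMap_eq_smul_one t]
    | cast j =>
      rw [colBlk_last_cast]
      simp [Matrix.mulVec, dotProduct, mul_comm]
  | cast i =>
    induction j using Fin.lastCases with
    | last => simp [Matrix.mulVec, dotProduct]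
    | cast j =>
      rw [colBlk_cast_cast, hermAct_diagH_apply]
      simp

/-- The trace of the first coordinate, and zero if there is none. -/
noncomputable def firstTr (v : Fin r → D.Carrier) : ℝ := ∑ j : Fin r, if (j : ℕ) = 0 then D.tr (v j) else 0

/-- The trace of the last coordinate, and zero if there is none. -/
noncomputable def lastTr (v : Fin r → D.Carrier) : ℝ := ∑ j : Fin r, if (j : ℕ) + 1 = r then D.tr (v j) else 0

theorem tr_zero : D.tr 0 = 0 := map_zero _

theorem chiN_eq (ψ : AddChar ℝ Circle) (u : Matrix (Fin n) (Fin n) D.Carrier) :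
    chiN ψ u = charVal ψ (∑ i : Fin n, ∑ j : Fin n, if (i : ℕ) + 1 = j then D.tr (u i j) else 0) := rfl

theorem norm_chiN (ψ : AddChar ℝ Circle) (u : Matrix (Fin n) (Fin n) D.Carrier) : ‖chiN ψ u‖ = 1 :=
  norm_charVal _ _

theorem chiN_rowU (ψ : AddChar ℝ Circle) (x : (Fin r → D.Carrier) × (UpperIdx r → D.Carrier)) :
    chiN ψ (unip (rowU D r x)) = charVal ψ (firstTr x.1) * chiN ψ (unip x.2) := by
  rw [chiN_eq, chiN_eq, ← charVal_add, Fin.sum_univ_succ]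
  congr 2
  · rw [Fin.sum_univ_succ]
    simp [firstTr, eq_comm]
  · refine Finset.sum_congr rfl fun i _ => ?_
    rw [Fin.sum_univ_succ]
    simp

theorem chiN_colU (ψ : AddChar ℝ Circle) (x : (UpperIdx r → D.Carrier) × (Fin r → D.Carrier)) :
    chiN ψ (unip (colU D r x)) = chiN ψ (unip x.1) * charVal ψ (lastTr x.2) := by
  rw [chiN_eq, chiN_eq, ← charVal_add, Fin.sum_univ_castSucc]
  congr 1
  simp only [Fin.sum_univ_castSucc, unip_colU_cast_cast, unip_colU_cast_last, unip_colU_last_cast,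
    unip_colU_last_last, Fin.val_castSucc, Fin.val_last, Finset.sum_add_distrib]
  rw [add_assoc, lastTr]
  have h1 : ∀ j : Fin r, ¬ (r + 1 = (j : ℕ)) := fun j => by have := j.2; omega
  simp [h1]

/-- For a diagonal matrix the product of the leading minors is the product of the
`a_j ^ (n - 1 - j)`. -/
theorem sigmaH_diagH (a : Fin n → ℝ) : sigmaH (diagH D a) = ∏ j : Fin n, a j ^ (n - 1 - (j : ℕ)) := by
  have h1 : ∀ i, leadMinor i (diagH D a) = ∏ j : Fin n, if (j : ℕ) < i then a j else 1 := fun i => by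
    rw [leadMinor]
    have : (diagH D a).1.submatrix (Subtype.val : {j : Fin n // (j : ℕ) < i} → Fin n) Subtype.val =
        Matrix.diagonal fun j => algebraMap ℝ D.Carrier (a j.1) := by
      ext j k
      change Matrix.diagonal (fun i => algebraMap ℝ D.Carrier (a i)) j.1 k.1 = _
      simp [Matrix.diagonal_apply, Subtype.ext_iff]
    rw [this, Matrix.det_diagonal, ← map_prod, D.toReal_algebraMap, ← Finset.prod_filter,
      Finset.prod_subtype (p := fun j : Fin n => (j : ℕ) < i)]
    simp
  rw [sigmaH, Finset.prod_congr rfl fun i _ => h1 i, Finset.prod_comm]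
  refine Finset.prod_congr rfl fun j _ => ?_
  rw [← Finset.prod_filter, Finset.prod_const]
  congr 1
  have : (Finset.Icc 1 (n - 1)).filter (fun i => (j : ℕ) < i) = Finset.Icc ((j : ℕ) + 1) (n - 1) := by
    ext i; simp; omega
  rw [this, Nat.card_Icc]
  omega

theorem sigmaH_diagH_cons (q : ℝ) (a : Fin r → ℝ) :
    sigmaH (diagH D (Fin.cons q a : Fin (r + 1) → ℝ)) = q ^ r * sigmaH (diagH D a) := by
  rw [sigmaH_diagH, sigmaH_diagH, Fin.prod_univ_succ]
  simp only [Fin.cons_zero, Fin.cons_succ, Fin.val_zero, Fin.val_succ]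
  congr 1
  refine Finset.prod_congr rfl fun j _ => ?_
  congr 1
  omega

theorem sigmaH_diagH_snoc (p : Fin r → ℝ) (t : ℝ) :
    sigmaH (diagH D (Fin.snoc p t : Fin (r + 1) → ℝ)) = sigmaH (diagH D p) * ∏ i, p i := by
  rw [sigmaH_diagH, sigmaH_diagH, Fin.prod_univ_castSucc, ← Finset.prod_mul_distrib]
  simp only [Fin.snoc_castSucc, Fin.snoc_last, Fin.val_castSucc, Fin.val_last]
  have : r + 1 - 1 - r = 0 := by omega
  rw [this, pow_zero, mul_one]
  refine Finset.prod_congr rfl fun j _ => ?_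
  rw [← pow_succ]
  congr 1
  omega

end BlockForm

/-! ### Operations on Schwartz functions -/

section SchwartzOperations
variable {E W : Type*} [NormedAddCommGroup E] [NormedSpace ℝ E] [NormedAddCommGroup W] [NormedSpace ℝ W]

/-- Composition with a map of temperate growth which has a left inverse of temperate growth. -/
theorem exists_comp_temperate {g : E → W} {h : W → E} (hg : g.HasTemperateGrowth) (hh : h.HasTemperateGrowth)
    (hgh : ∀ x, h (g x) = x) (F : 𝓢(W, ℂ)) : ∃ G : 𝓢(E, ℂ), ∀ x, G x = F (g x) := by
  obtain ⟨k, C, hC⟩ := hh.2 0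
  refine ⟨compCLM ℂ hg ⟨k, C, fun x => ?_⟩ F, fun x => rfl⟩
  have := hC (g x)
  rwa [norm_iteratedFDeriv_zero, hgh] at this

/-- A Schwartz function on `V`, viewed as a family without parameters. -/
theorem exists_constFamily {V : Type*} [NormedAddCommGroup V] [NormedSpace ℝ V] (f : 𝓢(V, ℂ)) :
    ∃ K : 𝓢((Fin 0 → ℝ) × V, ℂ), ∀ e x, K (e, x) = f x := by
  obtain ⟨K, hK⟩ := exists_comp_temperate (g := fun x : (Fin 0 → ℝ) × V => x.2)
    (h := fun y => (0, y)) (by fun_prop) (by fun_prop) (fun x => Prod.ext (Subsingleton.elim _ _) rfl) f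
  exact ⟨K, fun e x => hK _⟩

theorem exists_mul_temperate {φ : E → ℂ} (hφ : φ.HasTemperateGrowth) (F : 𝓢(E, ℂ)) :
    ∃ G : 𝓢(E, ℂ), ∀ x, G x = φ x * F x :=
  ⟨smulLeftCLM ℂ φ F, fun x => by rw [smulLeftCLM_apply_apply hφ, smul_eq_mul]⟩

theorem HasFrequency.hasTemperateGrowth {ψ : AddChar ℝ Circle} {lam : ℝ} (hψ : HasFrequency ψ lam) {φ : E → ℝ}
    (hφ : φ.HasTemperateGrowth) : (fun x => charVal ψ (φ x)).HasTemperateGrowth := by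
  simp only [hψ _]
  exact hasTemperateGrowth_cexp (by fun_prop)

/-- A nondegenerate bilinear form on a finite-dimensional space represents every linear form. -/
theorem surjective_of_nondegenerate [FiniteDimensional ℝ W] {b : W →L[ℝ] W →L[ℝ] ℝ}
    (hb : ∀ x, (∀ y, b x y = 0) → x = 0) : Function.Surjective b := by
  let T : W →ₗ[ℝ] Module.Dual ℝ W := LinearMap.toContinuousLinearMap.symm.toLinearMap ∘ₗ b.toLinearMap
  have hT : Function.Injective T := by
    rw [injective_iff_map_eq_zero]
    exact fun x hx => hb x fun y => congrArg (fun l : Module.Dual ℝ W => l y) hx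
  have hs := (LinearMap.injective_iff_surjective_of_finrank_eq_finrank
    (Subspace.dual_finrank_eq (K := ℝ) (V := W)).symm).1 hT
  intro l
  obtain ⟨x, hx⟩ := hs l.toLinearMap
  exact ⟨x, ContinuousLinearMap.ext fun y => congrArg (fun l : Module.Dual ℝ W => l y) hx⟩

variable [FiniteDimensional ℝ E] [FiniteDimensional ℝ W] [MeasurableSpace W] [BorelSpace W]
  {ψ : AddChar ℝ Circle} {lam : ℝ}

/-- `exists_partialFourier`, for the character `ψ` and a nondegenerate form. -/
theorem exists_partialFourier_charVal (hlam : lam ≠ 0) (hψ : HasFrequency ψ lam) (μ : Measure W)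
    [μ.IsAddHaarMeasure] (b : W →L[ℝ] W →L[ℝ] ℝ) (hb : ∀ x, (∀ y, b x y = 0) → x = 0) (K : 𝓢(E × W, ℂ)) :
    ∃ G : 𝓢(E × W, ℂ), ∀ e ξ, G (e, ξ) = ∫ w, K (e, w) * charVal ψ (-b w ξ) ∂μ := by
  obtain ⟨G, hG⟩ := exists_partialFourier μ (lam • b)
    (surjective_of_nondegenerate fun x hx => hb x fun y => by simpa [hlam] using hx y) K
  refine ⟨G, fun e ξ => ?_⟩
  rw [hG]
  congr 1
  ext w
  rw [fourierKer, hψ]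
  congr 3
  simp

/-- `exists_fourier`, for the character `ψ` and a nondegenerate form. -/
theorem exists_fourier_charVal (hlam : lam ≠ 0) (hψ : HasFrequency ψ lam) (μ : Measure W)
    [μ.IsAddHaarMeasure] (b : W →L[ℝ] W →L[ℝ] ℝ) (hb : ∀ x, (∀ y, b x y = 0) → x = 0) (K : 𝓢(W, ℂ)) :
    ∃ G : 𝓢(W, ℂ), ∀ ξ, G ξ = ∫ w, K w * charVal ψ (-b w ξ) ∂μ := by
  obtain ⟨G, hG⟩ := exists_fourier μ (lam • b)
    (surjective_of_nondegenerate fun x hx => hb x fun y => by simpa [hlam] using hx y) K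
  refine ⟨G, fun ξ => ?_⟩
  rw [hG]
  congr 1
  ext w
  rw [fourierKer, hψ]
  congr 3
  simp

end SchwartzOperations

/-! ### Temperate growth of the algebraic maps -/

section Growth
variable {D : QuadAlg} {n r : ℕ} {E : Type*} [NormedAddCommGroup E] [NormedSpace ℝ E]

/-- The trace as a continuous linear map. -/
noncomputable def QuadAlg.trL (D : QuadAlg) : D.Carrier →L[ℝ] ℝ :=
  (Algebra.trace ℝ D.Carrier).toContinuousLinearMap

/-- The involution of `D` as a continuous linear map. -/
noncomputable def QuadAlg.starL (D : QuadAlg) : D.Carrier →L[ℝ] D.Carrier :=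
  LinearMap.toContinuousLinearMap
    { toFun := star, map_add' := star_add, map_smul' := fun t x => by simp }

@[fun_prop]
theorem hasTemperateGrowth_tr {f : E → D.Carrier} (hf : f.HasTemperateGrowth) :
    (fun x => D.tr (f x)).HasTemperateGrowth := D.trL.hasTemperateGrowth.comp hf

@[fun_prop]
theorem hasTemperateGrowth_toReal {f : E → D.Carrier} (hf : f.HasTemperateGrowth) :
    (fun x => D.toReal (f x)).HasTemperateGrowth := by
  unfold QuadAlg.toReal
  simp only [div_eq_mul_inv]
  fun_prop

@[fun_prop]
theorem hasTemperateGrowth_star {f : E → D.Carrier} (hf : f.HasTemperateGrowth) :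
    (fun x => star (f x)).HasTemperateGrowth := D.starL.hasTemperateGrowth.comp hf

@[fun_prop]
theorem hasTemperateGrowth_form {f g : E → D.Carrier} (hf : f.HasTemperateGrowth) (hg : g.HasTemperateGrowth) :
    (fun x => D.form (f x) (g x)).HasTemperateGrowth := by
  unfold QuadAlg.form
  fun_prop

theorem hasTemperateGrowth_herm {f : E → Herm D n} (h : ∀ i j, (fun x => (f x).1 i j).HasTemperateGrowth) :
    f.HasTemperateGrowth := by
  have e : f = fun x => (hermCoords D n).symm (hermCoords D n (f x)) := by simp
  rw [e]
  refine (hermCoords D n).symm.toContinuousLinearMap.hasTemperateGrowth.comp ?_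
  refine hasTemperateGrowth_prodMk (hasTemperateGrowth_pi fun i => ?_) (hasTemperateGrowth_pi fun p => h _ _)
  exact hasTemperateGrowth_toReal (h i i)

/-- A matrix entry as a continuous linear map. -/
noncomputable def hermEntryL (D : QuadAlg) {n : ℕ} (i j : Fin n) : Herm D n →L[ℝ] D.Carrier :=
  LinearMap.toContinuousLinearMap
    { toFun := fun X => X.1 i j, map_add' := fun _ _ => rfl, map_smul' := fun _ _ => rfl }

@[fun_prop]
theorem hasTemperateGrowth_hermEntry {f : E → Herm D n} (hf : f.HasTemperateGrowth) (i j : Fin n) :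
    (fun x => (f x).1 i j).HasTemperateGrowth := (hermEntryL D i j).hasTemperateGrowth.comp hf

@[fun_prop]
theorem hasTemperateGrowth_outerH {f : E → Fin n → D.Carrier} (hf : f.HasTemperateGrowth) :
    (fun x => outerH (f x)).HasTemperateGrowth := by
  refine hasTemperateGrowth_herm fun i j => ?_
  simp only [outerH_apply]
  have h : ∀ i, (fun x => f x i).HasTemperateGrowth := fun i => (hasTemperateGrowth_apply i).comp hf
  exact (hasTemperateGrowth_star (h i)).mul (h j)

@[fun_prop]
theorem hasTemperateGrowth_quadH {f : E → Herm D n} {g : E → Fin n → D.Carrier} (hf : f.HasTemperateGrowth)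
    (hg : g.HasTemperateGrowth) : (fun x => quadH (f x) (g x)).HasTemperateGrowth := by
  have h : ∀ i, (fun x => g x i).HasTemperateGrowth := fun i => (hasTemperateGrowth_apply i).comp hg
  unfold quadH
  refine hasTemperateGrowth_toReal (.sum fun i _ => .sum fun j _ => ?_)
  exact ((hasTemperateGrowth_star (h i)).mul (hasTemperateGrowth_hermEntry hf i j)).mul (h j)

@[fun_prop]
theorem hasTemperateGrowth_firstTr {f : E → Fin n → D.Carrier} (hf : f.HasTemperateGrowth) :
    (fun x => firstTr (f x)).HasTemperateGrowth := by
  unfold firstTr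
  refine .sum fun i _ => ?_
  split_ifs
  · exact hasTemperateGrowth_tr ((hasTemperateGrowth_apply i).comp hf)
  · exact .const _

@[fun_prop]
theorem hasTemperateGrowth_lastTr {f : E → Fin n → D.Carrier} (hf : f.HasTemperateGrowth) :
    (fun x => lastTr (f x)).HasTemperateGrowth := by
  unfold lastTr
  refine .sum fun i _ => ?_
  split_ifs
  · exact hasTemperateGrowth_tr ((hasTemperateGrowth_apply i).comp hf)
  · exact .const _

@[fun_prop]
theorem hasTemperateGrowth_colBlk {f : E → Herm D r × (ℝ × (Fin r → D.Carrier))} (hf : f.HasTemperateGrowth) :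
    (fun x => colBlk D r (f x)).HasTemperateGrowth :=
  (colBlk D r).toContinuousLinearMap.hasTemperateGrowth.comp hf

@[fun_prop]
theorem hasTemperateGrowth_rowBlk {f : E → (ℝ × (Fin r → D.Carrier)) × Herm D r} (hf : f.HasTemperateGrowth) :
    (fun x => rowBlk D r (f x)).HasTemperateGrowth :=
  (rowBlk D r).toContinuousLinearMap.hasTemperateGrowth.comp hf

end Growth

/-! ### The row and column operators -/

section RowColumnOperators
variable {D : QuadAlg} {n r : ℕ}

/-- The operator which integrates out the first row of the unipotent variable: the Kloosterman
integral of `f` at `diag(q, a)` is that of `rowOp ψ q f` at `diag a`. -/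
noncomputable def rowOp (ψ : AddChar ℝ Circle) (q : ℝ) (f : Herm D (r + 1) → ℂ) (Y : Herm D r) : ℂ :=
  ∫ v : Fin r → D.Carrier, f (rowBlk D r ((q, q • v), Y + q • outerH v)) * charVal ψ (firstTr v)

/-- The exponent of the Fourier kernel in the last column. -/
noncomputable def colPairing (w ξ : ℝ × (Fin r → D.Carrier)) : ℝ :=
  w.1 * ξ.1 + ∑ i, D.form (w.2 i) (ξ.2 i)

/-- The operator on Schwartz functions through which a step of the Jacquet transform acts on
Kloosterman integrals: the Fourier transform in the last column, integrated against a quadratic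
phase. -/
noncomputable def colOp (ψ : AddChar ℝ Circle) (lam q : ℝ) (f : Herm D (r + 1) → ℂ) (X : Herm D r) : ℂ :=
  ((√|lam| * D.density lam ^ r : ℝ) : ℂ) * ∫ γ : Fin r → D.Carrier,
    charVal ψ (-(q⁻¹ * quadH X γ) - q⁻¹ * lastTr γ) *
      ∫ w : ℝ × (Fin r → D.Carrier), f (colBlk D r (X, w)) * charVal ψ (-colPairing w (q, γ))

/-- The trace form of `D` as a continuous bilinear map. -/
noncomputable def QuadAlg.formL (D : QuadAlg) : D.Carrier →L[ℝ] D.Carrier →L[ℝ] ℝ :=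
  LinearMap.toContinuousLinearMap (LinearMap.toContinuousLinearMap.toLinearMap ∘ₗ
    LinearMap.mk₂ ℝ D.form D.form_add_left (fun t x y => D.form_smul_left t x y)
      (fun x y z => by rw [D.form_comm, D.form_add_left, D.form_comm, D.form_comm z])
      (fun t x y => by rw [D.form_comm, D.form_smul_left, D.form_comm, smul_eq_mul]))

theorem QuadAlg.formL_apply (D : QuadAlg) (x y : D.Carrier) : D.formL x y = D.form x y := rfl

theorem QuadAlg.form_nondegenerate (D : QuadAlg) {x : D.Carrier} (h : ∀ y, D.form x y = 0) : x = 0 := by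
  apply D.coords.injective
  ext i
  have := h (D.coords.symm (Pi.single i 1))
  rw [D.form_eq_coords] at this
  simpa [Pi.single_apply, D.coeff_ne_zero] using this

/-- `colPairing` as a continuous bilinear map. -/
noncomputable def colPairingL (D : QuadAlg) (r : ℕ) :
    (ℝ × (Fin r → D.Carrier)) →L[ℝ] (ℝ × (Fin r → D.Carrier)) →L[ℝ] ℝ :=
  (ContinuousLinearMap.mul ℝ ℝ).bilinearComp (ContinuousLinearMap.fst ℝ _ _) (ContinuousLinearMap.fst ℝ _ _) +
    ∑ i, D.formL.bilinearComp (ContinuousLinearMap.proj i ∘L ContinuousLinearMap.snd ℝ _ _)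
      (ContinuousLinearMap.proj i ∘L ContinuousLinearMap.snd ℝ _ _)

theorem colPairingL_apply (w ξ : ℝ × (Fin r → D.Carrier)) : colPairingL D r w ξ = colPairing w ξ := by
  simp [colPairingL, colPairing, QuadAlg.formL_apply]

theorem colPairingL_nondegenerate (w : ℝ × (Fin r → D.Carrier)) (h : ∀ ξ, colPairingL D r w ξ = 0) : w = 0 := by
  simp only [colPairingL_apply] at h
  have hz : ∀ x : D.Carrier, D.form x 0 = 0 := fun x => map_zero (D.formL x)
  refine Prod.ext ?_ (funext fun i => D.form_nondegenerate fun y => ?_)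
  · simpa [colPairing, hz] using h (1, 0)
  · have := h (0, Pi.single i y)
    rw [colPairing, Finset.sum_eq_single i (fun j _ hj => by simp [hj, hz]) (by simp)] at this
    simpa using this

/-- The form on Hermitian matrices as a continuous bilinear map. -/
noncomputable def hermFormL (D : QuadAlg) (n : ℕ) : Herm D n →L[ℝ] Herm D n →L[ℝ] ℝ :=
  LinearMap.toContinuousBilinearMap
    (LinearMap.mk₂ ℝ (hermForm D n)
      (fun X Y Z => by
        simp only [hermForm_eq, Herm.add_apply, add_mul, Finset.sum_add_distrib, D.toReal_add])
      (fun t X Y => by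
        simp only [hermForm_eq, Herm.smul_apply, smul_mul_assoc, ← Finset.smul_sum, D.toReal_smul, smul_eq_mul])
      hermForm_add_right (fun t X Y => by rw [hermForm_smul_right, smul_eq_mul]))

theorem hermFormL_apply (X Y : Herm D n) : hermFormL D n X Y = hermForm D n X Y := rfl

theorem hermFormL_nondegenerate (X : Herm D n) (h : ∀ Y, hermFormL D n X Y = 0) : X = 0 := by
  simp only [hermFormL_apply, hermForm_eq_upper] at h
  have hz : ∀ x : D.Carrier, D.form x 0 = 0 := fun x => map_zero (D.formL x)
  apply (hermCoords D n).injective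
  rw [map_zero]
  refine Prod.ext (funext fun i => ?_) (funext fun p => D.form_nondegenerate fun y => ?_)
  · have h1 := h (mkHerm (Pi.single i.rev 1) 0)
    have h2 : ∀ j : Fin n, D.toReal ((mkHerm (D := D) (Pi.single i.rev 1) 0).1 j.rev j.rev) = if j = i then 1 else 0 :=
      fun j => by
        rw [mkHerm_apply, dif_neg (lt_irrefl _), dif_neg (lt_irrefl _), D.toReal_algebraMap]
        simp [Pi.single_apply]
    have h3 : ∀ q : UpperIdx n, (mkHerm (D := D) (Pi.single i.rev 1) 0).1 q.1.2.rev q.1.1.rev = 0 := fun q => by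
      rw [mkHerm_apply, dif_pos (Fin.rev_lt_rev.2 q.2)]; rfl
    have h4 : D.toReal (X.1 i i) = 0 := by simpa [h2, h3, hz] using h1
    exact h4
  · have h1 := h (mkHerm 0 (Pi.single (upperRev n p) (star y)))
    have h2 : ∀ q : UpperIdx n, (mkHerm (0 : Fin n → ℝ) (Pi.single (upperRev n p) (star y))).1 q.1.2.rev q.1.1.rev =
        if q = p then star y else 0 := fun q => by
      rw [mkHerm_apply, dif_pos (Fin.rev_lt_rev.2 q.2), Pi.single_apply]
      exact if_congr ((upperRev n).injective.eq_iff (a := q) (b := p)) rfl rfl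
    have h3 : ∀ j : Fin n, D.toReal ((mkHerm (0 : Fin n → ℝ) (Pi.single (upperRev n p) (star y))).1 j.rev j.rev) = 0 :=
      fun j => by
        rw [mkHerm_apply, dif_neg (lt_irrefl _), dif_neg (lt_irrefl _), D.toReal_algebraMap]
        rfl
    simp only [h2, h3, mul_zero, Finset.sum_const_zero, zero_add] at h1
    rw [Finset.sum_eq_single p (fun q _ hq => by simp [hq, hz]) (by simp)] at h1
    have h4 : D.form (X.1 p.1.1 p.1.2) y = 0 := by simpa using h1
    exact h4

variable {ψ : AddChar ℝ Circle} {lam : ℝ}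

/-- The Fourier transform on Hermitian matrices in terms of the Lebesgue measure. -/
theorem fourierH_eq (hlam : lam ≠ 0) (hψ : HasFrequency ψ lam) (f : Herm D n → ℂ) (Y : Herm D n) :
    fourierH ψ f Y = (hermDensity D n lam : ℂ) * ∫ X, f X * charVal ψ (-hermForm D n X Y) ∂hermVol D n := by
  rw [fourierH, fourierB, selfDualHaar_eq (isSelfDual_hermForm hlam hψ), integral_smul_measure,
    ENNReal.toReal_ofReal (hermDensity_pos hlam).le, Complex.real_smul]
  rfl

theorem exists_fourierH (hlam : lam ≠ 0) (hψ : HasFrequency ψ lam) (f : 𝓢(Herm D n, ℂ)) :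
    ∃ G : 𝓢(Herm D n, ℂ), ∀ Y, G Y = fourierH ψ f Y := by
  obtain ⟨G, hG⟩ := exists_fourier_charVal hlam hψ (hermVol D n) (hermFormL D n) hermFormL_nondegenerate f
  refine ⟨(hermDensity D n lam : ℂ) • G, fun Y => ?_⟩
  rw [fourierH_eq hlam hψ, smul_apply, hG, smul_eq_mul]
  rfl

variable {E : Type*} [NormedAddCommGroup E] [NormedSpace ℝ E]

/-- The substitution in the row operator, for a Schwartz family and a varying first entry. -/
theorem exists_rowSubst {q qi : E → ℝ} (hq : q.HasTemperateGrowth) (hqi : qi.HasTemperateGrowth)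
    (hqq : ∀ e, qi e * q e = 1) (F : 𝓢(E × Herm D (r + 1), ℂ)) :
    ∃ K : 𝓢((E × Herm D r) × (Fin r → D.Carrier), ℂ), ∀ e Y v,
      K ((e, Y), v) = F (e, rowBlk D r ((q e, q e • v), Y + q e • outerH v)) := by
  let g : (E × Herm D r) × (Fin r → D.Carrier) → E × Herm D (r + 1) := fun x =>
    (x.1.1, rowBlk D r ((q x.1.1, q x.1.1 • x.2), x.1.2 + q x.1.1 • outerH x.2))
  -- The left inverse `h` of the substitution `g` recovers the row by dividing by `q`, and then the
  -- block; it has temperate growth because `qi` has.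
  let s : E × Herm D (r + 1) → (ℝ × (Fin r → D.Carrier)) × Herm D r := fun y => (rowBlk D r).symm y.2
  let h : E × Herm D (r + 1) → (E × Herm D r) × (Fin r → D.Carrier) := fun y =>
    ((y.1, (s y).2 - q y.1 • outerH (qi y.1 • (s y).1.2)), qi y.1 • (s y).1.2)
  have hs : s.HasTemperateGrowth :=
    (rowBlk D r).symm.toContinuousLinearMap.hasTemperateGrowth.comp (hasTemperateGrowth_snd .id')
  obtain ⟨G, hG⟩ := exists_comp_temperate (g := g) (h := h) (by
    have h1 : (fun x : (E × Herm D r) × (Fin r → D.Carrier) => q x.1.1).HasTemperateGrowth :=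
      hq.comp (by fun_prop)
    fun_prop) (by
    have h1 : (fun x : E × Herm D (r + 1) => q x.1).HasTemperateGrowth := hq.comp (by fun_prop)
    have h2 : (fun x : E × Herm D (r + 1) => qi x.1).HasTemperateGrowth := hqi.comp (by fun_prop)
    fun_prop) (fun x => by
      simp only [g, h, s, ContinuousLinearEquiv.symm_apply_apply, smul_smul, hqq, one_smul, add_sub_cancel_right]) F
  exact ⟨G, fun e Y v => hG _⟩

variable [FiniteDimensional ℝ E]

/-- The row operator preserves Schwartz families, also when the entry `q` depends on the parameters,
as long as `q` and its inverse `qi` have temperate growth. -/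
theorem exists_rowOp (hψ : HasFrequency ψ lam) {q qi : E → ℝ} (hq : q.HasTemperateGrowth)
    (hqi : qi.HasTemperateGrowth) (hqq : ∀ e, qi e * q e = 1) (F : 𝓢(E × Herm D (r + 1), ℂ)) :
    ∃ G : 𝓢(E × Herm D r, ℂ), ∀ e Y, G (e, Y) = rowOp ψ (q e) (fun X => F (e, X)) Y := by
  obtain ⟨K, hK⟩ := exists_rowSubst hq hqi hqq F
  obtain ⟨K', hK'⟩ := exists_mul_temperate (hψ.hasTemperateGrowth
    (φ := fun x : (E × Herm D r) × (Fin r → D.Carrier) => firstTr x.2) (by fun_prop)) K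
  obtain ⟨G, hG⟩ := exists_integral_snd volume K'
  refine ⟨G, fun e Y => ?_⟩
  rw [hG, rowOp]
  congr 1
  ext v
  rw [hK', hK, mul_comm]

/-- The Fourier transform in the last column, as a Schwartz function of the remaining block, of the
parameters and of the dual column. -/
theorem exists_colFourier (hlam : lam ≠ 0) (hψ : HasFrequency ψ lam) (F : 𝓢(E × Herm D (r + 1), ℂ)) :
    ∃ G : 𝓢((E × Herm D r) × (ℝ × (Fin r → D.Carrier)), ℂ), ∀ e X ξ, G ((e, X), ξ) =
      ∫ w : ℝ × (Fin r → D.Carrier), F (e, colBlk D r (X, w)) * charVal ψ (-colPairing w ξ) := by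
  have hc : (fun y : E × Herm D (r + 1) => (colBlk D r).symm y.2).HasTemperateGrowth :=
    (colBlk D r).symm.toContinuousLinearMap.hasTemperateGrowth.comp (hasTemperateGrowth_snd .id')
  obtain ⟨K, hK⟩ := exists_comp_temperate
    (g := fun x : (E × Herm D r) × (ℝ × (Fin r → D.Carrier)) => (x.1.1, colBlk D r (x.1.2, x.2)))
    (h := fun y => ((y.1, ((colBlk D r).symm y.2).1), ((colBlk D r).symm y.2).2)) (by fun_prop) (by fun_prop)
    (fun x => by simp) F
  obtain ⟨G, hG⟩ := exists_partialFourier_charVal hlam hψ volume (colPairingL D r) colPairingL_nondegenerate K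
  refine ⟨G, fun e X ξ => ?_⟩
  rw [hG]
  simp only [hK, colPairingL_apply]

/-- The integrand of the column operator as a Schwartz function. -/
theorem exists_colIntegrand (hlam : lam ≠ 0) (hψ : HasFrequency ψ lam) {q qi : E → ℝ} (hq : q.HasTemperateGrowth)
    (hqi : qi.HasTemperateGrowth) (F : 𝓢(E × Herm D (r + 1), ℂ)) :
    ∃ G : 𝓢((E × Herm D r) × (Fin r → D.Carrier), ℂ), ∀ e X γ, G ((e, X), γ) =
      charVal ψ (-(qi e * quadH X γ) - qi e * lastTr γ) *
      ∫ w : ℝ × (Fin r → D.Carrier), F (e, colBlk D r (X, w)) * charVal ψ (-colPairing w (q e, γ)) := by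
  obtain ⟨K, hK⟩ := exists_colFourier hlam hψ F
  have hq1 : (fun x : (E × Herm D r) × (Fin r → D.Carrier) => q x.1.1).HasTemperateGrowth :=
    hq.comp (by fun_prop)
  have hqi1 : (fun x : (E × Herm D r) × (Fin r → D.Carrier) => qi x.1.1).HasTemperateGrowth :=
    hqi.comp (by fun_prop)
  obtain ⟨K1, hK1⟩ := exists_comp_temperate
    (g := fun x : (E × Herm D r) × (Fin r → D.Carrier) => (x.1, (q x.1.1, x.2)))
    (h := fun y => (y.1, y.2.2)) (by fun_prop) (by fun_prop) (fun x => rfl) K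
  obtain ⟨K2, hK2⟩ := exists_mul_temperate (hψ.hasTemperateGrowth
    (φ := fun x : (E × Herm D r) × (Fin r → D.Carrier) =>
      -(qi x.1.1 * quadH x.1.2 x.2) - qi x.1.1 * lastTr x.2) (by fun_prop)) K1
  exact ⟨K2, fun e X γ => by rw [hK2, hK1, hK]⟩

/-- The column operator preserves Schwartz families, also when the entry `q` depends on the
parameters, as long as `q` and its inverse have temperate growth. -/
theorem exists_colOp (hlam : lam ≠ 0) (hψ : HasFrequency ψ lam) {q : E → ℝ} (hq : q.HasTemperateGrowth)
    (hqi : (fun e => (q e)⁻¹).HasTemperateGrowth) (F : 𝓢(E × Herm D (r + 1), ℂ)) :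
    ∃ G : 𝓢(E × Herm D r, ℂ), ∀ e X, G (e, X) = colOp ψ lam (q e) (fun X => F (e, X)) X := by
  obtain ⟨K, hK⟩ := exists_colIntegrand hlam hψ hq hqi F
  obtain ⟨G, hG⟩ := exists_integral_snd volume K
  refine ⟨((√|lam| * D.density lam ^ r : ℝ) : ℂ) • G, fun e X => ?_⟩
  rw [smul_apply, hG, colOp, smul_eq_mul]
  simp only [hK]

end RowColumnOperators

/-! ### Integrability of the Kloosterman integrand -/

section Integrability
variable {D : QuadAlg} {n r : ℕ}

theorem continuous_herm {P : Type*} [TopologicalSpace P] {f : P → Herm D n}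
    (h : ∀ i j, Continuous fun x => (f x).1 i j) : Continuous f := by
  have e : f = fun x => (hermCoords D n).symm (hermCoords D n (f x)) := by simp
  rw [e]
  refine (hermCoords D n).symm.continuous.comp (.prodMk (continuous_pi fun i => ?_) (continuous_pi fun p => h _ _))
  have : Continuous fun x => D.tr ((f x).1 i i) := D.trL.continuous.comp (h i i)
  exact this.div_const 2

theorem continuous_unip (i j : Fin n) : Continuous fun v : UpperIdx n → D.Carrier => unip v i j := by
  simp only [unip, Matrix.of_apply]
  split_ifs
  · exact continuous_apply _
  · exact continuous_const
  · exact continuous_const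

theorem continuous_star_carrier : Continuous (star : D.Carrier → D.Carrier) := D.starL.continuous

theorem Continuous.hermAct_unip {P : Type*} [TopologicalSpace P] {f : P → UpperIdx n → D.Carrier}
    {a : P → Fin n → ℝ} (hf : Continuous f) (ha : Continuous a) :
    Continuous fun x => hermAct (unip (f x)) (diagH D (a x)) := by
  refine continuous_herm fun i j => ?_
  simp only [hermAct_diagH_apply]
  refine continuous_finsetSum _ fun k _ => ?_
  have h1 : ∀ k i, Continuous fun x => unip (f x) k i := fun k i => (continuous_unip k i).comp hf
  have h2 : Continuous fun x => a x k := (continuous_apply k).comp ha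
  exact h2.smul ((continuous_star_carrier.comp (h1 k i)).mul (h1 k j))

theorem continuous_chiN {ψ : AddChar ℝ Circle} {lam : ℝ} (hψ : HasFrequency ψ lam) :
    Continuous fun v : UpperIdx n → D.Carrier => chiN ψ (unip v) := by
  simp only [chiN_eq]
  refine hψ.continuous.comp (continuous_finsetSum _ fun i _ => continuous_finsetSum _ fun j _ => ?_)
  split_ifs
  · exact D.trL.continuous.comp (continuous_unip i j)
  · exact continuous_const

/-- A bookkeeping of product measures: the last factor of the parameters is moved into the first
argument by `T`. -/
theorem MeasureTheory.MeasurePreserving.rearrange {α β γ P W : Type*} [MeasureSpace α] [MeasureSpace β]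
    [MeasureSpace γ] [MeasureSpace P] [MeasureSpace W] [SFinite (volume : Measure α)] [SFinite (volume : Measure β)]
    [SFinite (volume : Measure γ)] [SFinite (volume : Measure P)] [SFinite (volume : Measure W)] {T : β × α → γ}
    (hT : MeasurePreserving T) :
    MeasurePreserving fun z : (α × P) × (W × β) => ((T (z.2.2, z.1.1), z.1.2), z.2.1) := by
  have e1 : MeasurePreserving (fun z : (α × P) × (W × β) => ((z.1.1, z.2.2), (z.1.2, z.2.1))) :=
    measurePreserving_prodProdProdComm.comp ((MeasurePreserving.id volume).prod Measure.measurePreserving_swap)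
  have e2 : MeasurePreserving (fun z : (α × β) × (P × W) => (T (z.1.2, z.1.1), z.2)) :=
    (hT.comp Measure.measurePreserving_swap).prod (MeasurePreserving.id volume)
  have e3 : MeasurePreserving (fun z : γ × (P × W) => ((z.1, z.2.1), z.2.2)) :=
    (measurePreserving_prodAssoc volume volume volume).symm MeasurableEquiv.prodAssoc
  exact e3.comp (e2.comp e1)

/-- Schwartz functions are integrable along the orbits of the diagonal matrices `a p`, jointly in
the unipotent matrix, in `p` and in further parameters. -/
def OrbitIntegrable (D : QuadAlg) {r : ℕ} {P : Type} [MeasureSpace P] (a : P → Fin r → ℝ) : Prop :=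
  ∀ (W : Type) [NormedAddCommGroup W] [NormedSpace ℝ W] [FiniteDimensional ℝ W] [MeasureSpace W] [BorelSpace W]
    [SecondCountableTopology W] [SFinite (volume : Measure W)] [(volume : Measure W).IsAddHaarMeasure]
    (K : 𝓢(W × Herm D r, ℂ)),
    Integrable fun z : ((UpperIdx r → D.Carrier) × P) × W =>
      K (z.2, hermAct (unip z.1.1) (diagH D (a z.1.2)))

/-- The first row `v` of the unipotent matrix is treated as a further parameter of the Schwartz
function: in it, `K` pulled back to the orbit remains Schwartz, since `q ≠ 0`. -/
theorem OrbitIntegrable.cons {P : Type} [MeasureSpace P] [TopologicalSpace P] [BorelSpace P]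
    [SecondCountableTopology P] [SFinite (volume : Measure P)] {a : P → Fin r → ℝ} (ha : Continuous a)
    (h : OrbitIntegrable D a) {q : ℝ} (hq : q ≠ 0) :
    OrbitIntegrable D (r := r + 1) fun p => Fin.cons q (a p) := by
  intro W _ _ _ _ _ _ _ _ K
  obtain ⟨K1, hK1⟩ := exists_rowSubst (E := W) (q := fun _ => q) (qi := fun _ => q⁻¹) (.const _) (.const _)
    (fun _ => inv_mul_cancel₀ hq) K
  obtain ⟨K2, hK2⟩ := exists_comp_temperate (g := fun x : (W × (Fin r → D.Carrier)) × Herm D r =>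
    ((x.1.1, x.2), x.1.2)) (h := fun y => ((y.1.1, y.2), y.1.2)) (by fun_prop) (by fun_prop) (fun x => rfl) K1
  have h1 := h (W × (Fin r → D.Carrier)) K2
  let T : ((UpperIdx r → D.Carrier) × P) × (W × (Fin r → D.Carrier)) → ((UpperIdx (r + 1) → D.Carrier) × P) × W :=
    fun z => ((rowU D r (z.2.2, z.1.1), z.1.2), z.2.1)
  have hT : MeasurePreserving T := measurePreserving_rowU.rearrange
  refine (hT.integrable_comp ?_).1 ?_
  · have hc : Continuous fun p => (Fin.cons q (a p) : Fin (r + 1) → ℝ) := by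
      refine continuous_pi fun i => ?_
      induction i using Fin.cases with
      | zero => exact continuous_const
      | succ i => simp only [Fin.cons_succ]; fun_prop
    have h2 : Continuous fun z : ((UpperIdx (r + 1) → D.Carrier) × P) × W =>
        hermAct (unip z.1.1) (diagH D (Fin.cons q (a z.1.2) : Fin (r + 1) → ℝ)) :=
      Continuous.hermAct_unip (by fun_prop) (hc.comp (by fun_prop))
    exact (K.continuous.comp (continuous_snd.prodMk h2)).aestronglyMeasurable
  · refine h1.congr (.of_forall fun z => ?_)
    simp only [Function.comp, T, hermAct_unip_rowU, hK2, hK1]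

theorem unip_of_subsingleton [Subsingleton (Fin n)] (v : UpperIdx n → D.Carrier) : unip v = 1 := by
  ext i j
  rw [Subsingleton.elim i j]
  simp [unip]

/-- Absolute convergence over a single orbit. Only the entries of `a` other than the last one have to
be nonzero. -/
theorem orbitIntegrable_const {a : Fin n → ℝ} (ha : ∀ i : Fin n, (i : ℕ) + 1 < n → a i ≠ 0) :
    OrbitIntegrable D fun _ : Fin 0 → ℝ => a := by
  have base : ∀ (n : ℕ) [Subsingleton (Fin n)] (a : Fin n → ℝ), OrbitIntegrable D fun _ : Fin 0 → ℝ => a := by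
    intro n _ a W _ _ _ _ _ _ _ _ K
    have h1 : Integrable (fun w => K (w, hermAct 1 (diagH D a))) := by
      obtain ⟨G, hG⟩ := exists_comp_temperate (g := fun w : W => (w, hermAct 1 (diagH D a))) (h := Prod.fst)
        (by fun_prop) (by fun_prop) (fun x => rfl) K
      exact G.integrable.congr (.of_forall hG)
    have : IsEmpty (UpperIdx n) := ⟨fun p => p.2.ne (Subsingleton.elim _ _)⟩
    have hf : IsFiniteMeasure (volume : Measure ((UpperIdx n → D.Carrier) × (Fin 0 → ℝ))) := by
      rw [Measure.volume_eq_prod, Measure.volume_pi_eq_dirac 0, Measure.volume_pi_eq_dirac 0]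
      infer_instance
    refine (h1.comp_snd volume).congr (.of_forall fun z => ?_)
    simp only [unip_of_subsingleton]
  induction n with
  | zero => exact base 0 a
  | succ n ih =>
    rcases n.eq_zero_or_pos with rfl | hn
    · exact base 1 a
    · have := (ih (a := Fin.tail a) fun i hi => ha _ (by simpa using hi)).cons (by fun_prop)
        (ha 0 (by simpa using hn))
      simpa using this

/-- Absolute convergence jointly in the unipotent matrix and the last diagonal entry, as needed to
exchange the Kloosterman integral with the Fourier transform in the last entry. -/
theorem orbitIntegrable_snoc {p : Fin r → ℝ} (hp : p ∈ torus r) :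
    OrbitIntegrable D (r := r + 1) fun x : ℝ => Fin.snoc p x := by
  induction r with
  | zero =>
    intro W _ _ _ _ _ _ _ _ K
    have h1 : Integrable (fun z : ℝ × W => K (z.2, diagH D fun _ => z.1)) := by
      have e := exists_comp_temperate (g := fun z : ℝ × W => (z.2, (diagH D (fun _ => z.1) : Herm D 1)))
        (h := fun y => (D.toReal (y.2.1 0 0), y.1)) (by
          refine hasTemperateGrowth_prodMk (by fun_prop) (hasTemperateGrowth_herm fun i j => ?_)
          have : ∀ z : ℝ × W, (diagH D (fun _ => z.1) : Herm D 1).1 i j = z.1 • 1 := fun z => by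
            rw [Subsingleton.elim i j, ← Algebra.algebraMap_eq_smul_one]; simp [diagH]
          simp only [this]
          fun_prop) (by fun_prop) (fun x => by simp [diagH]) K
      obtain ⟨G, hG⟩ := e
      exact G.integrable.congr (.of_forall hG)
    have : IsEmpty (UpperIdx 1) := ⟨fun p => by have := p.2; omega⟩
    have hf : IsFiniteMeasure (volume : Measure (UpperIdx 1 → D.Carrier)) := by
      rw [Measure.volume_pi_eq_dirac 0]
      infer_instance
    have h2 := h1.comp_snd (volume : Measure (UpperIdx 1 → D.Carrier))
    have h3 : MeasurePreserving (fun z : ((UpperIdx 1 → D.Carrier) × ℝ) × W => (z.1.1, (z.1.2, z.2))) :=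
      measurePreserving_prodAssoc volume volume volume
    refine (h3.integrable_comp_of_integrable h2).congr (.of_forall fun z => ?_)
    refine congrArg K (Prod.ext rfl (Herm.ext fun i j => ?_))
    rw [hermAct_diagH_apply, Fin.fin_one_eq_zero i, Fin.fin_one_eq_zero j]
    simp [unip, diagH, Fin.snoc, Algebra.algebraMap_eq_smul_one]
  | succ r ih =>
    have := (ih (p := Fin.tail p) fun i => hp _).cons (by
      refine continuous_pi fun i => ?_
      induction i using Fin.lastCases <;> simp <;> fun_prop) (hp 0)
    convert this using 2 with x
    rw [Fin.cons_snoc_eq_snoc_cons, Fin.cons_self_tail]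

variable {ψ : AddChar ℝ Circle} {lam : ℝ}

theorem integrable_orbit {a : Fin n → ℝ} (ha : ∀ i : Fin n, (i : ℕ) + 1 < n → a i ≠ 0) (f : 𝓢(Herm D n, ℂ)) :
    Integrable fun v : UpperIdx n → D.Carrier => f (hermAct (unip v) (diagH D a)) := by
  obtain ⟨K, hK⟩ := exists_constFamily f
  have h1 := orbitIntegrable_const ha (Fin 0 → ℝ) K
  -- The spaces of parameters are points, of mass one, and can be dropped.
  have h2 : (volume : Measure (Fin 0 → ℝ)) = Measure.dirac 0 := Measure.volume_pi_eq_dirac 0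
  have h3 : (volume : Measure (((UpperIdx n → D.Carrier) × (Fin 0 → ℝ)) × (Fin 0 → ℝ))) =
      ((volume : Measure (UpperIdx n → D.Carrier)).prod (Measure.dirac 0)).prod (Measure.dirac 0) := by
    rw [Measure.volume_eq_prod, Measure.volume_eq_prod, h2]
  rw [h3] at h1
  have h4 := h1.prod_left_ae
  rw [ae_dirac_eq] at h4
  have h5 := (Filter.eventually_pure.1 h4).prod_left_ae
  rw [ae_dirac_eq] at h5
  exact (Filter.eventually_pure.1 h5).congr (.of_forall fun v => hK _ _)

theorem integrable_orbit_snoc {p : Fin r → ℝ} (hp : p ∈ torus r) (f : 𝓢(Herm D (r + 1), ℂ)) :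
    Integrable fun z : (UpperIdx (r + 1) → D.Carrier) × ℝ =>
      f (hermAct (unip z.1) (diagH D (Fin.snoc p z.2 : Fin (r + 1) → ℝ))) := by
  obtain ⟨K, hK⟩ := exists_constFamily f
  have h1 := orbitIntegrable_snoc hp (Fin 0 → ℝ) K
  -- The space of further parameters is a point, of mass one, and can be dropped.
  have h2 : (volume : Measure (Fin 0 → ℝ)) = Measure.dirac 0 := Measure.volume_pi_eq_dirac 0
  have h3 : (volume : Measure (((UpperIdx (r + 1) → D.Carrier) × ℝ) × (Fin 0 → ℝ))) =
      (volume : Measure ((UpperIdx (r + 1) → D.Carrier) × ℝ)).prod (Measure.dirac 0) := by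
    rw [Measure.volume_eq_prod, h2]
  rw [h3] at h1
  have h4 := h1.prod_left_ae
  rw [ae_dirac_eq] at h4
  exact (Filter.eventually_pure.1 h4).congr (.of_forall fun v => hK _ _)

theorem integrable_kloosIntegrand (hψ : HasFrequency ψ lam) {a : Fin n → ℝ}
    (ha : ∀ i : Fin n, (i : ℕ) + 1 < n → a i ≠ 0)
    (f : 𝓢(Herm D n, ℂ)) : Integrable (kloosIntegrand ψ f a) :=
  (integrable_orbit ha f).mul_bdd (c := 1) (continuous_chiN hψ).aestronglyMeasurable
    (.of_forall fun _ => (norm_chiN _ _).le)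

theorem kloosIntegrand_rowU (f : Herm D (r + 1) → ℂ) (q : ℝ) (a : Fin r → ℝ)
    (x : (Fin r → D.Carrier) × (UpperIdx r → D.Carrier)) :
    kloosIntegrand ψ f (Fin.cons q a) (rowU D r x) =
      f (rowBlk D r ((q, q • x.1), hermAct (unip x.2) (diagH D a) + q • outerH x.1)) *
        (charVal ψ (firstTr x.1) * chiN ψ (unip x.2)) := by
  rw [kloosIntegrand, hermAct_unip_rowU, chiN_rowU]

theorem kloosIntegrand_colU (f : Herm D (r + 1) → ℂ) (p : Fin r → ℝ) (t : ℝ)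
    (x : (UpperIdx r → D.Carrier) × (Fin r → D.Carrier)) :
    kloosIntegrand ψ f (Fin.snoc p t) (colU D r x) =
      f (colBlk D r (hermAct (unip x.1) (diagH D p), (t + ∑ i, p i * D.normForm (x.2 i),
        (unip x.1).conjTranspose.mulVec fun i => p i • x.2 i))) *
        (chiN ψ (unip x.1) * charVal ψ (lastTr x.2)) := by
  rw [kloosIntegrand, hermAct_unip_colU, chiN_colU]

/-- Integrating out the first row: the Kloosterman integral at `diag(q, a)` is the one of the image
under the row operator at `diag a`. -/
theorem kloos_cons (hψ : HasFrequency ψ lam) {q : ℝ} (hq : q ≠ 0) {a : Fin r → ℝ}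
    (ha : ∀ i : Fin r, (i : ℕ) + 1 < r → a i ≠ 0) (f : 𝓢(Herm D (r + 1), ℂ)) :
    kloos ψ f (Fin.cons q a) = kloos ψ (rowOp ψ q f) a := by
  have hint := integrable_kloosIntegrand hψ (a := Fin.cons q a)
    (fun i hi => by
      induction i using Fin.cases with
      | zero => exact hq
      | succ i => exact ha i (by simpa using hi)) f
  have emb : MeasurableEmbedding (rowU D r) := (rowU D r).toHomeomorph.measurableEmbedding
  rw [kloos, ← measurePreserving_rowU.integral_comp emb, Measure.volume_eq_prod, integral_prod_symm]
  · rw [kloos]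
    congr 1
    ext u
    simp only [kloosIntegrand_rowU]
    rw [kloosIntegrand, rowOp, ← integral_mul_const]
    congr 1
    ext v
    ring
  · exact (measurePreserving_rowU.integrable_comp_emb emb).2 hint

end Integrability

/-! ### The Weil formula and the last column -/

section LastColumn
variable {D : QuadAlg} {n r : ℕ} {ψ : AddChar ℝ Circle} {lam : ℝ}

/-- The Jacobian of a matrix over `D` with real determinant `t`, as a real linear map, is `t ^ 2`.
-/
theorem integral_comp_mulVec {M : Matrix (Fin r) (Fin r) D.Carrier} {t : ℝ}
    (hM : M.det = algebraMap ℝ D.Carrier t) (ht : t ≠ 0) (Φ : (Fin r → D.Carrier) → ℂ) :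
    ((t ^ 2 : ℝ) : ℂ) * ∫ v, Φ (M.mulVec v) = ∫ v, Φ v := by
  let T : (Fin r → D.Carrier) →ₗ[ℝ] (Fin r → D.Carrier) := (Matrix.mulVecLin M).restrictScalars ℝ
  have hdet : T.det = t ^ 2 := by
    have h := LinearMap.det_restrictScalars (R := ℝ) (S := D.Carrier) (f := Matrix.mulVecLin M)
    rw [h, ← Matrix.toLin'_apply', LinearMap.det_toLin', hM, Algebra.norm_algebraMap, D.finrank_carrier]
  have ht2 : 0 < t ^ 2 := by positivity
  have hT : T.det ≠ 0 := by rw [hdet]; exact ht2.ne'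
  have hmap := Measure.map_linearMap_addHaar_eq_smul_addHaar (volume : Measure (Fin r → D.Carrier)) hT
  have emb : MeasurableEmbedding T :=
    (T.equivOfDetNeZero hT).toContinuousLinearEquiv.toHomeomorph.measurableEmbedding
  have h3 : ∫ v, Φ (M.mulVec v) = ∫ v, Φ v ∂(volume.map T) := (emb.integral_map Φ).symm
  rw [h3, hmap, integral_smul_measure, hdet, ENNReal.toReal_ofReal (abs_nonneg _),
    abs_of_nonneg (inv_nonneg.2 ht2.le), Complex.real_smul, ← mul_assoc, ← Complex.ofReal_mul,
    mul_inv_cancel₀ ht2.ne', Complex.ofReal_one, one_mul]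

theorem hasTemperateGrowth_mulVec (M : Matrix (Fin r) (Fin r) D.Carrier) :
    (fun v : Fin r → D.Carrier => M.mulVec v).HasTemperateGrowth :=
  (LinearMap.toContinuousLinearMap ((Matrix.mulVecLin M).restrictScalars ℝ)).hasTemperateGrowth

theorem det_unip (u : UpperIdx n → D.Carrier) : (unip u).det = 1 := by
  rw [Matrix.det_of_isUpperTriangular]
  · simp [unip]
  · intro i j h
    have h' : j < i := h
    simp [unip, h'.not_gt, h'.ne']

/-- The matrix `diag(p) u`. -/
noncomputable def diagUnip (p : Fin r → ℝ) (u : UpperIdx r → D.Carrier) : Matrix (Fin r) (Fin r) D.Carrier :=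
  Matrix.diagonal (fun i => algebraMap ℝ D.Carrier (p i)) * unip u

theorem diagUnip_mulVec (p : Fin r → ℝ) (u : UpperIdx r → D.Carrier) (γ : Fin r → D.Carrier) (i : Fin r) :
    (diagUnip p u).mulVec γ i = p i • (unip u).mulVec γ i := by
  rw [diagUnip, ← Matrix.mulVec_mulVec, Matrix.mulVec_diagonal, Algebra.smul_def]

theorem diagUnip_conjTranspose_mulVec (p : Fin r → ℝ) (u : UpperIdx r → D.Carrier) (v : Fin r → D.Carrier) :
    (diagUnip p u).conjTranspose.mulVec v = (unip u).conjTranspose.mulVec fun i => p i • v i := by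
  rw [diagUnip, Matrix.conjTranspose_mul, ← Matrix.mulVec_mulVec, Matrix.diagonal_conjTranspose]
  congr 1
  ext i
  rw [Matrix.mulVec_diagonal, Pi.star_apply, D.star_algebraMap, Algebra.smul_def]

theorem det_diagUnip (p : Fin r → ℝ) (u : UpperIdx r → D.Carrier) :
    (diagUnip p u).det = algebraMap ℝ D.Carrier (∏ i, p i) := by
  rw [diagUnip, Matrix.det_mul, det_unip, Matrix.det_diagonal, mul_one, map_prod]

theorem det_diagUnip_conjTranspose (p : Fin r → ℝ) (u : UpperIdx r → D.Carrier) :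
    (diagUnip p u).conjTranspose.det = algebraMap ℝ D.Carrier (∏ i, p i) := by
  rw [Matrix.det_conjTranspose, det_diagUnip, D.star_algebraMap]

theorem sum_form_mulVec (M : Matrix (Fin r) (Fin r) D.Carrier) (x y : Fin r → D.Carrier) :
    ∑ i, D.form (y i) (M.mulVec x i) = ∑ i, D.form (M.conjTranspose.mulVec y i) (x i) := by
  simp only [QuadAlg.form, ← D.tr_sum]
  congr 1
  simp only [Matrix.mulVec, dotProduct, star_sum, Finset.mul_sum, Finset.sum_mul, Matrix.conjTranspose_apply]
  rw [Finset.sum_comm]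
  refine Finset.sum_congr rfl fun i _ => Finset.sum_congr rfl fun j _ => ?_
  rw [star_mul']
  ring

/-- The Hermitian form in the orbit of `diag(p)` is diagonal after the substitution by `u`. -/
theorem quadH_hermAct_diagH (u : Matrix (Fin r) (Fin r) D.Carrier) (p : Fin r → ℝ) (γ : Fin r → D.Carrier) :
    quadH (hermAct u (diagH D p)) γ = ∑ k, p k * D.normForm (u.mulVec γ k) := by
  have h : ∑ i, ∑ j, star (γ i) * (hermAct u (diagH D p)).1 i j * γ j =
      ∑ k, p k • (u.mulVec γ k * star (u.mulVec γ k)) := by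
    simp only [hermAct_diagH_apply, Matrix.mulVec, dotProduct, star_sum, Finset.mul_sum, Finset.sum_mul,
      Finset.smul_sum]
    rw [Finset.sum_congr rfl fun i _ => Finset.sum_comm]
    rw [Finset.sum_comm]
    refine Finset.sum_congr rfl fun k _ => Finset.sum_congr rfl fun i _ => Finset.sum_congr rfl fun j _ => ?_
    rw [star_mul']
    simp only [Algebra.smul_def]
    ring
  rw [quadH, h, D.toReal_sum]
  exact Finset.sum_congr rfl fun k _ => D.toReal_smul _ _

theorem unip_mulVec_of_last (u : UpperIdx r → D.Carrier) (γ : Fin r → D.Carrier) {i : Fin r} (hi : (i : ℕ) + 1 = r) :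
    (unip u).mulVec γ i = γ i := by
  rw [Matrix.mulVec, dotProduct, Finset.sum_eq_single i]
  · simp [unip]
  · intro j _ hj
    have h1 : ¬ i < j := fun h => by have := j.2; omega
    simp [unip, h1, hj.symm]
  · simp

theorem form_algebraMap_right (x : D.Carrier) (t : ℝ) : D.form x (algebraMap ℝ D.Carrier t) = t * D.tr x := by
  rw [QuadAlg.form, D.star_algebraMap, mul_comm, ← Algebra.smul_def, D.tr_smul]

theorem normForm_algebraMap (t : ℝ) : D.normForm (algebraMap ℝ D.Carrier t) = t ^ 2 := by
  rw [QuadAlg.normForm, D.star_algebraMap, ← map_mul, D.toReal_algebraMap, sq]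

/-- The exponent `1 / (q p_r)` of the phase in a step of the Jacquet transform, zero if `r = 0`. -/
noncomputable def lastPhase (p : Fin r → ℝ) (q : ℝ) : ℝ := ∑ i : Fin r, if (i : ℕ) + 1 = r then 1 / (q * p i) else 0

/-- The shift which completes the square in the last column. -/
noncomputable def squareShift (D : QuadAlg) (p : Fin r → ℝ) (q : ℝ) (i : Fin r) : D.Carrier :=
  if (i : ℕ) + 1 = r then algebraMap ℝ D.Carrier (1 / (q * p i)) else 0

theorem normForm_zero : D.normForm 0 = 0 := by simpa using normForm_algebraMap (D := D) 0

theorem form_zero_right (x : D.Carrier) : D.form x 0 = 0 := map_zero (D.formL x)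

/-- Completing the square: the linear term `lastTr v` from the character is absorbed by a shift of
the last coordinate, at the cost of the constant `1 / (q p_r)`, the phase in the Jacquet transform.
-/
theorem complete_square {p : Fin r → ℝ} (hp : p ∈ torus r) {q : ℝ} (hq : q ≠ 0) (v : Fin r → D.Carrier) :
    ∑ i, q * p i * D.normForm ((v + squareShift D p q) i) =
      lastTr v + q * ∑ i, p i * D.normForm (v i) + lastPhase p q := by
  rw [lastTr, lastPhase, Finset.mul_sum, ← Finset.sum_add_distrib, ← Finset.sum_add_distrib]
  refine Finset.sum_congr rfl fun i _ => ?_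
  rw [Pi.add_apply, D.normForm_add, squareShift]
  have := hp i
  split_ifs
  · rw [form_algebraMap_right, normForm_algebraMap]
    field_simp
    ring
  · rw [form_zero_right, normForm_zero]
    ring

/-- The shift reappears on the dual side as the linear phase of the column operator. -/
theorem sum_form_squareShift {p : Fin r → ℝ} (hp : p ∈ torus r) {q : ℝ} (u : UpperIdx r → D.Carrier)
    (β : Fin r → D.Carrier) :
    ∑ i, D.form (squareShift D p q i) ((diagUnip p u).mulVec β i) = q⁻¹ * lastTr β := by
  rw [lastTr, Finset.mul_sum]
  refine Finset.sum_congr rfl fun i _ => ?_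
  rw [squareShift, D.form_comm]
  split_ifs with h
  · rw [form_algebraMap_right, diagUnip_mulVec, D.tr_smul, unip_mulVec_of_last u β h]
    have := hp i
    rcases eq_or_ne q 0 with rfl | hq
    · simp
    · field_simp
  · rw [form_zero_right, mul_zero]

/-- The integral over the last column of the unipotent variable, by the Weil formula. The character
makes the exponent a quadratic form in the shifted variable, and the substitutions by `diag(p) u`
and by its adjoint have the same Jacobian, so that it cancels. -/
theorem integral_mulVec_char {p : Fin r → ℝ} (hp : p ∈ torus r) (hlam : lam ≠ 0) (hψ : HasFrequency ψ lam)
    {q : ℝ} (hq : q ≠ 0) (u : UpperIdx r → D.Carrier) (φ : 𝓢(Fin r → D.Carrier, ℂ)) :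
    (∫ v : Fin r → D.Carrier, charVal ψ (lastTr v + q * ∑ i, p i * D.normForm (v i)) *
        φ ((unip u).conjTranspose.mulVec fun i => p i • v i)) * charVal ψ (lastPhase p q) =
      (∏ i, (D.density lam : ℂ) * (((|q * p i|⁻¹ * D.eta (q * p i) : ℝ) : ℂ) * D.weilConst lam)) *
        ∫ β : Fin r → D.Carrier, charVal ψ (-(q⁻¹ * quadH (hermAct (unip u) (diagH D p)) β) - q⁻¹ * lastTr β) *
          ∫ b : Fin r → D.Carrier, φ b * charVal ψ (-∑ i, D.form (b i) (β i)) := by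
  set M := diagUnip p u with hM
  set s := squareShift D p q with hs
  have hP : ∏ i, p i ≠ 0 := Finset.prod_ne_zero_iff.2 fun i _ => hp i
  have hunit : IsUnit M.conjTranspose.det := by
    rw [det_diagUnip_conjTranspose]
    exact (isUnit_iff_ne_zero.2 hP).map (algebraMap ℝ D.Carrier)
  obtain ⟨h, hh⟩ := exists_comp_temperate (g := fun v => M.conjTranspose.mulVec (v - s))
    (h := fun y => M.conjTranspose⁻¹.mulVec y + s)
    ((hasTemperateGrowth_mulVec M.conjTranspose).comp (by fun_prop))
    ((hasTemperateGrowth_mulVec M.conjTranspose⁻¹).add (.const _))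
    (fun v => by
      rw [Matrix.mulVec_mulVec, Matrix.nonsing_inv_mul _ hunit, Matrix.one_mulVec, sub_add_cancel]) φ
  -- The Weil formula is applied at `-(q p_i)⁻¹`, so that its right-hand side is the quadratic
  -- phase of coefficients `q p_i` to be integrated.
  have ha : ∀ i, -(q * p i)⁻¹ ≠ 0 := fun i => neg_ne_zero.2 (inv_ne_zero (mul_ne_zero hq (hp i)))
  have weil := D.weil_formula_pi hlam hψ (fun i => -(q * p i)⁻¹) ha h
  -- completing the square
  have h1 : (∫ v : Fin r → D.Carrier, charVal ψ (lastTr v + q * ∑ i, p i * D.normForm (v i)) *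
      φ ((unip u).conjTranspose.mulVec fun i => p i • v i)) * charVal ψ (lastPhase p q) =
      ∫ v : Fin r → D.Carrier, charVal ψ (-∑ i, D.normForm (v i) / -(q * p i)⁻¹) * h v := by
    symm
    rw [← integral_add_right_eq_self _ s, ← integral_mul_const]
    congr 1
    ext v
    rw [hh, add_sub_cancel_right, hM, diagUnip_conjTranspose_mulVec]
    have e : -∑ i, D.normForm ((v + s) i) / -(q * p i)⁻¹ = ∑ i, q * p i * D.normForm ((v + s) i) := by
      rw [← Finset.sum_neg_distrib]
      refine Finset.sum_congr rfl fun i _ => ?_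
      rw [div_neg, neg_neg, div_inv_eq_mul, mul_comm]
    rw [e, hs, complete_square hp hq, charVal_add ψ _ (lastPhase p q)]
    ring
  -- the substitutions by `M` and by its adjoint
  have h2 : ∫ x : Fin r → D.Carrier, charVal ψ (∑ i, -(q * p i)⁻¹ * D.normForm (x i)) *
      (∫ y : Fin r → D.Carrier, h y * charVal ψ (-∑ i, D.form (y i) (x i))) =
      ∫ β : Fin r → D.Carrier, charVal ψ (-(q⁻¹ * quadH (hermAct (unip u) (diagH D p)) β) - q⁻¹ * lastTr β) *
          ∫ b : Fin r → D.Carrier, φ b * charVal ψ (-∑ i, D.form (b i) (β i)) := by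
    rw [← integral_comp_mulVec (det_diagUnip p u) hP, ← integral_const_mul]
    congr 1
    ext β
    have e4 := integral_comp_mulVec (det_diagUnip_conjTranspose p u) hP
      fun b => φ b * charVal ψ (-∑ i, D.form (b i) (β i))
    rw [← e4, ← integral_add_right_eq_self _ s, ← hM]
    have e1 : ∑ i, -(q * p i)⁻¹ * D.normForm (M.mulVec β i) = -(q⁻¹ * quadH (hermAct (unip u) (diagH D p)) β) := by
      rw [quadH_hermAct_diagH, Finset.mul_sum, ← Finset.sum_neg_distrib]
      refine Finset.sum_congr rfl fun i _ => ?_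
      rw [hM, diagUnip_mulVec, D.normForm_smul]
      have := hp i
      field_simp
    have e2 : ∀ y : Fin r → D.Carrier, charVal ψ (-∑ i, D.form ((y + s) i) (M.mulVec β i)) =
        charVal ψ (-(q⁻¹ * lastTr β)) * charVal ψ (-∑ i, D.form (M.conjTranspose.mulVec y i) (β i)) := fun y => by
      rw [← charVal_add, ← sum_form_mulVec, ← sum_form_squareShift hp u β, ← neg_add, ← Finset.sum_add_distrib]
      congr 2
      refine Finset.sum_congr rfl fun i _ => ?_
      rw [Pi.add_apply, D.form_add_left, add_comm]
    have e3 : ∀ y : Fin r → D.Carrier, h (y + s) = φ (M.conjTranspose.mulVec y) := fun y => by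
      rw [hh, add_sub_cancel_right]
    simp only [e1, e2, e3, sub_eq_add_neg, charVal_add, mul_left_comm _ (charVal ψ (-(q⁻¹ * lastTr β))),
      integral_const_mul]
    ring
  have hd : (D.density lam : ℂ) ≠ 0 := by exact_mod_cast (D.density_pos hlam).ne'
  rw [h1, ← h2, weil, ← mul_assoc, ← Finset.prod_mul_distrib]
  rw [Finset.prod_eq_one, one_mul]
  intro i _
  have hqp : q * p i ≠ 0 := mul_ne_zero hq (hp i)
  -- The Weil factor at `-1 / b`, where `b = q p_i`, is inverse to the asserted factor at `b`.
  have e1 : |-(q * p i)⁻¹|⁻¹ * D.eta (-(q * p i)⁻¹) = |q * p i| * (D.eta (-1) * D.eta (q * p i)) := by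
    rw [abs_neg, abs_inv, inv_inv, ← D.eta_inv (q * p i), ← D.eta_mul, neg_one_mul]
  rw [e1]
  have e2 := D.eta_mul_self hqp
  have e3 : ((D.eta (-1) : ℝ) : ℂ) * (D.weilConst lam * D.weilConst lam) = 1 := by
    rw [← QuadAlg.eta_neg_one_mul D hlam, ← Complex.ofReal_mul, D.eta_mul_self (by norm_num), Complex.ofReal_one]
  have e4 : ((D.eta (q * p i) : ℝ) : ℂ) * (D.eta (q * p i) : ℝ) = 1 := by rw [← Complex.ofReal_mul, e2, Complex.ofReal_one]
  have e5 : ((|q * p i| : ℝ) : ℂ) ≠ 0 := by exact_mod_cast abs_ne_zero.2 hqp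
  push_cast
  calc _ = ((D.density lam : ℂ) * (D.density lam : ℂ)⁻¹) * (((|q * p i| : ℝ) : ℂ)⁻¹ * ((|q * p i| : ℝ) : ℂ)) *
        (((D.eta (q * p i) : ℝ) : ℂ) * (D.eta (q * p i) : ℝ)) *
        (((D.eta (-1) : ℝ) : ℂ) * (D.weilConst lam * D.weilConst lam)) := by ring
    _ = 1 := by rw [mul_inv_cancel₀ hd, inv_mul_cancel₀ e5, e4, e3]; ring

end LastColumn

/-! ### The Fourier transform of a Kloosterman integral in the last coordinate -/

section LastFourier
variable {D : QuadAlg} {n r : ℕ} {ψ : AddChar ℝ Circle} {lam : ℝ}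

/-- The self-dual measure on `ℝ` is `√|λ|` times the Lebesgue measure. -/
theorem haarReal_eq (hlam : lam ≠ 0) (hψ : HasFrequency ψ lam) :
    haarReal ψ = ENNReal.ofReal √|lam| • volume := by
  have h := isSelfDual_of_coords (ι := Unit) (ContinuousLinearEquiv.funUnique Unit ℝ ℝ).symm volume
    (volume_preserving_funUnique Unit ℝ).symm (Equiv.refl _) (fun _ => 1) (by simp) (fun x y : ℝ => x * y)
    (fun x y => by simp) ψ lam hlam hψ
  rw [haarReal, selfDualHaar_eq h]
  simp

theorem integral_haarReal (hlam : lam ≠ 0) (hψ : HasFrequency ψ lam) (g : ℝ → ℂ) :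
    ∫ x, g x ∂haarReal ψ = ((√|lam| : ℝ) : ℂ) * ∫ x, g x := by
  rw [haarReal_eq hlam hψ, integral_smul_measure, ENNReal.toReal_ofReal (Real.sqrt_nonneg _), Complex.real_smul]

theorem integrable_haarReal (hlam : lam ≠ 0) (hψ : HasFrequency ψ lam) {g : ℝ → ℂ} (hg : Integrable g) :
    Integrable g (haarReal ψ) := by
  rw [haarReal_eq hlam hψ]
  exact hg.smul_measure ENNReal.ofReal_ne_top

/-- For a fixed upper left block `A`, the Fourier transform of `f` in the last diagonal entry is a
Schwartz function of the rest of the last column, and its Fourier transform is the one of `f` in the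
whole last column. -/
theorem exists_colSlice (hψ : HasFrequency ψ lam) (A : Herm D r) (q : ℝ) (f : 𝓢(Herm D (r + 1), ℂ)) :
    ∃ φ : 𝓢(Fin r → D.Carrier, ℂ),
      (∀ b, φ b = ∫ d : ℝ, f (colBlk D r (A, (d, b))) * charVal ψ (-(d * q))) ∧
      ∀ β : Fin r → D.Carrier, ∫ b, φ b * charVal ψ (-∑ i, D.form (b i) (β i)) =
        ∫ w : ℝ × (Fin r → D.Carrier), f (colBlk D r (A, w)) * charVal ψ (-colPairing w (q, β)) := by
  obtain ⟨K, hK⟩ := exists_comp_temperate (g := fun x : (Fin r → D.Carrier) × ℝ => colBlk D r (A, (x.2, x.1)))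
    (h := fun Y => (((colBlk D r).symm Y).2.2, ((colBlk D r).symm Y).2.1)) (by fun_prop) (by
      have := (colBlk D r).symm.toContinuousLinearMap.hasTemperateGrowth
      have h2 : (fun Y => (colBlk D r).symm Y).HasTemperateGrowth := this
      fun_prop) (fun x => by simp) f
  obtain ⟨K1, hK1⟩ := exists_mul_temperate (hψ.hasTemperateGrowth
    (φ := fun x : (Fin r → D.Carrier) × ℝ => -(x.2 * q)) (by fun_prop)) K
  obtain ⟨φ, hφ⟩ := exists_integral_snd volume K1
  have hφ' : ∀ b, φ b = ∫ d : ℝ, f (colBlk D r (A, (d, b))) * charVal ψ (-(d * q)) := fun b => by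
    rw [hφ]
    congr 1
    ext d
    rw [hK1, hK, mul_comm]
  refine ⟨φ, hφ', fun β => ?_⟩
  obtain ⟨K2, hK2⟩ := exists_mul_temperate (hψ.hasTemperateGrowth
    (φ := fun x : (Fin r → D.Carrier) × ℝ => -∑ i, D.form (x.1 i) (β i)) (by fun_prop)) K1
  have hi := K2.integrable (μ := volume)
  rw [Measure.volume_eq_prod] at hi
  rw [Measure.volume_eq_prod, integral_prod_symm]
  · congr 1
    ext b
    rw [hφ', ← integral_mul_const]
    congr 1
    ext d
    simp only [colPairing]
    rw [mul_assoc, ← charVal_add, neg_add]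
  · refine hi.swap.congr (.of_forall fun w => ?_)
    simp only [Function.comp, Prod.swap, hK2, hK1, hK, colPairing]
    rw [neg_add, charVal_add]
    ring

theorem integrable_kloosIntegrand_snoc (hψ : HasFrequency ψ lam) {p : Fin r → ℝ} (hp : p ∈ torus r)
    (f : 𝓢(Herm D (r + 1), ℂ)) (q : ℝ) :
    Integrable fun z : (UpperIdx (r + 1) → D.Carrier) × ℝ =>
      kloosIntegrand ψ f (Fin.snoc p z.2 : Fin (r + 1) → ℝ) z.1 * charVal ψ (-(z.2 * q)) := by
  have h := (integrable_orbit_snoc hp f).mul_bdd (c := 1)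
    (((continuous_chiN hψ).comp continuous_fst).aestronglyMeasurable) (.of_forall fun _ => (norm_chiN _ _).le)
  exact h.mul_bdd (c := 1) ((hψ.continuous.comp
    (f := fun z : (UpperIdx (r + 1) → D.Carrier) × ℝ => -(z.2 * q)) (by fun_prop)).aestronglyMeasurable)
    (.of_forall fun _ => (norm_charVal _ _).le)

/-- The absolute convergence of the innermost integral. -/
theorem integrable_kloosNorm_snoc (hlam : lam ≠ 0) (hψ : HasFrequency ψ lam) {p : Fin r → ℝ} (hp : p ∈ torus r)
    (f : 𝓢(Herm D (r + 1), ℂ)) (q : ℝ) :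
    Integrable (fun x => kloosNorm ψ f (Fin.snoc p x : Fin (r + 1) → ℝ) * charVal ψ (-(x * q))) (haarReal ψ) := by
  have h := (integrable_kloosIntegrand_snoc hψ hp f q).integral_prod_right
  refine integrable_haarReal hlam hψ ((h.const_mul
    ((D.eta (sigmaH (diagH D p) * ∏ i, p i) * |sigmaH (diagH D p) * ∏ i, p i| : ℝ) : ℂ)).congr
    (.of_forall fun x => ?_))
  simp only [kloosNorm, sigmaH_diagH_snoc, kloos, integral_mul_const, mul_assoc]

/-- The Fourier transform of a Kloosterman integral in the last coordinate, times the phase of a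
step of the Jacquet transform, is a Kloosterman integral in one dimension less. -/
theorem integral_kloos_snoc (hlam : lam ≠ 0) (hψ : HasFrequency ψ lam) {p : Fin r → ℝ} (hp : p ∈ torus r)
    {q : ℝ} (hq : q ≠ 0) (f : 𝓢(Herm D (r + 1), ℂ)) :
    (∫ x, kloos ψ f (Fin.snoc p x : Fin (r + 1) → ℝ) * charVal ψ (-(x * q)) ∂haarReal ψ) *
        charVal ψ (lastPhase p q) =
      (∏ i, (((|q * p i|⁻¹ * D.eta (q * p i) : ℝ) : ℂ) * D.weilConst lam)) * kloos ψ (colOp ψ lam q f) p := by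
  have hI := integrable_kloosIntegrand_snoc hψ hp f q
  have emb : MeasurableEmbedding (colU D r) := (colU D r).toHomeomorph.measurableEmbedding
  have hJ := (measurePreserving_colU.integrable_comp_emb emb).2 hI.integral_prod_left
  have h1 : ∫ x, kloos ψ f (Fin.snoc p x : Fin (r + 1) → ℝ) * charVal ψ (-(x * q)) =
      ∫ u, ∫ v, ∫ x, kloosIntegrand ψ f (Fin.snoc p x : Fin (r + 1) → ℝ) (colU D r (u, v)) * charVal ψ (-(x * q)) := by
    simp only [kloos, ← integral_mul_const]
    rw [integral_integral_swap (f := fun x U => kloosIntegrand ψ f (Fin.snoc p x : Fin (r + 1) → ℝ) U *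
      charVal ψ (-(x * q))) hI.swap, ← measurePreserving_colU.integral_comp emb]
    exact integral_prod _ hJ
  have h2 : ∀ u : UpperIdx r → D.Carrier,
      (∫ v, ∫ x, kloosIntegrand ψ f (Fin.snoc p x : Fin (r + 1) → ℝ) (colU D r (u, v)) * charVal ψ (-(x * q))) *
        (((√|lam| : ℝ) : ℂ) * charVal ψ (lastPhase p q)) =
      (∏ i, (((|q * p i|⁻¹ * D.eta (q * p i) : ℝ) : ℂ) * D.weilConst lam)) *
        kloosIntegrand ψ (colOp ψ lam q f) p u := fun u => by
    obtain ⟨φ, hφ, hφ'⟩ := exists_colSlice hψ (hermAct (unip u) (diagH D p)) q f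
    have h3 : ∀ v : Fin r → D.Carrier, ∫ x, kloosIntegrand ψ f (Fin.snoc p x : Fin (r + 1) → ℝ) (colU D r (u, v)) *
        charVal ψ (-(x * q)) = chiN ψ (unip u) * (charVal ψ (lastTr v + q * ∑ i, p i * D.normForm (v i)) *
          φ ((unip u).conjTranspose.mulVec fun i => p i • v i)) := fun v => by
      -- The last diagonal entry `x + ∑ p_i N(v_i)` of the orbit is made the variable of
      -- integration; the character turns the translation into the quadratic phase
      -- `ψ(q ∑ p_i N(v_i))`.
      have e := integral_add_right_eq_self (μ := volume) (fun d : ℝ => f (colBlk D r (hermAct (unip u) (diagH D p),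
        (d, (unip u).conjTranspose.mulVec fun i => p i • v i))) * charVal ψ (-(d * q))) (∑ i, p i * D.normForm (v i))
      rw [hφ, ← e, ← integral_const_mul, ← integral_const_mul]
      congr 1
      ext x
      rw [kloosIntegrand_colU, add_mul, neg_add, charVal_add, charVal_add, mul_comm q]
      have e : charVal ψ ((∑ i, p i * D.normForm (v i)) * q) * charVal ψ (-((∑ i, p i * D.normForm (v i)) * q)) = 1 := by
        rw [← charVal_add, add_neg_cancel, charVal_zero]
      linear_combination (-f (colBlk D r (hermAct (unip u) (diagH D p), x + ∑ i, p i * D.normForm (v i),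
        (unip u).conjTranspose.mulVec fun i => p i • v i)) * chiN ψ (unip u) * charVal ψ (lastTr v) *
          charVal ψ (-(x * q))) * e
    have key := integral_mulVec_char hp hlam hψ hq u φ
    simp only [h3, integral_const_mul]
    rw [kloosIntegrand, colOp]
    simp only [hφ', Finset.prod_mul_distrib, Finset.prod_const, Finset.card_univ, Fintype.card_fin] at key ⊢
    push_cast at key ⊢
    linear_combination (chiN ψ (unip u) * ((√|lam| : ℝ) : ℂ)) * key
  rw [integral_haarReal hlam hψ, h1, mul_comm ((√|lam| : ℝ) : ℂ), mul_assoc, ← integral_mul_const]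
  simp only [h2, integral_const_mul, kloos]

/-- The same for normalized Kloosterman integrals: the normalization absorbs the dependence of the
Weil factors on the diagonal entries. -/
theorem integral_kloosNorm_snoc (hlam : lam ≠ 0) (hψ : HasFrequency ψ lam) {p : Fin r → ℝ} (hp : p ∈ torus r)
    {q : ℝ} (hq : q ≠ 0) (f : 𝓢(Herm D (r + 1), ℂ)) :
    (∫ x, kloosNorm ψ f (Fin.snoc p x : Fin (r + 1) → ℝ) * charVal ψ (-(x * q)) ∂haarReal ψ) *
        charVal ψ (lastPhase p q) =
      (D.weilConst lam * ((D.eta q * |q|⁻¹ : ℝ) : ℂ)) ^ r * kloosNorm ψ (colOp ψ lam q f) p := by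
  have key := integral_kloos_snoc hlam hψ hp hq f
  simp only [kloosNorm, sigmaH_diagH_snoc, mul_assoc, integral_const_mul]
  rw [key]
  have hP : ∏ i, p i ≠ 0 := Finset.prod_ne_zero_iff.2 fun i _ => hp i
  have e1 : (D.eta (sigmaH (diagH D p) * ∏ i, p i) * |sigmaH (diagH D p) * ∏ i, p i|) *
      ∏ i, |q * p i|⁻¹ * D.eta (q * p i) =
      (D.eta q * |q|⁻¹) ^ r * (D.eta (sigmaH (diagH D p)) * |sigmaH (diagH D p)|) := by
    have e2 := D.eta_mul_self hP
    have e3 : |∏ i, p i| * |∏ i, p i|⁻¹ = 1 := mul_inv_cancel₀ (abs_ne_zero.2 hP)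
    have e4 : ∏ i, |q * p i|⁻¹ * D.eta (q * p i) = (D.eta q * |q|⁻¹) ^ r * (|∏ i, p i|⁻¹ * D.eta (∏ i, p i)) := by
      simp only [abs_mul, D.eta_mul, mul_inv, Finset.prod_mul_distrib, Finset.prod_const, Finset.card_univ,
        Fintype.card_fin, Finset.abs_prod, D.eta_prod, Finset.prod_inv_distrib]
      ring
    rw [e4, D.eta_mul, abs_mul]
    linear_combination ((D.eta q * |q|⁻¹) ^ r * (D.eta (sigmaH (diagH D p)) * |sigmaH (diagH D p)|)) *
      (D.eta (∏ i, p i) * D.eta (∏ i, p i) * e3 + e2)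
  have e5 := congrArg (fun x : ℝ => (x : ℂ)) e1
  push_cast at e5 ⊢
  simp only [Finset.prod_mul_distrib, Finset.prod_const, Finset.card_univ, Fintype.card_fin, mul_pow] at e5 ⊢
  linear_combination (D.weilConst lam ^ r * kloos ψ (colOp ψ lam q f) p) * e5

end LastFourier

/-! ### The Fourier transform intertwines the column and the row operators -/

section Intertwining
variable {D : QuadAlg} {n r : ℕ} {ψ : AddChar ℝ Circle} {lam : ℝ}

theorem exists_colOp_const (hlam : lam ≠ 0) (hψ : HasFrequency ψ lam) (q : ℝ) (f : 𝓢(Herm D (r + 1), ℂ)) :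
    ∃ G : 𝓢(Herm D r, ℂ), ∀ X, G X = colOp ψ lam q f X := by
  obtain ⟨K, hK⟩ := exists_constFamily f
  obtain ⟨G, hG⟩ := exists_colOp hlam hψ (q := fun _ : Fin 0 → ℝ => q) (.const _) (.const _) K
  exact ⟨schwartzSlice G 0, fun X => by simp only [schwartzSlice_apply, hG, hK]⟩

/-- The reflection which identifies last columns with first rows preserves the measure. -/
theorem integral_rev_star (Φ : (Fin r → D.Carrier) → ℂ) :
    ∫ γ : Fin r → D.Carrier, Φ (fun i => star (γ i.rev)) = ∫ δ, Φ δ := by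
  have h1 : MeasurePreserving (fun γ : Fin r → D.Carrier => fun i => star (γ i)) :=
    volume_preserving_pi fun _ => D.measurePreserving_star
  have h2 := volume_measurePreserving_piCongrLeft (fun _ : Fin r => D.Carrier) Fin.revPerm
  have h3 : ∀ γ : Fin r → D.Carrier,
      MeasurableEquiv.piCongrLeft (fun _ : Fin r => D.Carrier) Fin.revPerm γ = fun i => γ i.rev := fun γ => by
    ext i
    have := MeasurableEquiv.piCongrLeft_apply_apply (β := fun _ : Fin r => D.Carrier) Fin.revPerm γ i.rev
    rwa [Fin.revPerm_apply, Fin.rev_rev] at this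
  have h4 : MeasurableEmbedding (fun γ : Fin r → D.Carrier => fun i => star (γ i)) :=
    (ContinuousLinearEquiv.piCongrRight fun _ : Fin r => ContinuousLinearEquiv.equivOfInverse D.starL D.starL
      (fun x => star_star x) (fun x => star_star x)).toHomeomorph.measurableEmbedding
  have h5 := h2.integral_comp (MeasurableEquiv.measurableEmbedding _) fun γ => Φ fun i => star (γ i)
  simp only [h3] at h5
  exact h5.trans (h1.integral_comp h4 Φ)

theorem lastTr_eq_firstTr (γ : Fin r → D.Carrier) : lastTr γ = firstTr fun i => star (γ i.rev) := by
  rw [lastTr, firstTr, ← Equiv.sum_comp Fin.revPerm]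
  refine Finset.sum_congr rfl fun i _ => ?_
  rw [Fin.revPerm_apply, D.tr_star]
  refine if_congr ?_ rfl rfl
  have := i.2
  rw [Fin.val_rev]
  omega

theorem firstTr_smul (t : ℝ) (v : Fin r → D.Carrier) : firstTr (t • v) = t * firstTr v := by
  rw [firstTr, firstTr, Finset.mul_sum]
  refine Finset.sum_congr rfl fun i _ => ?_
  split_ifs
  · exact D.tr_smul _ _
  · simp

theorem outerH_smul (t : ℝ) (v : Fin r → D.Carrier) : outerH (t • v) = (t * t) • outerH v := by
  refine Herm.ext fun i j => ?_
  rw [Herm.smul_apply, outerH_apply, outerH_apply, Pi.smul_apply, Pi.smul_apply, star_smul, smul_mul_smul_comm]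
  rfl

/-- The Fourier transform of `f` as an iterated integral over the last column and the remaining
block. -/
theorem fourierH_rowBlk (hlam : lam ≠ 0) (hψ : HasFrequency ψ lam) (f : 𝓢(Herm D (r + 1), ℂ)) (q : ℝ)
    (γ : Fin r → D.Carrier) (Z : Herm D r) :
    fourierH ψ f (rowBlk D r ((q, fun i => star (γ i.rev)), Z)) =
      (hermDensity D (r + 1) lam : ℂ) * ∫ X, (∫ w : ℝ × (Fin r → D.Carrier),
        f (colBlk D r (X, w)) * charVal ψ (-colPairing w (q, γ))) * charVal ψ (-hermForm D r X Z) ∂hermVol D r := by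
  have emb : MeasurableEmbedding (colBlk D r) := (colBlk D r).toHomeomorph.measurableEmbedding
  have hi : Integrable (fun Y => f Y * charVal ψ (-hermForm D (r + 1) Y
      (rowBlk D r ((q, fun i => star (γ i.rev)), Z)))) (hermVol D (r + 1)) := by
    refine f.integrable.mul_bdd (c := 1) (Continuous.aestronglyMeasurable ?_) (.of_forall fun _ => (norm_charVal _ _).le)
    exact hψ.continuous.comp (((hermFormL D (r + 1)).flip _).continuous.neg)
  have hi' := (measurePreserving_colBlk.integrable_comp_emb emb).2 hi
  rw [fourierH_eq hlam hψ, ← measurePreserving_colBlk.integral_comp emb]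
  refine (congrArg _ (integral_prod _ hi')).trans ?_
  congr 2
  ext X
  rw [← integral_mul_const]
  congr 1
  ext w
  obtain ⟨d, b⟩ := w
  rw [Function.comp, hermForm_colBlk_rowBlk, colPairing, neg_add, charVal_add, mul_comm q d]
  ring

/-- The Fourier transform intertwines the column operator for `ψ` with the row operator for `ψ⁻¹`.
-/
theorem fourierH_colOp (hlam : lam ≠ 0) (hψ : HasFrequency ψ lam) {q : ℝ} (hq : q ≠ 0)
    (f : 𝓢(Herm D (r + 1), ℂ)) (Z : Herm D r) :
    fourierH ψ (colOp ψ lam q f) Z = ((|q| ^ (2 * r) : ℝ) : ℂ) * rowOp ψ⁻¹ q (fourierH ψ f) Z := by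
  -- the integrand in the block `X` and the dual column `γ`
  let I : Herm D r → (Fin r → D.Carrier) → ℂ := fun X γ =>
    (charVal ψ (-(q⁻¹ * quadH X γ) - q⁻¹ * lastTr γ) *
      ∫ w : ℝ × (Fin r → D.Carrier), f (colBlk D r (X, w)) * charVal ψ (-colPairing w (q, γ))) *
      charVal ψ (-hermForm D r X Z)
  have hI : Integrable (Function.uncurry I) ((hermVol D r).prod volume) := by
    obtain ⟨K, hK⟩ := exists_constFamily f
    obtain ⟨G, hG⟩ := exists_colIntegrand hlam hψ (q := fun _ : Fin 0 → ℝ => q) (qi := fun _ => q⁻¹)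
      (.const _) (.const _) K
    obtain ⟨G1, hG1⟩ := exists_comp_temperate
      (g := fun x : Herm D r × (Fin r → D.Carrier) => (((0 : Fin 0 → ℝ), x.1), x.2))
      (h := fun y => (y.1.2, y.2)) (by fun_prop) (by fun_prop) (fun x => rfl) G
    have hB : (fun x : Herm D r × (Fin r → D.Carrier) => -hermForm D r x.1 Z).HasTemperateGrowth :=
      ((((hermFormL D r).flip Z).hasTemperateGrowth).comp (hasTemperateGrowth_fst .id')).neg
    obtain ⟨G2, hG2⟩ := exists_mul_temperate (hψ.hasTemperateGrowth hB) G1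
    refine G2.integrable.congr (.of_forall fun x => ?_)
    simp only [hG2, hG1, hG, hK, Function.uncurry, I]
    ring
  -- The transform of the column operator as an integral over the dual column: in the variable `δ`,
  -- the reflection of `γ`, its integrand is `Ψ`, and `δ = q v` gives the integrand of the row
  -- operator.
  let Ψ : (Fin r → D.Carrier) → ℂ := fun δ =>
    charVal ψ (-(q⁻¹ * firstTr δ)) * fourierH ψ f (rowBlk D r ((q, δ), Z + q⁻¹ • outerH δ))
  have h1 : fourierH ψ (colOp ψ lam q f) Z = ∫ γ : Fin r → D.Carrier, Ψ fun i => star (γ i.rev) := by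
    have h2 : ∀ γ : Fin r → D.Carrier, Ψ (fun i => star (γ i.rev)) =
        (hermDensity D (r + 1) lam : ℂ) * ∫ X, I X γ ∂hermVol D r := fun γ => by
      simp only [Ψ]
      rw [fourierH_rowBlk hlam hψ, ← lastTr_eq_firstTr, mul_left_comm, ← integral_const_mul]
      congr 2
      ext X
      simp only [I]
      rw [hermForm_add_right, hermForm_smul_right, hermForm_outerH, neg_add, charVal_add, sub_eq_add_neg, charVal_add]
      ring
    simp only [h2, integral_const_mul]
    rw [fourierH_eq hlam hψ, ← integral_integral_swap hI, hermDensity_succ, Complex.ofReal_mul, mul_assoc,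
      ← integral_const_mul (((√|lam| * D.density lam ^ r : ℝ)) : ℂ)]
    congr 2
    ext X
    rw [colOp, mul_assoc, ← integral_mul_const]
  have h3 : ∀ v : Fin r → D.Carrier, Ψ (q • v) =
      fourierH ψ f (rowBlk D r ((q, q • v), Z + q • outerH v)) * charVal ψ⁻¹ (firstTr v) := fun v => by
    simp only [Ψ]
    rw [firstTr_smul, inv_mul_cancel_left₀ hq, outerH_smul, smul_smul, inv_mul_cancel_left₀ hq, charVal_inv, mul_comm]
  have h4 := Measure.integral_comp_smul (volume : Measure (Fin r → D.Carrier)) Ψ q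
  have h5 : Module.finrank ℝ (Fin r → D.Carrier) = 2 * r := by
    rw [Module.finrank_pi_fintype]
    simp [D.finrank_carrier, mul_comm]
  rw [h1, integral_rev_star, rowOp]
  simp only [← h3]
  rw [h4, h5, abs_inv, abs_pow, Complex.real_smul, ← mul_assoc, ← Complex.ofReal_mul, mul_inv_cancel₀ (by positivity),
    Complex.ofReal_one, one_mul]

/-- The Kloosterman integral of the Fourier transform of `colOp ψ lam q f` is, up to the factor from
the normalization, the one of the Fourier transform of `f` with `q` as additional first entry. -/
theorem kloosNorm_fourierH_colOp (hlam : lam ≠ 0) (hψ : HasFrequency ψ lam) {q : ℝ} (hq : q ≠ 0)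
    (f : 𝓢(Herm D (r + 1), ℂ)) {a : Fin r → ℝ} (ha : a ∈ torus r) :
    (((D.eta q * |q|⁻¹ : ℝ) : ℂ)) ^ r * kloosNorm ψ⁻¹ (fourierH ψ (colOp ψ lam q f)) a =
      kloosNorm ψ⁻¹ (fourierH ψ f) (Fin.cons q a : Fin (r + 1) → ℝ) := by
  obtain ⟨G, hG⟩ := exists_fourierH hlam hψ f
  have hG' : (G : Herm D (r + 1) → ℂ) = fourierH ψ f := funext hG
  have h1 := kloos_cons hψ.inv hq (fun i _ => ha i) G
  rw [hG'] at h1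
  have h2 : kloos ψ⁻¹ (fourierH ψ (colOp ψ lam q f)) a =
      ((|q| ^ (2 * r) : ℝ) : ℂ) * kloos ψ⁻¹ (rowOp ψ⁻¹ q (fourierH ψ f)) a := by
    simp only [kloos, ← integral_const_mul]
    congr 1
    ext u
    rw [kloosIntegrand, kloosIntegrand, fourierH_colOp hlam hψ hq, mul_assoc]
  rw [kloosNorm, kloosNorm, h1, h2, sigmaH_diagH_cons]
  have h3 : ((D.eta q * |q|⁻¹) ^ r) * |q| ^ (2 * r) = D.eta (q ^ r) * |q ^ r| := by
    have : |q| ≠ 0 := abs_ne_zero.2 hq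
    rw [D.eta_pow, abs_pow, mul_pow, inv_pow, two_mul, pow_add]
    field_simp
  have h4 := congrArg (fun x : ℝ => (x : ℂ)) h3
  rw [D.eta_mul, abs_mul]
  push_cast at h4 ⊢
  linear_combination (D.eta (sigmaH (diagH D a)) * |sigmaH (diagH D a)| *
    kloos ψ⁻¹ (rowOp ψ⁻¹ q (fourierH ψ f)) a : ℂ) * h4

end Intertwining

/-! ### The inversion formula -/

section Inversion
variable {D : QuadAlg} {n r : ℕ} {ψ : AddChar ℝ Circle} {lam : ℝ}

theorem kloosNorm_const_mul (κ : ℂ) (f : Herm D n → ℂ) (a : Fin n → ℝ) :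
    kloosNorm ψ (fun X => κ * f X) a = κ * kloosNorm ψ f a := by
  simp only [kloosNorm, kloos, kloosIntegrand, mul_assoc, integral_const_mul]
  ring

theorem fourierH_const_mul (hlam : lam ≠ 0) (hψ : HasFrequency ψ lam) (κ : ℂ) (f : Herm D n → ℂ) :
    fourierH ψ (fun X => κ * f X) = fun Y => κ * fourierH ψ f Y := by
  ext Y
  rw [fourierH_eq hlam hψ, fourierH_eq hlam hψ]
  simp only [mul_assoc, integral_const_mul]
  ring

/-- The column operator, normalized so that it acts on normalized Kloosterman integrals. -/
noncomputable def stepOp (ψ : AddChar ℝ Circle) (lam q : ℝ) (f : Herm D (r + 1) → ℂ) (X : Herm D r) : ℂ :=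
  (D.weilConst lam * ((D.eta q * |q|⁻¹ : ℝ) : ℂ)) ^ r * colOp ψ lam q f X

theorem exists_stepOp (hlam : lam ≠ 0) (hψ : HasFrequency ψ lam) (q : ℝ) (f : 𝓢(Herm D (r + 1), ℂ)) :
    ∃ G : 𝓢(Herm D r, ℂ), ∀ X, G X = stepOp ψ lam q f X := by
  obtain ⟨G, hG⟩ := exists_colOp_const hlam hψ q f
  exact ⟨(D.weilConst lam * ((D.eta q * |q|⁻¹ : ℝ) : ℂ)) ^ r • G, fun X => by
    rw [smul_apply, smul_eq_mul, hG, stepOp]⟩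

/-- The Fourier transform in the last entry, times the phase, turns the Kloosterman integral of `f`
into that of `stepOp ψ lam q f`, in one dimension less. -/
theorem integral_kloosNorm_stepOp (hlam : lam ≠ 0) (hψ : HasFrequency ψ lam) {p : Fin r → ℝ} (hp : p ∈ torus r)
    {q : ℝ} (hq : q ≠ 0) (f : 𝓢(Herm D (r + 1), ℂ)) :
    (∫ x, kloosNorm ψ f (Fin.snoc p x : Fin (r + 1) → ℝ) * charVal ψ (-(x * q)) ∂haarReal ψ) *
        charVal ψ (lastPhase p q) = kloosNorm ψ (stepOp ψ lam q f) p := by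
  rw [integral_kloosNorm_snoc hlam hψ hp hq, ← kloosNorm_const_mul]
  rfl

/-- On the side of the Fourier transform, passing from `f` to `stepOp ψ lam q f` removes the first
entry `q`, up to a power of the Weil constant. -/
theorem kloosNorm_fourierH_stepOp (hlam : lam ≠ 0) (hψ : HasFrequency ψ lam) {q : ℝ} (hq : q ≠ 0)
    (f : 𝓢(Herm D (r + 1), ℂ)) {a : Fin r → ℝ} (ha : a ∈ torus r) :
    kloosNorm ψ⁻¹ (fourierH ψ (stepOp ψ lam q f)) a =
      D.weilConst lam ^ r * kloosNorm ψ⁻¹ (fourierH ψ f) (Fin.cons q a : Fin (r + 1) → ℝ) := by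
  have h : stepOp ψ lam q f = fun X =>
    (D.weilConst lam * ((D.eta q * |q|⁻¹ : ℝ) : ℂ)) ^ r * colOp ψ lam q f X := rfl
  rw [← kloosNorm_fourierH_colOp hlam hψ hq f ha, h, fourierH_const_mul hlam hψ, kloosNorm_const_mul, mul_pow, mul_assoc]

theorem kloosNorm_zero (f : Herm D 0 → ℂ) (a : Fin 0 → ℝ) : kloosNorm ψ f a = f 0 := by
  have h1 : ∀ v : UpperIdx 0 → D.Carrier, kloosIntegrand ψ f a v = f 0 := fun v => by
    rw [kloosIntegrand, chiN_eq, Finset.univ_eq_empty, Finset.sum_empty, charVal_zero, mul_one]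
    exact congrArg f (Herm.ext fun i => i.elim0)
  simp [kloosNorm, kloos, h1, sigmaH_diagH, D.eta_one, Measure.real, volume_pi]

theorem fourierH_zero (hlam : lam ≠ 0) (hψ : HasFrequency ψ lam) (f : Herm D 0 → ℂ) (Y : Herm D 0) :
    fourierH ψ f Y = f 0 := by
  have h1 : ∀ X : Herm D 0, f X * charVal ψ (-hermForm D 0 X Y) = f 0 := fun X => by
    have : hermForm D 0 X Y = 0 := by simp [hermForm_eq, QuadAlg.toReal, tr_zero]
    rw [this, neg_zero, charVal_zero, mul_one]
    exact congrArg f (Herm.ext fun i => i.elim0)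
  have h2 : (hermVol D 0) Set.univ = 1 := by
    rw [← measurePreserving_hermCoords_symm.measure_preimage MeasurableSet.univ.nullMeasurableSet, Set.preimage_univ,
      Measure.volume_eq_prod, Measure.volume_pi_eq_dirac 0, Measure.volume_pi_eq_dirac 0, ← Set.univ_prod_univ,
      Measure.prod_prod]
    simp
  rw [fourierH_eq hlam hψ]
  simp [h1, Measure.real, h2, hermDensity]

/-- The phase of the inversion formula, in the order in which its terms arise from the successive
integrations. -/
noncomputable def stepPhase : (n : ℕ) → (Fin n → ℝ) → (Fin n → ℝ) → ℝ
  | 0, _, _ => 0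
  | n + 1, a, p => -(p (Fin.last n) * a 0) + lastPhase (Fin.init p) (a 0) + stepPhase n (Fin.tail a) (Fin.init p)

theorem lastPhase_succ (p : Fin (r + 1) → ℝ) (q : ℝ) : lastPhase p q = 1 / (q * p (Fin.last r)) := by
  rw [lastPhase, Fin.sum_univ_castSucc]
  have : ∀ i : Fin r, (i : ℕ) ≠ r := fun i => i.2.ne
  simp [this]

theorem inversionPhase_eq (m : ℕ) (a p : Fin (m + 1) → ℝ) : inversionPhase a p = stepPhase (m + 1) a p := by
  induction m with
  | zero => simp [inversionPhase, stepPhase, lastPhase, mul_comm (p 0)]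
  | succ m ih =>
    have e1 : ∑ i : Fin (m + 1 + 1), a i.rev * p i =
        ∑ i : Fin (m + 1), Fin.tail a i.rev * Fin.init p i + a 0 * p (Fin.last (m + 1)) := by
      rw [Fin.sum_univ_castSucc]
      simp [Fin.tail, Fin.init, Fin.rev_castSucc]
    have e2 : ∑ i : Fin (m + 1), 1 / (a i.rev.castSucc * p i.castSucc) =
        ∑ i : Fin m, 1 / (Fin.tail a i.rev.castSucc * Fin.init p i.castSucc) + 1 / (a 0 * p (Fin.last m).castSucc) := by
      rw [Fin.sum_univ_castSucc]
      simp [Fin.tail, Fin.init, Fin.rev_castSucc]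
    rw [stepPhase, ← ih, lastPhase_succ, inversionPhase, inversionPhase, e1, e2, Fin.init]
    ring

theorem nullSingletonClass_haarReal (hlam : lam ≠ 0) (hψ : HasFrequency ψ lam) : NullSingletonClass (haarReal ψ) := by
  rw [haarReal_eq hlam hψ]
  exact ⟨fun x => by simp⟩

theorem snoc_mem_torus {p : Fin n → ℝ} (hp : p ∈ torus n) {x : ℝ} (hx : x ≠ 0) :
    (Fin.snoc p x : Fin (n + 1) → ℝ) ∈ torus (n + 1) := fun i => by
  induction i using Fin.lastCases with
  | last => simpa using hx
  | cast i => simpa using hp i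

theorem ae_ne_zero {μ : Measure ℝ} [NullSingletonClass μ] : ∀ᵐ x ∂μ, x ≠ 0 := by
  simp [ae_iff]

/-- Only values off the coordinate hyperplanes matter for iterated integrals. -/
theorem iterInt_congr {μ : Measure ℝ} [NullSingletonClass μ] : ∀ {n : ℕ} {G G' : (Fin n → ℝ) → ℂ},
    (∀ p ∈ torus n, G p = G' p) → iterInt μ n G = iterInt μ n G'
  | 0, _, _, h => h _ fun i => i.elim0
  | n + 1, _, _, h => iterInt_congr (n := n) fun p hp => integral_congr_ae <| by
      filter_upwards [ae_ne_zero] with x hx using h _ (snoc_mem_torus hp hx)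

theorem iterIntegrable_congr {μ : Measure ℝ} [NullSingletonClass μ] : ∀ {n : ℕ} {G G' : (Fin n → ℝ) → ℂ},
    (∀ p ∈ torus n, G p = G' p) → IterIntegrable μ n G → IterIntegrable μ n G'
  | 0, _, _, _, _ => trivial
  | n + 1, _, _, h, hG => ⟨fun p hp => (hG.1 p hp).congr <| by
      filter_upwards [ae_ne_zero] with x hx using h _ (snoc_mem_torus hp hx),
      iterIntegrable_congr (n := n) (fun p hp => integral_congr_ae <| by
        filter_upwards [ae_ne_zero] with x hx using h _ (snoc_mem_torus hp hx)) hG.2⟩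

/-- The inversion formula, with the Weil constants on the side of the Fourier transform. -/
theorem iterInt_kloosNorm (hlam : lam ≠ 0) (hψ : HasFrequency ψ lam) (n : ℕ) (f : 𝓢(Herm D n, ℂ)) {a : Fin n → ℝ}
    (ha : a ∈ torus n) :
    IterIntegrable (haarReal ψ) n (fun p => kloosNorm ψ f p * charVal ψ (stepPhase n a p)) ∧
      iterInt (haarReal ψ) n (fun p => kloosNorm ψ f p * charVal ψ (stepPhase n a p)) =
        D.weilConst lam ^ n.choose 2 * kloosNorm ψ⁻¹ (fourierH ψ f) a := by
  have := nullSingletonClass_haarReal hlam hψ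
  induction n with
  | zero =>
    refine ⟨trivial, ?_⟩
    simp [iterInt, kloosNorm_zero, stepPhase, charVal_zero, fourierH_zero hlam hψ]
  | succ n ih =>
    obtain ⟨G, hG⟩ := exists_stepOp hlam hψ (a 0) f
    have hG' : (G : Herm D n → ℂ) = stepOp ψ lam (a 0) f := funext hG
    have ha' : Fin.tail a ∈ torus n := fun i => ha _
    -- The innermost integral is taken over the last variable; what remains is the iterated
    -- integral for `stepOp ψ lam (a 0) f` and the entries of `a` other than the first.
    obtain ⟨h1, h2⟩ := ih G ha'
    have h3 : ∀ (p : Fin n → ℝ) (x : ℝ), kloosNorm ψ f (Fin.snoc p x : Fin (n + 1) → ℝ) *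
        charVal ψ (stepPhase (n + 1) a (Fin.snoc p x : Fin (n + 1) → ℝ)) =
        kloosNorm ψ f (Fin.snoc p x : Fin (n + 1) → ℝ) * charVal ψ (-(x * a 0)) *
          (charVal ψ (lastPhase p (a 0)) * charVal ψ (stepPhase n (Fin.tail a) p)) := fun p x => by
      rw [stepPhase, Fin.init_snoc, Fin.snoc_last, charVal_add, charVal_add]
      ring
    have h4 : ∀ p ∈ torus n, kloosNorm ψ G p * charVal ψ (stepPhase n (Fin.tail a) p) =
        ∫ x, kloosNorm ψ f (Fin.snoc p x : Fin (n + 1) → ℝ) *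
          charVal ψ (stepPhase (n + 1) a (Fin.snoc p x : Fin (n + 1) → ℝ)) ∂haarReal ψ := fun p hp => by
      simp only [h3]
      rw [integral_mul_const, ← mul_assoc, integral_kloosNorm_stepOp hlam hψ hp (ha 0), hG']
    refine ⟨⟨fun p hp => ?_, iterIntegrable_congr h4 h1⟩, ?_⟩
    · simp only [h3]
      exact (integrable_kloosNorm_snoc hlam hψ hp f (a 0)).mul_const _
    · rw [iterInt, ← iterInt_congr h4, h2, hG', kloosNorm_fourierH_stepOp hlam hψ (ha 0) f ha', Fin.cons_self_tail,
        Nat.choose_succ_succ, Nat.choose_one_right, pow_add]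
      ring

end Inversion

/-! ### Kloosterman integrals of Schwartz families -/

section Families
variable {D : QuadAlg} {m n r : ℕ} {ψ : AddChar ℝ Circle} {lam : ℝ}

/-- The tensor product of two Schwartz functions. -/
theorem exists_tensor {E V : Type*} [NormedAddCommGroup E] [NormedSpace ℝ E] [FiniteDimensional ℝ E]
    [NormedAddCommGroup V] [NormedSpace ℝ V] [FiniteDimensional ℝ V] (g : 𝓢(E, ℂ)) (f : 𝓢(V, ℂ)) :
    ∃ K : 𝓢(E × V, ℂ), ∀ e x, K (e, x) = g e * f x := by
  suffices h : ∃ K : 𝓢(E × V, ℂ), ∀ z, K z = g z.1 * f z.2 from h.imp fun K hK e x => hK (e, x)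
  let T : 𝓢(E, ℂ) × 𝓢(V, ℂ) → E × V → ℂ := fun p z => p.1 z.1 * p.2 z.2
  have hT : ∀ p z, HasFDerivAt (T p) (p.1 z.1 • (fderiv ℝ p.2 z.2 ∘L ContinuousLinearMap.snd ℝ E V) +
      p.2 z.2 • (fderiv ℝ p.1 z.1 ∘L ContinuousLinearMap.fst ℝ E V)) z := fun p z =>
    ((p.1.differentiableAt.hasFDerivAt (x := z.1)).comp z hasFDerivAt_fst).mul
      ((p.2.differentiableAt.hasFDerivAt (x := z.2)).comp z hasFDerivAt_snd)
  refine exists_schwartzMap_of_set (Set.range T) ?_ ?_ ?_ ?_ ⟨(g, f), rfl⟩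
  · rintro _ ⟨p, rfl⟩
    refine ⟨SchwartzMap.seminorm ℝ 0 0 p.1 * SchwartzMap.seminorm ℝ 0 0 p.2, fun z => ?_⟩
    rw [norm_mul]
    exact mul_le_mul (norm_le_seminorm ℝ _ _) (norm_le_seminorm ℝ _ _) (norm_nonneg _) (apply_nonneg _ _)
  · rintro _ ⟨p, rfl⟩
    exact fun z => (hT p z).differentiableAt
  · rintro _ ⟨p, rfl⟩ v
    have h : (fun z => fderiv ℝ (T p) z v) = T (p.1, LineDeriv.lineDerivOp v.2 p.2) +
        T (LineDeriv.lineDerivOp v.1 p.1, p.2) := by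
      ext z
      rw [(hT p z).fderiv]
      simp [T, lineDerivOp_apply_eq_fderiv, mul_comm]
    rw [h]
    exact add_mem (Submodule.subset_span ⟨_, rfl⟩) (Submodule.subset_span ⟨_, rfl⟩)
  · rintro _ ⟨p, rfl⟩ l
    obtain ⟨g1, hg1⟩ := exists_mul_temperate (φ := fun e => ((l (e, 0) : ℝ) : ℂ)) (by
      have : (fun e : E => l (e, 0)).HasTemperateGrowth :=
        (l ∘L ContinuousLinearMap.inl ℝ E V).hasTemperateGrowth
      fun_prop) p.1
    obtain ⟨f1, hf1⟩ := exists_mul_temperate (φ := fun x => ((l (0, x) : ℝ) : ℂ)) (by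
      have : (fun x : V => l (0, x)).HasTemperateGrowth :=
        (l ∘L ContinuousLinearMap.inr ℝ E V).hasTemperateGrowth
      fun_prop) p.2
    have h : (fun z => (l z : ℂ) * T p z) = T (g1, p.2) + T (p.1, f1) := by
      ext z
      have : l z = l (z.1, 0) + l (0, z.2) := by rw [← map_add]; simp
      simp only [T, Pi.add_apply, hg1, hf1, this]
      push_cast
      ring
    rw [h]
    exact add_mem (Submodule.subset_span ⟨_, rfl⟩) (Submodule.subset_span ⟨_, rfl⟩)

theorem hasTemperateGrowth_prod {E ι : Type*} [NormedAddCommGroup E] [NormedSpace ℝ E] (s : Finset ι)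
    {f : ι → E → ℝ} (hf : ∀ i, (f i).HasTemperateGrowth) : (fun x => ∏ i ∈ s, f i x).HasTemperateGrowth := by
  classical
  induction s using Finset.induction_on with
  | empty => simp
  | insert i s hi ih =>
    simp only [Finset.prod_insert hi]
    have := hf i
    fun_prop

theorem hasTemperateGrowth_inv_signedParam (ε : Fin m → ℤˣ) (i : Fin m) :
    (fun t => (signedParam ε t i)⁻¹).HasTemperateGrowth := by
  simp only [inv_signedParam]
  fun_prop

theorem hasTemperateGrowth_signedParam_apply (ε : Fin m → ℤˣ) (i : Fin m) :
    (fun t => signedParam ε t i).HasTemperateGrowth :=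
  (hasTemperateGrowth_apply i).comp (hasTemperateGrowth_signedParam ε)

theorem eta_signedParam (ε : Fin m → ℤˣ) (t : Fin m → ℝ) (i : Fin m) :
    D.eta (signedParam ε t i) = D.eta (ε i : ℤ) := by
  have h : D.eta (posParam (t i)) = 1 := by
    cases D
    · simp [QuadAlg.eta, posParam_pos]
    · rfl
  rw [signedParam, D.eta_mul, h, mul_one]

theorem abs_signedParam (ε : Fin m → ℤˣ) (t : Fin m → ℝ) (i : Fin m) : |signedParam ε t i| = posParam (t i) := by
  rw [signedParam, abs_mul, abs_unit, one_mul, abs_of_pos (posParam_pos _)]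

/-- Kloosterman integrals of a Schwartz family are Schwartz functions of the parameters and of the
last diagonal entry, when the other diagonal entries are among the torus coordinates: by the row
operator, they are integrated out one after the other. -/
theorem exists_kloos_snoc (hψ : HasFrequency ψ lam) (ε : Fin m → ℤˣ) (ι : Fin r → Fin m)
    (G : 𝓢((Fin m → ℝ) × Herm D (r + 1), ℂ)) :
    ∃ K : 𝓢((Fin m → ℝ) × ℝ, ℂ), ∀ t x, K (t, x) =
      kloos ψ (fun X => G (t, X)) (Fin.snoc (fun i => signedParam ε t (ι i)) x : Fin (r + 1) → ℝ) := by
  induction r with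
  | zero =>
    obtain ⟨K, hK⟩ := exists_comp_temperate
      (g := fun z : (Fin m → ℝ) × ℝ => (z.1, (diagH D (fun _ => z.2) : Herm D 1)))
      (h := fun y => (y.1, D.toReal (y.2.1 0 0))) (by
        refine hasTemperateGrowth_prodMk (by fun_prop) (hasTemperateGrowth_herm fun i j => ?_)
        have : ∀ z : (Fin m → ℝ) × ℝ, (diagH D (fun _ => z.2) : Herm D 1).1 i j = z.2 • 1 := fun z => by
          rw [Subsingleton.elim i j, ← Algebra.algebraMap_eq_smul_one]; simp [diagH]
        simp only [this]
        fun_prop) (by fun_prop) (fun x => by simp [diagH]) G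
    refine ⟨K, fun t x => ?_⟩
    have : IsEmpty (UpperIdx 1) := ⟨fun p => p.2.ne (Subsingleton.elim _ _)⟩
    have h1 : ∀ v : UpperIdx 1 → D.Carrier, kloosIntegrand ψ (fun X => G (t, X))
        (Fin.snoc (fun i : Fin 0 => signedParam ε t (ι i)) x : Fin 1 → ℝ) v = K (t, x) := fun v => by
      have h2 : chiN ψ (unip v) = 1 := by simp [chiN_eq, charVal_zero]
      rw [kloosIntegrand, h2, mul_one, hK, unip_of_subsingleton (n := 1)]
      refine congrArg G (Prod.ext rfl (Herm.ext fun i j => ?_))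
      rw [hermAct_diagH_apply, Fin.fin_one_eq_zero i, Fin.fin_one_eq_zero j]
      simp [diagH, Fin.snoc, Algebra.algebraMap_eq_smul_one]
    simp [kloos, h1, Measure.real, volume_pi]
  | succ r ih =>
    obtain ⟨G1, hG1⟩ := exists_rowOp hψ (hasTemperateGrowth_signedParam_apply ε (ι 0))
      (hasTemperateGrowth_inv_signedParam ε (ι 0)) (fun t => inv_mul_cancel₀ (signedParam_mem ε t _)) G
    obtain ⟨K, hK⟩ := ih (fun i => ι i.succ) G1
    refine ⟨K, fun t x => ?_⟩
    let f : 𝓢(Herm D (r + 2), ℂ) := schwartzSlice G t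
    have hf' : (f : Herm D (r + 2) → ℂ) = fun X => G (t, X) := rfl
    have h1 := kloos_cons hψ (signedParam_mem ε t (ι 0)) (a := Fin.snoc (fun i => signedParam ε t (ι (Fin.succ i))) x)
      (fun i hi => by
        induction i using Fin.lastCases with
        | last => simp at hi
        | cast i => rw [Fin.snoc_castSucc]; exact signedParam_mem ε t _) f
    rw [hK, ← hf']
    simp only [hG1, ← hf']
    rw [← h1, Fin.cons_snoc_eq_snoc_cons]
    congr 2
    ext i
    induction i using Fin.cases <;> simp

/-- The same for normalized Kloosterman integrals: on a component of the torus the normalizing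
factor is a monomial in the positive coordinates, up to sign. -/
theorem exists_kloosNorm_snoc (hψ : HasFrequency ψ lam) (ε : Fin m → ℤˣ) (ι : Fin r → Fin m)
    (G : 𝓢((Fin m → ℝ) × Herm D (r + 1), ℂ)) :
    ∃ K : 𝓢((Fin m → ℝ) × ℝ, ℂ), ∀ t x, K (t, x) =
      kloosNorm ψ (fun X => G (t, X)) (Fin.snoc (fun i => signedParam ε t (ι i)) x : Fin (r + 1) → ℝ) := by
  obtain ⟨K, hK⟩ := exists_kloos_snoc hψ ε ι G
  have hS : ∀ t x, sigmaH (diagH D (Fin.snoc (fun i => signedParam ε t (ι i)) x : Fin (r + 1) → ℝ)) =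
      ∏ j : Fin r, signedParam ε t (ι j) ^ (r - (j : ℕ)) := fun t x => by
    rw [sigmaH_diagH, Fin.prod_univ_castSucc]
    simp
  obtain ⟨K', hK'⟩ := exists_mul_temperate (φ := fun z : (Fin m → ℝ) × ℝ =>
    ((∏ j : Fin r, (D.eta (ε (ι j) : ℤ) * posParam (z.1 (ι j))) ^ (r - (j : ℕ)) : ℝ) : ℂ)) (by
      have : ∀ j : Fin r, (fun z : (Fin m → ℝ) × ℝ =>
        (D.eta (ε (ι j) : ℤ) * posParam (z.1 (ι j))) ^ (r - (j : ℕ))).HasTemperateGrowth := fun j => by fun_prop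
      have := hasTemperateGrowth_prod Finset.univ this
      fun_prop) K
  refine ⟨K', fun t x => ?_⟩
  rw [hK', hK, kloosNorm, hS, D.eta_prod, Finset.abs_prod, ← Finset.prod_mul_distrib]
  simp only [D.eta_pow, abs_pow, ← mul_pow, eta_signedParam, abs_signedParam]

end Families

/-! ### The Jacquet space -/

section Jacquet
variable {D : QuadAlg} {m n r k : ℕ} {ψ : AddChar ℝ Circle} {lam : ℝ}

/-- The last `k + 1` coordinates. -/
def lastCoords {m k : ℕ} (hk : k ≤ m) (a : Fin (m + 1) → ℝ) (j : Fin (k + 1)) : ℝ :=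
  a ⟨m - k + j, by omega⟩

/-- A family of Schwartz functions on `H`, parametrized by `(ℝˣ)^m`, whose product with any Schwartz
function on `(ℝˣ)^m` is a Schwartz function of all variables, on every orthant in the coordinates
of `signedParam`. -/
def IsSchwartzFamily {V : Type*} [NormedAddCommGroup V] [NormedSpace ℝ V] (F : (Fin m → ℝ) → 𝓢(V, ℂ)) : Prop :=
  ∀ g : 𝓢(Fin m → ℝ, ℂ), FlatOff (torus m) g → ∀ ε : Fin m → ℤˣ, ∃ G : 𝓢((Fin m → ℝ) × V, ℂ),
    ∀ t x, G (t, x) = g (signedParam ε t) * F (signedParam ε t) x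

/-- The starting point of the induction: the function `f` itself. -/
theorem isSchwartzFamily_const {V : Type*} [NormedAddCommGroup V] [NormedSpace ℝ V] [FiniteDimensional ℝ V]
    (f : 𝓢(V, ℂ)) : IsSchwartzFamily fun _ : Fin m → ℝ => f := fun g hg ε => by
  obtain ⟨G, hG⟩ := exists_pullback_flat ε g hg
  obtain ⟨K, hK⟩ := exists_tensor G f
  exact ⟨K, fun t x => by rw [hK, hG]⟩

/-- `stepOp` as a map of Schwartz functions. -/
noncomputable def stepSchwartz (hlam : lam ≠ 0) (hψ : HasFrequency ψ lam) (q : ℝ) (f : 𝓢(Herm D (r + 1), ℂ)) :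
    𝓢(Herm D r, ℂ) := (exists_stepOp hlam hψ q f).choose

theorem stepSchwartz_apply (hlam : lam ≠ 0) (hψ : HasFrequency ψ lam) (q : ℝ) (f : 𝓢(Herm D (r + 1), ℂ)) :
    (stepSchwartz hlam hψ q f : Herm D r → ℂ) = stepOp ψ lam q f :=
  funext (exists_stepOp hlam hψ q f).choose_spec

theorem colOp_const_mul (κ : ℂ) (q : ℝ) (f : Herm D (r + 1) → ℂ) (X : Herm D r) :
    colOp ψ lam q (fun X => κ * f X) X = κ * colOp ψ lam q f X := by
  simp only [colOp, mul_assoc, integral_const_mul, mul_left_comm _ κ]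

/-- Schwartz families are preserved by `stepOp` with one of the parameters as entry. -/
theorem IsSchwartzFamily.step (hlam : lam ≠ 0) (hψ : HasFrequency ψ lam) {F : (Fin m → ℝ) → 𝓢(Herm D (r + 1), ℂ)}
    (hF : IsSchwartzFamily F) (i : Fin m) : IsSchwartzFamily fun t => stepSchwartz hlam hψ (t i) (F t) :=
  fun g hg ε => by
    obtain ⟨G, hG⟩ := hF g hg ε
    obtain ⟨G1, hG1⟩ := exists_colOp hlam hψ (hasTemperateGrowth_signedParam_apply ε i)
      (hasTemperateGrowth_inv_signedParam ε i) G
    obtain ⟨G2, hG2⟩ := exists_mul_temperate (φ := fun z : (Fin m → ℝ) × Herm D r =>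
      (D.weilConst lam * ((D.eta (ε i : ℤ) * posParamInv (z.1 i) : ℝ) : ℂ)) ^ r) (by
        have : (fun z : (Fin m → ℝ) × Herm D r => D.eta (ε i : ℤ) * posParamInv (z.1 i)).HasTemperateGrowth := by fun_prop
        fun_prop) G1
    refine ⟨G2, fun t X => ?_⟩
    rw [stepSchwartz_apply, hG2, hG1, stepOp, eta_signedParam, abs_signedParam, ← posParamInv_eq]
    simp only [hG]
    rw [colOp_const_mul]
    ring

theorem lastCoords_snoc (hk : k ≤ m) (b : Fin m → ℝ) (x : ℝ) :
    lastCoords hk (Fin.snoc b x : Fin (m + 1) → ℝ) =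
      (Fin.snoc (fun j : Fin k => b ⟨m - k + j, by omega⟩) x : Fin (k + 1) → ℝ) := by
  ext j
  induction j using Fin.lastCases with
  | last =>
    have : (⟨m - k + k, by omega⟩ : Fin (m + 1)) = Fin.last m := Fin.ext (by simp; omega)
    simp only [lastCoords, Fin.val_last, Fin.snoc_last, this]
  | cast j =>
    have : (⟨m - k + j, by omega⟩ : Fin (m + 1)) = Fin.castSucc ⟨m - k + j, by omega⟩ := rfl
    simp only [lastCoords, Fin.val_castSucc, Fin.snoc_castSucc, this]

/-- Kloosterman integrals of Schwartz families are Schwartz along the fibers. -/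
theorem IsSchwartzFamily.isFiberSchwartz (hψ : HasFrequency ψ lam) {F : (Fin m → ℝ) → 𝓢(Herm D (k + 1), ℂ)}
    (hF : IsSchwartzFamily F) (hk : k ≤ m) {h : (Fin (m + 1) → ℝ) → ℂ}
    (hh : ∀ a ∈ torus (m + 1), h a = kloosNorm ψ (F (Fin.init a)) (lastCoords hk a)) : IsFiberSchwartz h := by
  refine isFiberSchwartz_of_signedParam h (fun a => kloosNorm ψ (F (Fin.init a)) (lastCoords hk a))
    (fun a ha => (hh a ha).symm) fun g hg ε => ?_
  obtain ⟨G, hG⟩ := hF g hg ε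
  obtain ⟨K, hK⟩ := exists_kloosNorm_snoc hψ ε (fun j : Fin k => (⟨m - k + j, by omega⟩ : Fin m)) G
  refine ⟨K, fun t x => ?_⟩
  simp only [hK, hG, kloosNorm_const_mul, Fin.init_snoc, lastCoords_snoc]

theorem fourierLast_snoc (ψ : AddChar ℝ Circle) (h : (Fin (m + 1) → ℝ) → ℂ) (b : Fin m → ℝ) (y : ℝ) :
    fourierLast ψ h (Fin.snoc b y) = ∫ x, h (Fin.snoc b x) * charVal ψ (-(x * y)) ∂haarReal ψ := by
  rw [fourierLast, fourierB, Fin.init_snoc, Fin.snoc_last]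
  rfl

/-- Only values of `h` on the torus matter for the Fourier transform in the last coordinate, since
the rest is a null set on each fiber. -/
theorem fourierLast_congr (hlam : lam ≠ 0) (hψ : HasFrequency ψ lam) {h h' : (Fin (m + 1) → ℝ) → ℂ}
    (hh : ∀ a ∈ torus (m + 1), h a = h' a) {b : Fin m → ℝ} (hb : b ∈ torus m) (y : ℝ) :
    fourierLast ψ h (Fin.snoc b y) = ∫ x, h' (Fin.snoc b x) * charVal ψ (-(x * y)) ∂haarReal ψ := by
  have := nullSingletonClass_haarReal hlam hψ
  rw [fourierLast_snoc]
  refine integral_congr_ae ?_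
  filter_upwards [ae_ne_zero] with x hx
  rw [hh _ (snoc_mem_torus hb hx)]

/-- A step of the Jacquet transform replaces the family by its image under `stepOp`. -/
theorem jacquetStepAt_eq (hlam : lam ≠ 0) (hψ : HasFrequency ψ lam) (hk : k + 1 ≤ m)
    {F : (Fin m → ℝ) → 𝓢(Herm D (k + 2), ℂ)}
    (hdep : ∀ t t' : Fin m → ℝ, (∀ i : Fin m, (i : ℕ) + (k + 1) < m → t i = t' i) → F t = F t')
    {h : (Fin (m + 1) → ℝ) → ℂ}
    (hh : ∀ a ∈ torus (m + 1), h a = kloosNorm ψ (F (Fin.init a)) (lastCoords hk a))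
    {a : Fin (m + 1) → ℝ} (ha : a ∈ torus (m + 1)) :
    jacquetStepAt ψ (k + 1) h a =
      kloosNorm ψ (stepSchwartz hlam hψ (Fin.init a ⟨m - (k + 1), by omega⟩) (F (Fin.init a)))
        (lastCoords (k.le_succ.trans hk) a) := by
  set i : Fin (m + 1) := ⟨m - (k + 1), by omega⟩ with hi
  have hb : i.removeNth a ∈ torus m := fun j => ha _
  have hlow : ∀ j : Fin m, (j : ℕ) + (k + 1) < m → i.removeNth a j = Fin.init a j := fun j hj => by
    rw [Fin.removeNth, Fin.succAbove_of_castSucc_lt _ _ (Fin.lt_def.2 (by simp [hi]; omega))]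
    rfl
  have hhigh : ∀ (j : ℕ) (hj : j < k + 1), i.removeNth a ⟨m - (k + 1) + j, by omega⟩ = a ⟨m - k + j, by omega⟩ :=
    fun j hj => by
      rw [Fin.removeNth, Fin.succAbove_of_le_castSucc _ _ (Fin.le_def.2 (by simp [hi]))]
      congr 1
      ext
      simp
      omega
  have hp : lastCoords (k.le_succ.trans hk) a ∈ torus (k + 1) := fun j => ha _
  have hq : a i ≠ 0 := ha i
  rw [jacquetStepAt, jacquetStep, fourierLast_congr hlam hψ hh hb, stepSchwartz_apply]
  refine Eq.trans ?_ (integral_kloosNorm_stepOp hlam hψ hp hq (F (Fin.init a)))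
  congr 1
  · congr 1
    ext x
    rw [Fin.init_snoc, hdep _ _ hlow, lastCoords_snoc]
    congr 3
    ext j
    exact hhigh j j.2
  · rw [lastPhase_succ]
    have : lastCoords (k.le_succ.trans hk) a (Fin.last k) = a (Fin.last m) :=
      congrArg a (Fin.ext (by simp; omega))
    rw [this]
    rfl

theorem lastCoords_succ (hk : k + 1 ≤ m) (a : Fin (m + 1) → ℝ) :
    lastCoords hk a = (Fin.cons (Fin.init a ⟨m - (k + 1), by omega⟩) (lastCoords (k.le_succ.trans hk) a) : Fin (k + 2) → ℝ) := by
  ext j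
  induction j using Fin.cases with
  | zero => rfl
  | succ j =>
    refine congrArg a (Fin.ext ?_)
    simp
    omega

/-- The last `k + 1` coordinates of `a` are the diagonal entries of the Kloosterman integral, and
the others have become parameters of the Schwartz function `F`, which by `hdep` depends on those
only. Each step of the Jacquet transform moves one coordinate from the diagonal to the parameters.
-/
theorem memJacquet_kloosNorm (hlam : lam ≠ 0) (hψ : HasFrequency ψ lam) (k : ℕ) (hk : k ≤ m)
    (F : (Fin m → ℝ) → 𝓢(Herm D (k + 1), ℂ)) (hF : IsSchwartzFamily F)
    (hdep : ∀ t t' : Fin m → ℝ, (∀ i : Fin m, (i : ℕ) + k < m → t i = t' i) → F t = F t')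
    (h : (Fin (m + 1) → ℝ) → ℂ)
    (hh : ∀ a ∈ torus (m + 1), h a = kloosNorm ψ (F (Fin.init a)) (lastCoords hk a)) :
    MemJacquet ψ k h ∧ ∀ a ∈ torus (m + 1), jacquetIter ψ k h a =
      D.weilConst lam ^ (k + 1).choose 2 * kloosNorm ψ⁻¹ (fourierH ψ (F (Fin.init a))) (lastCoords hk a) := by
  induction k generalizing h with
  | zero =>
    refine ⟨hF.isFiberSchwartz hψ hk hh, fun a ha => ?_⟩
    have hb : Fin.init a ∈ torus m := fun j => ha _
    have hq : a (Fin.last m) ≠ 0 := ha _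
    have h0 : ∀ p : Fin 0 → ℝ, p ∈ torus 0 := fun p i => i.elim0
    -- In dimension one, the step is the Fourier transform on `ℝ` itself, without phase.
    have h1 := integral_kloosNorm_stepOp hlam hψ (h0 Fin.elim0) hq (F (Fin.init a))
    have h2 := kloosNorm_fourierH_stepOp hlam hψ hq (F (Fin.init a)) (h0 Fin.elim0)
    have h3 : ∀ x : ℝ, lastCoords hk (Fin.snoc (Fin.init a) x : Fin (m + 1) → ℝ) =
        (Fin.snoc (Fin.elim0 : Fin 0 → ℝ) x : Fin 1 → ℝ) := fun x => by
      rw [lastCoords_snoc, Subsingleton.elim (fun j : Fin 0 => _) (Fin.elim0 : Fin 0 → ℝ)]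
    have h4 : lastCoords hk a = (Fin.cons (a (Fin.last m)) (Fin.elim0 : Fin 0 → ℝ) : Fin 1 → ℝ) := by
      ext j
      rw [Fin.fin_one_eq_zero j]
      rfl
    rw [kloosNorm_zero, fourierH_zero hlam hψ, pow_zero, one_mul, ← h4] at h2
    rw [kloosNorm_zero, h2, lastPhase, Finset.univ_eq_empty, Finset.sum_empty, charVal_zero, mul_one] at h1
    rw [jacquetIter, ← Fin.snoc_init_self a, fourierLast_congr hlam hψ hh hb, Fin.snoc_init_self]
    simp only [h3, Fin.init_snoc, h1]
    simp
  | succ k ih =>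
    -- The family after one step, in which the coordinate at position `m - (k + 1)` has become a
    -- parameter.
    let F' : (Fin m → ℝ) → 𝓢(Herm D (k + 1), ℂ) := fun t => stepSchwartz hlam hψ (t ⟨m - (k + 1), by omega⟩) (F t)
    have hF' : IsSchwartzFamily F' := hF.step hlam hψ _
    have hdep' : ∀ t t' : Fin m → ℝ, (∀ i : Fin m, (i : ℕ) + k < m → t i = t' i) → F' t = F' t' := fun t t' ht => by
      have e1 := ht ⟨m - (k + 1), by omega⟩ (show m - (k + 1) + k < m by omega)
      have e2 := hdep t t' fun i hi => ht i (by omega)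
      simp only [F', e1, e2]
    have hh' : ∀ a ∈ torus (m + 1), jacquetStepAt ψ (k + 1) h a =
        kloosNorm ψ (F' (Fin.init a)) (lastCoords (k.le_succ.trans hk) a) :=
      fun a ha => jacquetStepAt_eq hlam hψ hk hdep hh ha
    have key := ih (k.le_succ.trans hk) F' hF' hdep' _ hh'
    refine ⟨⟨hF.isFiberSchwartz hψ hk hh, key.1⟩, fun a ha => ?_⟩
    have hq : Fin.init a ⟨m - (k + 1), by omega⟩ ≠ 0 := ha _
    have hp : lastCoords (k.le_succ.trans hk) a ∈ torus (k + 1) := fun j => ha _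
    rw [jacquetIter, key.2 a ha, stepSchwartz_apply,
      kloosNorm_fourierH_stepOp hlam hψ hq _ hp, ← lastCoords_succ hk,
      Nat.choose_succ_succ (k + 1), Nat.choose_one_right, pow_add]
    ring

end Jacquet

/-! ### The inversion formula and the Jacquet transform -/

theorem mainTheorem3 (D : QuadAlg) (ψ : AddChar ℝ Circle) (hcont : Continuous ψ) (hψ : ψ ≠ 1) :
    ∃ c c' : ℂ, IsWeilConstant D ψ c ∧ IsWeilConstant D ψ⁻¹ c' ∧
      ∀ (m : ℕ) (f : 𝓢(Herm D (m + 1), ℂ)),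
        -- the Kloosterman integrals involved converge absolutely
        (∀ a ∈ torus (m + 1), Integrable (kloosIntegrand ψ f a) ∧
          Integrable (kloosIntegrand ψ⁻¹ (fourierH ψ f) a)) ∧
        -- the inversion formula, the right side converging as an iterated integral
        (∀ a ∈ torus (m + 1),
          IterIntegrable (haarReal ψ) (m + 1)
            (fun p => kloosNorm ψ f p * (ψ (inversionPhase a p) : ℂ)) ∧
          kloosNorm ψ⁻¹ (fourierH ψ f) a =
            c' ^ ((m + 1) * m / 2) * iterInt (haarReal ψ) (m + 1)
              (fun p => kloosNorm ψ f p * (ψ (inversionPhase a p) : ℂ))) ∧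
        -- the same in terms of the Jacquet space and the Jacquet transform
        kloosNorm ψ f ∈ JacquetSpace m ψ ∧
        ∀ a ∈ torus (m + 1),
          jacquetTransform ψ (kloosNorm ψ f) a =
            c ^ ((m + 1) * m / 2) * kloosNorm ψ⁻¹ (fourierH ψ f) a := by
  obtain ⟨lam, hlam, hfreq⟩ := exists_frequency ψ hcont hψ
  have hψ' : HasFrequency ψ lam := hfreq
  refine ⟨D.weilConst lam, D.weilConst (-lam), D.isWeilConstant_weilConst hlam hψ',
    D.isWeilConstant_weilConst (neg_ne_zero.2 hlam) hψ'.inv, fun m f => ⟨fun a ha => ⟨?_, ?_⟩, fun a ha => ?_, ?_⟩⟩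
  · exact integrable_kloosIntegrand hψ' (fun i _ => ha i) f
  · obtain ⟨G, hG⟩ := exists_fourierH hlam hψ' f
    have h := integrable_kloosIntegrand hψ'.inv (fun i _ => ha i) G
    rwa [show (G : Herm D (m + 1) → ℂ) = fourierH ψ f from funext hG] at h
  · have h := iterInt_kloosNorm hlam hψ' (m + 1) f ha
    simp only [← inversionPhase_eq] at h
    refine ⟨h.1, ?_⟩
    -- The power of `c` from `iterInt_kloosNorm` is moved to the other side, as `c * c' = 1`.
    have e : D.weilConst (-lam) ^ ((m + 1) * m / 2) * D.weilConst lam ^ ((m + 1) * m / 2) = 1 := by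
      rw [← mul_pow, mul_comm, D.weilConst_mul_neg hlam, one_pow]
    have h2 := h.2
    rw [Nat.choose_two_right, Nat.add_sub_cancel] at h2
    refine Eq.trans ?_ (congrArg (D.weilConst (-lam) ^ ((m + 1) * m / 2) * ·) h2.symm)
    rw [← mul_assoc, e, one_mul]
  · have hl : ∀ a : Fin (m + 1) → ℝ, lastCoords le_rfl a = a := fun a => by
      ext j
      exact congrArg a (Fin.ext (by simp))
    have h := memJacquet_kloosNorm hlam hψ' m le_rfl (fun _ => f) (isSchwartzFamily_const f) (fun _ _ _ => rfl)
      (kloosNorm ψ f) fun a _ => by rw [hl]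
    refine ⟨h.1, fun a ha => ?_⟩
    rw [jacquetTransform, h.2 a ha, hl, Nat.choose_two_right, Nat.add_sub_cancel]
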